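/- Let $T>0$, $\mu,\sigma,g:\mathbb R\to\mathbb R$ and $f:[0,T]\times\mathbb R^3\to\mathbb R$. Call a continuous $\lambda:[0,\infty)\to(0,\infty)$ a growth function if $\lim_{s\to\infty}\lambda(s)=\infty$ and $\int_0^\infty \frac{ds}{s\lambda(s)}=\infty$. Assume: 1. $\mu,\sigma\in C^2(\mathbb R)$ and $f\in C^2([0,T]\times\mathbb R^3)$; $f$ and its first- and second-order derivatives are bounded and uniformly continuous on $[0,T]\times\mathbb R\times B$ for every bounded $B\subset\mathbb R^2$. 2. There are $C>0$ and a growth function $\lambda$ with $\max\{f(t,x,y,0),-f(t,x,-y,0)\}\le C+y\lambda(y)$ for all $(t,x,y)\in[0,T]\times\mathbb R\times[0,\infty)$. 3. $\sigma^2(x)>0$ for all $x\in\mathbb R$. 4. For every $M>0$ there are $C_0>0$ and a growth function $\lambda_0$ with $|z|\,\partial_yf(t,x,y,\sigma(x)z)\le|z|\lambda_0(z)+C_0$ for all $(t,x)\in[0,T]\times\mathbb R$, $|y|\le M$, $z\ge0$. 5. $g\in C^2(\mathbb R)$, and $g,g',g''$ are bounded. 6. There is $L>0$ with $|f(t,x,y,z)-f(t,x,y',z')|\le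 L(|y-y'|+|z-z'|)$ for all $(t,x)\in[0,T]\times\mathbb R$ and $y,y',z,z'\in\mathbb R$. 7. $\mu$ and $\sigma$ are globally Lipschitz continuous. Suppose that the terminal value problem $$\partial_tu+\mu(x)\,\partial_xu+\tfrac12\sigma^2(x)\,\partial_{xx}u+f(t,x,u,\sigma(x)\partial_xu)=0\ \text{ on }[0,T]\times\mathbb R,\qquad u(T,\cdot)=g,$$ has a unique classical solution $u$, that is, a unique solution among the functions in $C^{1,2}([0,T]\times\mathbb R)$ of polynomial growth in $x$ uniformly in $t$. For $\Delta x>0$ and $N_0\in\mathbb N$ put $N=2N_0+1$ and $x_i=i\Delta x$, $-N_0\le i\le N_0$. For $z=(z_i)_{|i|\le N_0}\in\mathbb R^N$ let $(D_1z)_i=\frac{z_{i+1}-z_{i-1}}{2\Delta x}$ and $(D_2z)_i=\frac{z_{i+1}-2z_i+z_{i-1}}{\Delta x^2}$ for $|i|<N_0$, and $(D_1z)_i=(D_2z)_i=0$ for $|i|=N_0$. Then the system $$\frac{dU_{t,i}}{dt}+\mu(x_i)(D_1U_t)_i+\tfrac12\sigma^2(x_i)(D_2U_t)_i+f\big(t,x_i,U_{t,i},\sigma(x_i)(D_1U_t)_i\big)=0,\qquad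 U_{T,i}=g(x_i),\qquad |i|\le N_0,$$ has a unique solution $U^{(N,\Delta x)}$ on $[0,T]$, and for every compact $K\subset\mathbb R$ $$\lim_{\Delta x\to0^+}\ \lim_{N_0\to\infty}\ \sup_{|i|\le N_0,\ i\Delta x\in K}\big|u(t,i\Delta x)-U^{(N,\Delta x)}_{t,i}\big|=0$$ for every $t\in[0,T]$, and also uniformly in time, i.e. with the supremum taken over $t\in[0,T]$ as well. Here the inner limits exist and are finite for every $\Delta x>0$, and the supremum over the empty set is $0$. -/

import Mathlib

open Set Filter Topology MeasureTheory
open scoped NNReal ENNReal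

namespace MethodOfLines

/-! ### The data: coefficients `μ`, `σ`, driver `f`, terminal function `g` -/

/-- The driver `f(t,x,y,z)` as a function of one variable in `ℝ⁴`. -/
def uncurry4 (f : ℝ → ℝ → ℝ → ℝ → ℝ) (p : ℝ × ℝ × ℝ × ℝ) : ℝ :=
  f p.1 p.2.1 p.2.2.1 p.2.2.2

/-- The set `[0,T] × ℝ × B`. -/
def slab (T : ℝ) (B : Set (ℝ × ℝ)) : Set (ℝ × ℝ × ℝ × ℝ) :=
  {p | p.1 ∈ Icc 0 T ∧ p.2.2 ∈ B}

/-- Admissible growth functions: `ν : [0,∞) → (0,∞)` continuous, `ν(s) → ∞`, and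
`∫₀^∞ ds / (s ν(s)) = ∞`. -/
structure IsGrowthFunction (ν : ℝ → ℝ) : Prop where
  continuousOn : ContinuousOn ν (Ici 0)
  pos : ∀ s, 0 ≤ s → 0 < ν s
  tendsto : Tendsto ν atTop atTop
  integral_eq_top : ∫⁻ s in Ioi (0 : ℝ), ENNReal.ofReal (1 / (s * ν s)) = ⊤

/-- The structural assumptions on the data of the terminal value problem. -/
structure WalterAssumption (T : ℝ) (μ σ : ℝ → ℝ) (f : ℝ → ℝ → ℝ → ℝ → ℝ) (g : ℝ → ℝ) :
    Prop where
  contDiff_drift : ContDiff ℝ 2 μ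
  contDiff_diffusion : ContDiff ℝ 2 σ
  contDiffOn_driver : ContDiffOn ℝ 2 (uncurry4 f) (slab T univ)
  /-- `f` and its derivatives of order one and two are bounded on `[0,T] × ℝ × B`. -/
  bounded_driver : ∀ B : Set (ℝ × ℝ), Bornology.IsBounded B → ∀ k : ℕ, k ≤ 2 →
    ∃ C : ℝ, ∀ p ∈ slab T B, ‖iteratedFDerivWithin ℝ k (uncurry4 f) (slab T univ) p‖ ≤ C
  /-- `f` and its derivatives of order one and two are uniformly continuous on
  `[0,T] × ℝ × B`. -/
  uniformContinuousOn_driver : ∀ B : Set (ℝ × ℝ), Bornology.IsBounded B → ∀ k : ℕ, k ≤ 2 →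
    UniformContinuousOn (iteratedFDerivWithin ℝ k (uncurry4 f) (slab T univ)) (slab T B)
  growth_driver : ∃ C : ℝ, 0 < C ∧ ∃ ν : ℝ → ℝ, IsGrowthFunction ν ∧
    ∀ t ∈ Icc 0 T, ∀ x y : ℝ, 0 ≤ y → max (f t x y 0) (-f t x (-y) 0) ≤ C + y * ν y
  diffusion_pos : ∀ x, 0 < σ x ^ 2
  growth_deriv_driver : ∀ M : ℝ, 0 < M → ∃ C₀ : ℝ, 0 < C₀ ∧ ∃ ν₀ : ℝ → ℝ,
    IsGrowthFunction ν₀ ∧ ∀ t ∈ Icc 0 T, ∀ x y z : ℝ, |y| ≤ M → 0 ≤ z →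
      |z| * deriv (fun y' => f t x y' (σ x * z)) y ≤ |z| * ν₀ z + C₀
  contDiff_terminal : ContDiff ℝ 2 g
  bounded_terminal : ∀ k : ℕ, k ≤ 2 → ∃ C : ℝ, ∀ x, |iteratedDeriv k g x| ≤ C

/-- Global Lipschitz continuity of the driver in its last two variables. -/
def LipschitzDriver (T : ℝ) (f : ℝ → ℝ → ℝ → ℝ → ℝ) : Prop :=
  ∃ L : ℝ, 0 < L ∧ ∀ t ∈ Icc 0 T, ∀ x y y' z z' : ℝ,
    |f t x y z - f t x y' z'| ≤ L * (|y - y'| + |z - z'|)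

/-- Global Lipschitz continuity of the drift and the diffusion coefficient. -/
def LipschitzCoefficients (μ σ : ℝ → ℝ) : Prop :=
  ∃ L : ℝ, 0 < L ∧ ∀ x x' : ℝ, |μ x - μ x'| + |σ x - σ x'| ≤ L * |x - x'|

/-! ### The partial differential equation -/

/-- `u` is of class `C^{1,2}` on `[0,T] × ℝ`: `u`, `∂ₜu`, `∂ₓu`, `∂ₓₓu` exist there and are
continuous (the time derivative is one-sided at `t = 0` and `t = T`). -/
structure IsC12 (T : ℝ) (u : ℝ → ℝ → ℝ) : Prop where
  differentiable_time : ∀ t ∈ Icc 0 T, ∀ x,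
    DifferentiableWithinAt ℝ (fun s => u s x) (Icc 0 T) t
  contDiff_space : ∀ t ∈ Icc 0 T, ContDiff ℝ 2 (u t)
  continuousOn : ContinuousOn (fun p : ℝ × ℝ => u p.1 p.2) (Icc 0 T ×ˢ univ)
  continuousOn_dt : ContinuousOn
    (fun p : ℝ × ℝ => derivWithin (fun s => u s p.2) (Icc 0 T) p.1) (Icc 0 T ×ˢ univ)
  continuousOn_dx : ContinuousOn (fun p : ℝ × ℝ => deriv (u p.1) p.2) (Icc 0 T ×ˢ univ)
  continuousOn_dxx : ContinuousOn
    (fun p : ℝ × ℝ => iteratedDeriv 2 (u p.1) p.2) (Icc 0 T ×ˢ univ)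

/-- `u ∈ C^{1,2}([0,T] × ℝ)`, of polynomial growth in `x` uniformly in `t`, is a classical
solution of the terminal value problem
`∂ₜu + μ ∂ₓu + ½ σ² ∂ₓₓu + f(t, x, u, σ ∂ₓu) = 0` on `[0,T] × ℝ`, `u(T,·) = g`. -/
structure IsClassicalSolution (T : ℝ) (μ σ : ℝ → ℝ) (f : ℝ → ℝ → ℝ → ℝ → ℝ) (g : ℝ → ℝ)
    (u : ℝ → ℝ → ℝ) : Prop where
  isC12 : IsC12 T u
  growth : ∃ C : ℝ, ∃ p : ℕ, ∀ t ∈ Icc 0 T, ∀ x, |u t x| ≤ C * (1 + |x| ^ p)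
  equation : ∀ t ∈ Icc 0 T, ∀ x,
    derivWithin (fun s => u s x) (Icc 0 T) t
      + (μ x * deriv (u t) x + 1 / 2 * σ x ^ 2 * iteratedDeriv 2 (u t) x)
      + f t x (u t x) (σ x * deriv (u t) x) = 0
  terminal : ∀ x, u T x = g x

/-- `u` is the unique classical solution, as a function on `[0,T] × ℝ`. -/
def IsUniqueClassicalSolution (T : ℝ) (μ σ : ℝ → ℝ) (f : ℝ → ℝ → ℝ → ℝ → ℝ) (g : ℝ → ℝ)
    (u : ℝ → ℝ → ℝ) : Prop :=
  IsClassicalSolution T μ σ f g u ∧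
    ∀ v, IsClassicalSolution T μ σ f g v → ∀ t ∈ Icc 0 T, ∀ x, v t x = u t x

/-! ### The spatial discretization

A grid with nodes `x_{-N₀} < ⋯ < x_{N₀}` is given by a function `x : ℤ → ℝ`, of which only the
values at the indices `-N₀, …, N₀` are used. -/

/-- The index set `{-N₀, …, N₀}`. -/
abbrev Node (N₀ : ℕ) : Type := ↥(Finset.Icc (-(N₀ : ℤ)) (N₀ : ℤ))

/-- `δxᵢ = xᵢ₊₁ - xᵢ`. -/
def step (x : ℤ → ℝ) (i : ℤ) : ℝ := x (i + 1) - x i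

/-- The matrix of the central first difference, with zero rows at the two end nodes. -/
noncomputable def D₁ (x : ℤ → ℝ) (N₀ : ℕ) : Matrix (Node N₀) (Node N₀) ℝ :=
  Matrix.of fun i j =>
    if (i : ℤ) = -N₀ ∨ (i : ℤ) = N₀ then 0
    else if (j : ℤ) = i - 1 then -step x i / (step x (i - 1) * (step x (i - 1) + step x i))
    else if (j : ℤ) = i then (step x i - step x (i - 1)) / (step x i * step x (i - 1))
    else if (j : ℤ) = i + 1 then step x (i - 1) / (step x i * (step x (i - 1) + step x i))
    else 0

/-- The matrix of the central second difference, with zero rows at the two end nodes. -/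
noncomputable def D₂ (x : ℤ → ℝ) (N₀ : ℕ) : Matrix (Node N₀) (Node N₀) ℝ :=
  Matrix.of fun i j =>
    if (i : ℤ) = -N₀ ∨ (i : ℤ) = N₀ then 0
    else if (j : ℤ) = i - 1 then 2 / (step x (i - 1) * (step x (i - 1) + step x i))
    else if (j : ℤ) = i then -2 / (step x i * step x (i - 1))
    else if (j : ℤ) = i + 1 then 2 / (step x i * (step x (i - 1) + step x i))
    else 0

/-- `Q = diag(μ) D₁ + ½ diag(σ²) D₂`. -/
noncomputable def Q (μ σ : ℝ → ℝ) (x : ℤ → ℝ) (N₀ : ℕ) : Matrix (Node N₀) (Node N₀) ℝ :=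
  Matrix.diagonal (fun i : Node N₀ => μ (x i)) * D₁ x N₀
    + (1 / 2 : ℝ) • (Matrix.diagonal (fun i : Node N₀ => σ (x i) ^ 2) * D₂ x N₀)

/-- `F(t,z)ᵢ = f(t, xᵢ, zᵢ, σ(xᵢ) (D₁ z)ᵢ)`. -/
noncomputable def F (σ : ℝ → ℝ) (f : ℝ → ℝ → ℝ → ℝ → ℝ) (x : ℤ → ℝ) (N₀ : ℕ) (t : ℝ)
    (z : Node N₀ → ℝ) : Node N₀ → ℝ :=
  fun i => f t (x i) (z i) (σ (x i) * ((D₁ x N₀).mulVec z) i)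

/-- `U : [0,T] → ℝ^N` solves `dU/dt + Q U + F(t,U) = 0` on `[0,T]`, `U_T = G = (g(xᵢ))ᵢ`. -/
def IsODESolution (T : ℝ) (μ σ : ℝ → ℝ) (f : ℝ → ℝ → ℝ → ℝ → ℝ) (g : ℝ → ℝ) (x : ℤ → ℝ)
    (N₀ : ℕ) (U : ℝ → Node N₀ → ℝ) : Prop :=
  (∀ t ∈ Icc 0 T,
    HasDerivWithinAt U (-((Q μ σ x N₀).mulVec (U t) + F σ f x N₀ t (U t))) (Icc 0 T) t) ∧
  ∀ i : Node N₀, U T i = g (x i)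

/-- The uniform grid `xᵢ = i Δx`. -/
def uniformGrid (Δx : ℝ) (i : ℤ) : ℝ := i * Δx

/-! ### The error and the iterated limit -/

/-- The supremum of `|u(t, iΔx) - U_{t,i}|` over the `-N₀ ≤ i ≤ N₀` with `iΔx ∈ K`
(`0` if there is no such `i`). -/
noncomputable def gridError (u : ℝ → ℝ → ℝ) (K : Set ℝ) (Δx : ℝ) (N₀ : ℕ)
    (U : ℝ → Node N₀ → ℝ) (t : ℝ) : ℝ≥0∞ :=
  ⨆ (i : Node N₀) (_ : uniformGrid Δx i ∈ K),
    ENNReal.ofReal |u t (uniformGrid Δx i) - U t i|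

/-- `lim_{Δx → 0+} lim_{N₀ → ∞} e(Δx, N₀) = 0`: for each `Δx > 0` the inner limit exists and is
finite, and it tends to `0` as `Δx → 0+`. -/
def IteratedLimitZero (e : ℝ → ℕ → ℝ≥0∞) : Prop :=
  ∃ l : ℝ → ℝ≥0, (∀ Δx : ℝ, 0 < Δx → Tendsto (fun N₀ => e Δx N₀) atTop (𝓝 (l Δx : ℝ≥0∞))) ∧
    Tendsto l (𝓝[>] 0) (𝓝 0)

end MethodOfLines

namespace MethodOfLines

/-! ### The weighted energy inequality for central differences -/

/-! The central scheme need not be monotone, so the argument rests on weighted energy estimates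
instead of a maximum principle. Let `V` be a difference of two solutions and test its equation with
`2 η² V`. Summation by parts makes the second-order term coercive and the central drift
antisymmetric up to order zero, and the Lipschitz driver is absorbed (`energy_abstract`). Since `μ`
and `σ` grow at most linearly, the powers of `w = 1 / (1 + |x|)` are admissible weights, because
`|w'| = w²`.

The end nodes carry wrong values: both differences are zero there, so each end value follows a
scalar equation that does not see the diffusion. These values are bounded independently of the grid
(`boundary_sq_le`), and at a fixed mesh size the weight suppresses their influence as `N₀ → ∞`. This
gives weighted bounds uniform in the mesh (`weighted_apriori`). To compare solutions away from the
ends, the weight is truncated to `(w ^ (j+1) - a ^ (j+1))₊`. The truncation costs only `a²` times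
the squared weighted norm of order `j` (`sq_wt_pow_le`), which the a priori bound controls. Taking
for `a` the weight of the end node yields the Cauchy property at every node as `N₀ → ∞`
(`node_cauchy`), hence the inner limit.

As `Δx → 0`, an `ℓ²` bound alone controls point values only up to a factor `h ^ (-1/2)`. Therefore a
small multiple of a localized gradient energy is added; on a compact set `σ²` is bounded below, and
the errors of the gradient energy are absorbed by the coercive term of the first energy. A
one-dimensional discrete Sobolev inequality then gives local uniform stability (`local_stability`).
It is applied to `u - U`, with a fixed small `a` and a residual that is small by uniform continuity
of the derivatives of `u` on compact sets (`IsC12.consistency`, `eventually_error_le`). -/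

/-- Forward difference quotient on the lattice of mesh `h`. -/
noncomputable def fdiff (h : ℝ) (V : ℤ → ℝ) (i : ℤ) : ℝ := (V (i + 1) - V i) / h

/-- Central first difference quotient. -/
noncomputable def cdiff (h : ℝ) (V : ℤ → ℝ) (i : ℤ) : ℝ := (fdiff h V i + fdiff h V (i - 1)) / 2

/-- Central second difference quotient. -/
noncomputable def cdiff₂ (h : ℝ) (V : ℤ → ℝ) (i : ℤ) : ℝ := (fdiff h V i - fdiff h V (i - 1)) / h

theorem sum_Ico_telescope (G : ℤ → ℝ) (a : ℤ) (n : ℕ) :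
    ∑ i ∈ Finset.Ico a (a + n), (G (i + 1) - G i) = G (a + n) - G a := by
  induction n with
  | zero => simp
  | succ n ih =>
    have : Finset.Ico a (a + (n + 1 : ℕ)) = insert (a + n) (Finset.Ico a (a + n)) := by
      ext x; simp only [Finset.mem_Ico, Finset.mem_insert]; push_cast; omega
    rw [this, Finset.sum_insert (by simp), ih]
    push_cast
    rw [← add_assoc]; ring

theorem sum_Icc_telescope (G : ℤ → ℝ) (M : ℕ) :
    ∑ i ∈ Finset.Icc (-(M : ℤ)) M, (G (i + 1) - G i) = G (M + 1) - G (-M) := by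
  have h := sum_Ico_telescope G (-M) (2 * M + 1)
  have e : Finset.Icc (-(M : ℤ)) M = Finset.Ico (-(M : ℤ)) (-M + (2 * M + 1 : ℕ)) := by
    ext x; simp only [Finset.mem_Icc, Finset.mem_Ico]; push_cast; omega
  rw [e, h]
  congr 2
  push_cast; ring

/-- Absorption of the transport part of the second-order term. -/
theorem absorb_edge {d S D L β v v' : ℝ} (hD : |D| ≤ 2 * L * β) (a a' : ℝ) (hS : |S| ≤ |a| + |a'|) :
    |1 / 2 * d * (D * S) * (v' + v)| ≤
      1 / 8 * (a' ^ 2 + a ^ 2) * d ^ 2 + 8 * L ^ 2 * β ^ 2 * (v ^ 2 + v' ^ 2) := by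
  have h1 : |1 / 2 * d * (D * S) * (v' + v)| = 1 / 2 * (|D| * |v' + v|) * (|S| * |d|) := by
    simp only [abs_mul]; rw [abs_of_pos (by norm_num : (0 : ℝ) < 1 / 2)]; ring
  have h2 : |D| * |v' + v| ≤ 2 * L * β * |v' + v| := by gcongr
  have h3 : |S| * |d| ≤ (|a| + |a'|) * |d| := by gcongr
  have h4 : 1 / 2 * (|D| * |v' + v|) * (|S| * |d|) ≤
      1 / 2 * (2 * L * β * |v' + v|) * ((|a| + |a'|) * |d|) := by
    have h0 : 0 ≤ 2 * L * β * |v' + v| := (by positivity : (0 : ℝ) ≤ |D| * |v' + v|).trans h2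
    gcongr
  have h5 : (|a| + |a'|) ^ 2 ≤ 2 * (a ^ 2 + a' ^ 2) := by
    nlinarith [sq_nonneg (|a| - |a'|), sq_abs a, sq_abs a']
  have h6 : |v' + v| ^ 2 ≤ 2 * (v ^ 2 + v' ^ 2) := by
    rw [sq_abs]; nlinarith [sq_nonneg (v' - v)]
  have h7 : ((|a| + |a'|) * |d|) ^ 2 ≤ 2 * (a ^ 2 + a' ^ 2) * d ^ 2 := by
    rw [mul_pow, sq_abs d]; gcongr
  have h8 : (L * β * |v' + v|) ^ 2 ≤ L ^ 2 * β ^ 2 * (2 * (v ^ 2 + v' ^ 2)) := by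
    rw [mul_pow, mul_pow]; gcongr
  nlinarith [sq_nonneg ((|a| + |a'|) * |d| / 4 - 2 * (L * β * |v' + v|))]

theorem abs_mul_le_add_sq (x y : ℝ) : |x| * |y| ≤ (x ^ 2 + y ^ 2) / 2 := by
  nlinarith [sq_nonneg (|x| - |y|), sq_abs x, sq_abs y]

/-- Pointwise energy estimate at a node. -/
theorem absorb_node {η β L : ℝ} (hη : 0 ≤ η) (hηβ : η ≤ β) (hL : 1 ≤ L) (v p m s d d₀ c r : ℝ)
    (heq : η * v ≠ 0 → |p + (m * ((d + d₀) / 2) + 1 / 2 * s ^ 2 * c)|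
        ≤ L * (|v| + |s| * |(d + d₀) / 2|) + r) :
    -(2 * η ^ 2 * v * (m * ((d + d₀) / 2) + 1 / 2 * s ^ 2 * c)) - 7 * L ^ 2 * (β ^ 2 * v ^ 2)
      - (η * r) ^ 2 - 1 / 8 * (η * s) ^ 2 * (d ^ 2 + d₀ ^ 2) ≤ 2 * η ^ 2 * v * p := by
  set X := m * ((d + d₀) / 2) + 1 / 2 * s ^ 2 * c
  -- The equation is assumed only where it is tested; elsewhere every tested term vanishes. This is
  -- what later allows cutoffs that ignore the end nodes.
  by_cases h0 : η * v = 0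
  · have e : ∀ z, 2 * η ^ 2 * v * z = 0 := fun z => by linear_combination 2 * η * z * h0
    rw [e, e]
    have h1 : 0 ≤ 7 * L ^ 2 * (β ^ 2 * v ^ 2) := by positivity
    have h2 : 0 ≤ 1 / 8 * (η * s) ^ 2 * (d ^ 2 + d₀ ^ 2) := by positivity
    have h3 : 0 ≤ (η * r) ^ 2 := by positivity
    linarith
  · have hq := heq h0
    have hsq : η ^ 2 * v ^ 2 ≤ β ^ 2 * v ^ 2 := by gcongr
    have h1 : |2 * η ^ 2 * v * (p + X)|
        ≤ 2 * η ^ 2 * |v| * (L * (|v| + |s| * |(d + d₀) / 2|) + r) := by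
      rw [abs_mul, abs_mul, abs_of_nonneg (by positivity : 0 ≤ 2 * η ^ 2)]
      gcongr
    have h2 := neg_le_of_abs_le h1
    have h4 : |(d + d₀) / 2| ≤ (|d| + |d₀|) / 2 := by
      rw [abs_div, abs_two]
      gcongr
      exact abs_add_le _ _
    have h5 : 2 * η ^ 2 * |v| * r ≤ η ^ 2 * v ^ 2 + (η * r) ^ 2 := by
      nlinarith [sq_nonneg (η * |v| - η * r), sq_abs v]
    have hy : (η * |s| * (|d| + |d₀|)) ^ 2 ≤ 2 * (η * s) ^ 2 * (d ^ 2 + d₀ ^ 2) := by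
      have : (|d| + |d₀|) ^ 2 ≤ 2 * (d ^ 2 + d₀ ^ 2) := by
        nlinarith [sq_nonneg (|d| - |d₀|), sq_abs d, sq_abs d₀]
      have := mul_le_mul_of_nonneg_left this (by positivity : 0 ≤ η ^ 2 * s ^ 2)
      rw [mul_pow, mul_pow, sq_abs, mul_pow]
      linarith
    have h6 : 2 * η ^ 2 * |v| * (L * (|s| * |(d + d₀) / 2|)) ≤
        1 / 8 * (η * s) ^ 2 * (d ^ 2 + d₀ ^ 2) + 4 * L ^ 2 * (η ^ 2 * v ^ 2) := by
      have h7 : 2 * η ^ 2 * |v| * (L * (|s| * |(d + d₀) / 2|)) ≤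
          2 * η ^ 2 * |v| * (L * (|s| * ((|d| + |d₀|) / 2))) := by gcongr
      have h8 : (L * η * |v|) ^ 2 = L ^ 2 * (η ^ 2 * v ^ 2) := by
        rw [mul_pow, mul_pow, sq_abs]; ring
      have h9 := sq_nonneg (η * |s| * (|d| + |d₀|) / 4 - 2 * (L * η * |v|))
      have h10 : 2 * η ^ 2 * |v| * (L * (|s| * ((|d| + |d₀|) / 2)))
        = (η * |s| * (|d| + |d₀|)) * (L * η * |v|) := by ring
      linarith
    have h7 : 2 * η ^ 2 * |v| * (L * |v|) = 2 * L * (η ^ 2 * v ^ 2) := by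
      rw [← sq_abs v]; ring
    have h8 : (1 + 2 * L + 4 * L ^ 2) * (η ^ 2 * v ^ 2) ≤ 7 * L ^ 2 * (β ^ 2 * v ^ 2) := by
      have : 1 + 2 * L + 4 * L ^ 2 ≤ 7 * L ^ 2 := by nlinarith
      gcongr
    have h9 : 2 * η ^ 2 * |v| * (L * (|v| + |s| * |(d + d₀) / 2|) + r)
      = 2 * η ^ 2 * |v| * (L * |v|) + 2 * η ^ 2 * |v| * (L * (|s| * |(d + d₀) / 2|))
        + 2 * η ^ 2 * |v| * r := by ring
    have h10 : 2 * η ^ 2 * v * (p + X) = 2 * η ^ 2 * v * p + 2 * η ^ 2 * v * X := by ring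
    linarith

/-- Summation by parts across one edge, with `a`, `a'` the values of `η σ` at its ends: the second
summand on the left is a flux increment, the first term on the right is coercive, and the last one
is small because `η σ` has bounded difference quotients relative to the weight. -/
theorem edge_identity {h : ℝ} (hh : h ≠ 0) (a a' v d d₀ : ℝ) :
    -a ^ 2 * v * (d - d₀) / h + (a' ^ 2 * (v + h * d) * d - a ^ 2 * v * d₀) / h
      = 1 / 2 * (a' ^ 2 + a ^ 2) * d ^ 2
        + 1 / 2 * d * ((a' - a) / h * (a' + a)) * (v + h * d + v) := by
  field_simp; ring

/-- **Weighted energy inequality.** The central scheme with Lipschitz coefficients is stable in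
weighted `ℓ²`: the second-order term is coercive and the central drift is antisymmetric up to
order zero, without any monotonicity. -/
theorem energy_abstract {h L : ℝ} (hh : 0 < h) (hL : 1 ≤ L) (M : ℕ) (μ σ η β V P r : ℤ → ℝ)
    (hV : ∀ i : ℤ, (M : ℤ) ≤ |i| → V i = 0) (hη : ∀ i, 0 ≤ η i)
    (hηβ : ∀ i, η i ≤ β i) (hηβ' : ∀ i, η (i + 1) ≤ β i)
    (hσ : ∀ i, |σ (i + 1) - σ i| ≤ L * h) (hμ : ∀ i, |μ (i + 1) - μ i| ≤ L * h)
    (hση : ∀ i, |σ i| * |η (i + 1) - η i| ≤ L * h * β i)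
    (hμη : ∀ i, |μ i| * |η (i + 1) - η i| ≤ L * h * β i)
    (heq : ∀ i, η i * V i ≠ 0 →
      |P i + (μ i * cdiff h V i + 1 / 2 * σ i ^ 2 * cdiff₂ h V i)|
        ≤ L * (|V i| + |σ i| * |cdiff h V i|) + r i) :
    ∑ i ∈ Finset.Icc (-(M : ℤ)) M,
        (1 / 4 * (η i * σ i) ^ 2 * (fdiff h V i ^ 2 + fdiff h V (i - 1) ^ 2)
          - 30 * L ^ 2 * (β i ^ 2 * (V i ^ 2 + V (i + 1) ^ 2)) - (η i * r i) ^ 2)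
      ≤ ∑ i ∈ Finset.Icc (-(M : ℤ)) M, 2 * η i ^ 2 * V i * P i := by
  set d := fdiff h V with hd
  -- `Φ` vanishes at both ends, so adding its increments reduces the summed inequality to a
  -- pointwise one. The last two terms are the fluxes of diffusion and drift. The first shares the
  -- coercivity of an edge between its two end points: `3/8 = 1/2 - 1/8` is left after
  -- `absorb_edge`, and `absorb_node` takes another `1/8`, leaving `1/4`.
  set Φ : ℤ → ℝ := fun i => 3 / 8 * (η i * σ i) ^ 2 * d (i - 1) ^ 2
    - (η i * σ i) ^ 2 * V i * d (i - 1) / h - η i ^ 2 * μ i * V i * V (i - 1) / h with hΦ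
  have hΦ1 : Φ (M + 1) = 0 := by
    have e1 : V (M + 1) = 0 := hV _ (by rw [abs_of_nonneg] <;> omega)
    have e2 : V (M + 1 - 1) = 0 := hV _ (by rw [abs_of_nonneg] <;> omega)
    simp [hΦ, hd, fdiff, e1] at e2 ⊢
    simp [e2]
  have hΦ2 : Φ (-M) = 0 := by
    have e1 : V (-M) = 0 := hV _ (by rw [abs_neg]; exact le_abs_self _)
    have e2 : V (-M - 1) = 0 := hV _ (by rw [abs_of_nonpos] <;> omega)
    simp [hΦ, hd, fdiff, e1, e2]
  have htel := sum_Icc_telescope Φ M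
  rw [hΦ1, hΦ2, sub_zero] at htel
  rw [← add_zero (Finset.sum _ _), ← htel, ← Finset.sum_add_distrib]
  refine Finset.sum_le_sum fun i _ => ?_
  have hβ : 0 ≤ β i := (hη i).trans (hηβ i)
  have hL0 : 0 ≤ L := by linarith
  have hnode := absorb_node (hη i) (hηβ i) hL (V i) (P i) (μ i) (σ i) (d i) (d (i - 1))
    (cdiff₂ h V i) (r i) (heq i)
  have hX : 2 * η i ^ 2 * V i * (μ i * ((d i + d (i - 1)) / 2)
        + 1 / 2 * σ i ^ 2 * cdiff₂ h V i)
      = η i ^ 2 * μ i * V i * (V (i + 1) - V (i - 1)) / h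
        + (η i * σ i) ^ 2 * V i * (d i - d (i - 1)) / h := by
    have hdV : d i + d (i - 1) = (V (i + 1) - V (i - 1)) / h := by
      simp only [hd, fdiff, sub_add_cancel]; ring
    rw [mul_div_assoc _ _ h, ← hdV]
    simp only [cdiff₂, ← hd]; ring
  rw [hX] at hnode
  -- summation by parts at the edge
  set A := η i * σ i with hA
  set A' := η (i + 1) * σ (i + 1) with hA'
  have hDA : |(A' - A) / h| ≤ 2 * L * β i := by
    rw [abs_div, abs_of_pos hh, div_le_iff₀ hh]
    have e : A' - A = η (i + 1) * (σ (i + 1) - σ i) + σ i * (η (i + 1) - η i) := by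
      rw [hA, hA']; ring
    rw [e]
    refine (abs_add_le _ _).trans ?_
    rw [abs_mul, abs_mul, abs_of_nonneg (hη (i + 1))]
    have := mul_le_mul (hηβ' i) (hσ i) (abs_nonneg _) hβ
    linarith [hση i]
  have hedge := absorb_edge (d := d i) (v := V i) (v' := V (i + 1)) hDA A A'
    (S := A' + A) (by rw [add_comm |A|]; exact abs_add_le _ _)
  have hDM : |(η (i + 1) ^ 2 * μ (i + 1) - η i ^ 2 * μ i) / h| ≤ 3 * L * β i ^ 2 := by
    rw [abs_div, abs_of_pos hh, div_le_iff₀ hh]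
    have e : η (i + 1) ^ 2 * μ (i + 1) - η i ^ 2 * μ i
        = η (i + 1) ^ 2 * (μ (i + 1) - μ i)
          + (η (i + 1) + η i) * (μ i * (η (i + 1) - η i)) := by ring
    rw [e]
    refine (abs_add_le _ _).trans ?_
    rw [abs_mul, abs_mul, abs_mul, abs_of_nonneg (sq_nonneg _),
      abs_of_nonneg (add_nonneg (hη (i + 1)) (hη i))]
    have e1 : η (i + 1) ^ 2 ≤ β i ^ 2 := by
      gcongr
      · exact hη _
      · exact hηβ' i
    have e2 := mul_le_mul e1 (hμ i) (abs_nonneg _) (sq_nonneg _)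
    have e3 := mul_le_mul (add_le_add (hηβ' i) (hηβ i)) (hμη i) (by positivity) (by positivity)
    linarith
  have hdrift : |(η (i + 1) ^ 2 * μ (i + 1) - η i ^ 2 * μ i) / h * (V i * V (i + 1))|
      ≤ 2 * L * (β i ^ 2 * (V i ^ 2 + V (i + 1) ^ 2)) := by
    rw [abs_mul]
    have h2 : |V i * V (i + 1)| ≤ (V i ^ 2 + V (i + 1) ^ 2) / 2 := by
      rw [abs_mul]; exact abs_mul_le_add_sq _ _
    have := mul_le_mul hDM h2 (abs_nonneg _) (by positivity)
    nlinarith [show 0 ≤ L * (β i ^ 2 * (V i ^ 2 + V (i + 1) ^ 2)) by positivity]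
  have hΦΔ : Φ (i + 1) - Φ i =
      3 / 8 * A' ^ 2 * d i ^ 2 - 3 / 8 * A ^ 2 * d (i - 1) ^ 2
      - (A' ^ 2 * V (i + 1) * d i - A ^ 2 * V i * d (i - 1)) / h
      - (η (i + 1) ^ 2 * μ (i + 1) * V (i + 1) * V i - η i ^ 2 * μ i * V i * V (i - 1)) / h := by
    simp only [hΦ, add_sub_cancel_right]; ring
  have hVd : V (i + 1) = V i + h * d i := by
    simp only [hd, fdiff]; field_simp; ring
  have hsec : - A ^ 2 * V i * (d i - d (i - 1)) / h
        + (A' ^ 2 * V (i + 1) * d i - A ^ 2 * V i * d (i - 1)) / h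
      = 1 / 2 * (A' ^ 2 + A ^ 2) * d i ^ 2
        + 1 / 2 * d i * ((A' - A) / h * (A' + A)) * (V (i + 1) + V i) := by
    rw [hVd]; exact edge_identity hh.ne' A A' _ _ _
  -- Antisymmetry of the central drift: only the increment of `η² μ` survives, and it is of order
  -- `h`.
  have hfirst : -(η i ^ 2 * μ i * V i * (V (i + 1) - V (i - 1)) / h)
        + (η (i + 1) ^ 2 * μ (i + 1) * V (i + 1) * V i - η i ^ 2 * μ i * V i * V (i - 1)) / h
      = (η (i + 1) ^ 2 * μ (i + 1) - η i ^ 2 * μ i) / h * (V i * V (i + 1)) := by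
    ring
  have b1 := neg_le_of_abs_le hedge
  have b2 := neg_le_of_abs_le hdrift
  have b3 : L * (β i ^ 2 * (V i ^ 2 + V (i + 1) ^ 2)) ≤
      L ^ 2 * (β i ^ 2 * (V i ^ 2 + V (i + 1) ^ 2)) := by
    gcongr; exact le_self_pow₀ hL two_ne_zero
  have b4 : L ^ 2 * (β i ^ 2 * V i ^ 2) ≤ L ^ 2 * (β i ^ 2 * (V i ^ 2 + V (i + 1) ^ 2)) := by
    gcongr; exact le_add_of_nonneg_right (sq_nonneg _)
  have b5 : 0 ≤ L ^ 2 * (β i ^ 2 * (V i ^ 2 + V (i + 1) ^ 2)) := by positivity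
  have b6 : -(A ^ 2 * V i * (d i - d (i - 1)) / h) = - A ^ 2 * V i * (d i - d (i - 1)) / h := by
    ring
  linarith

/-! ### Polynomial weights on the lattice -/

/-- The weight `1 / (1 + |xᵢ|)` at the node `xᵢ = ih`. -/
noncomputable def wt (h : ℝ) (i : ℤ) : ℝ := (1 + |uniformGrid h i|)⁻¹

/-- The power `k` of the weight, shifted down so as to vanish where `wt ≤ a`. -/
noncomputable def cut (k : ℕ) (a h : ℝ) (i : ℤ) : ℝ := max (wt h i ^ k - a ^ k) 0

theorem wt_pos (h : ℝ) (i : ℤ) : 0 < wt h i := by unfold wt; positivity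

theorem wt_le_one (h : ℝ) (i : ℤ) : wt h i ≤ 1 :=
  inv_le_one_of_one_le₀ (by linarith [abs_nonneg (uniformGrid h i)])

theorem wt_mul_one_add (h : ℝ) (i : ℤ) : wt h i * (1 + |uniformGrid h i|) = 1 :=
  inv_mul_cancel₀ (by positivity)

theorem wt_neg (h : ℝ) (i : ℤ) : wt h (-i) = wt h i := by
  simp [wt, uniformGrid]

/-- Discrete form of `|w'| = w²` for `w = 1 / (1 + |x|)`. -/
theorem abs_wt_succ_sub_le {h : ℝ} (hh : 0 < h) (i : ℤ) :
    |wt h (i + 1) - wt h i| ≤ h * (wt h (i + 1) * wt h i) := by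
  have e : wt h (i + 1) - wt h i =
      (|uniformGrid h i| - |uniformGrid h (i + 1)|) * (wt h (i + 1) * wt h i) := by
    have h1 := wt_mul_one_add h i
    have h2 := wt_mul_one_add h (i + 1)
    linear_combination (-wt h (i + 1)) * h1 + wt h i * h2
  rw [e, abs_mul, abs_of_pos (mul_pos (wt_pos _ _) (wt_pos _ _))]
  gcongr
  · exact (mul_pos (wt_pos _ _) (wt_pos _ _)).le
  · refine (abs_abs_sub_abs_le_abs_sub _ _).trans (le_of_eq ?_)
    have : uniformGrid h i - uniformGrid h (i + 1) = -h := by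
      simp only [uniformGrid]; push_cast; ring
    rw [this, abs_neg, abs_of_pos hh]

theorem wt_succ_le {h : ℝ} (hh : 0 < h) (i : ℤ) : wt h (i + 1) ≤ (1 + h) * wt h i := by
  have h1 := (abs_le.1 (abs_wt_succ_sub_le hh i)).2
  have h2 : wt h (i + 1) * wt h i ≤ 1 * wt h i := by
    gcongr
    · exact (wt_pos _ _).le
    · exact wt_le_one _ _
  nlinarith

theorem wt_le_succ {h : ℝ} (hh : 0 < h) (i : ℤ) : wt h i ≤ (1 + h) * wt h (i + 1) := by
  have h1 := wt_succ_le hh (-(i + 1))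
  rw [show -(i + 1) + 1 = -i by ring, wt_neg, wt_neg] at h1
  exact h1

/-- The surplus factor `wt h i` is kept separate because it cancels the linear growth of `μ` and
`σ`; this is how the hypotheses `hση` and `hμη` of `energy_abstract` are met. -/
theorem abs_wt_pow_succ_sub_le {h : ℝ} (hh : 0 < h) (k : ℕ) (i : ℤ) :
    |wt h (i + 1) ^ k - wt h i ^ k| ≤ k * (1 + h) ^ k * h * (wt h i * wt h i ^ k) := by
  obtain _ | n := k
  · simp
  refine (abs_pow_sub_pow_le _ _ _).trans ?_
  rw [abs_of_pos (wt_pos _ _), abs_of_pos (wt_pos _ _), Nat.add_sub_cancel]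
  have h0 := wt_pos h i
  have h1 : max (wt h (i + 1)) (wt h i) ≤ (1 + h) * wt h i :=
    max_le (wt_succ_le hh i) (by nlinarith)
  have h2 : max (wt h (i + 1)) (wt h i) ^ n ≤ ((1 + h) * wt h i) ^ n :=
    pow_le_pow_left₀ (le_max_of_le_right h0.le) h1 n
  have h3 : |wt h (i + 1) - wt h i| ≤ h * ((1 + h) * wt h i * wt h i) :=
    (abs_wt_succ_sub_le hh i).trans (by gcongr; exact wt_succ_le hh i)
  calc |wt h (i + 1) - wt h i| * ((n + 1 : ℕ) : ℝ) * max (wt h (i + 1)) (wt h i) ^ n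
      ≤ h * ((1 + h) * wt h i * wt h i) * ((n + 1 : ℕ) : ℝ) * ((1 + h) * wt h i) ^ n := by
        gcongr
    _ = _ := by rw [mul_pow]; ring

theorem cut_nonneg (k : ℕ) (a h : ℝ) (i : ℤ) : 0 ≤ cut k a h i := le_max_right _ _

theorem cut_le {a : ℝ} (ha : 0 ≤ a) (k : ℕ) (h : ℝ) (i : ℤ) : cut k a h i ≤ wt h i ^ k :=
  max_le (by linarith [pow_nonneg ha k]) (pow_nonneg (wt_pos _ _).le _)

theorem cut_zero {k : ℕ} (hk : k ≠ 0) (h : ℝ) (i : ℤ) : cut k 0 h i = wt h i ^ k := by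
  simp [cut, hk, (wt_pos h i).le]

theorem lt_wt_of_cut_ne_zero {k : ℕ} {a h : ℝ} {i : ℤ} (hi : cut k a h i ≠ 0) : a < wt h i := by
  by_contra! hle
  exact hi (max_eq_right (sub_nonpos.2 (pow_le_pow_left₀ (wt_pos _ _).le hle k)))

theorem abs_cut_succ_sub_le {h : ℝ} (hh : 0 < h) (k : ℕ) (a : ℝ) (i : ℤ) :
    |cut k a h (i + 1) - cut k a h i| ≤ k * (1 + h) ^ k * h * (wt h i * wt h i ^ k) := by
  refine (abs_max_sub_max_le_abs _ _ _).trans ?_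
  rw [sub_sub_sub_cancel_right]
  exact abs_wt_pow_succ_sub_le hh k i

/-- The price of truncation. Where `wt ≤ a`, one power of the weight is worth a factor `a`, so the
part of the weight that the cutoff misses is charged to the norm of order `j` with the small factor
`a²`. -/
theorem sq_wt_pow_le {a : ℝ} (ha : 0 ≤ a) (j : ℕ) (h : ℝ) (i : ℤ) :
    (wt h i ^ (j + 1)) ^ 2 ≤ 2 * cut (j + 1) a h i ^ 2 + 2 * a ^ 2 * (wt h i ^ j) ^ 2 := by
  have h0 := (wt_pos h i).le
  rcases le_total (wt h i) a with hle | hle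
  · have : wt h i ^ (j + 1) ≤ a * wt h i ^ j := by rw [pow_succ']; gcongr
    have : (wt h i ^ (j + 1)) ^ 2 ≤ (a * wt h i ^ j) ^ 2 := by gcongr
    nlinarith [sq_nonneg (cut (j + 1) a h i), sq_nonneg (a * wt h i ^ j)]
  · have h1 : wt h i ^ (j + 1) - a ^ (j + 1) ≤ cut (j + 1) a h i := le_max_left _ _
    have h2 : a ^ (j + 1) ≤ a * wt h i ^ j := by rw [pow_succ']; gcongr
    have h3 : wt h i ^ (j + 1) ≤ cut (j + 1) a h i + a * wt h i ^ j := by linarith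
    have : (wt h i ^ (j + 1)) ^ 2 ≤ (cut (j + 1) a h i + a * wt h i ^ j) ^ 2 := by gcongr
    nlinarith [sq_nonneg (cut (j + 1) a h i - a * wt h i ^ j)]

/-- The weighted energy inequality for the weights `cut`, uniformly for bounded mesh sizes. -/
theorem energy_cut {L : ℝ} (hL : 1 ≤ L) (j : ℕ) (H : ℝ) : ∃ K : ℝ, 0 < K ∧
    ∀ (h : ℝ) (_ : 0 < h) (_ : h ≤ H) (a : ℝ) (_ : 0 ≤ a) (M : ℕ) (μ σ V P r : ℤ → ℝ)
      (_ : ∀ i : ℤ, (M : ℤ) ≤ |i| → V i = 0)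
      (_ : ∀ i, |σ (i + 1) - σ i| ≤ L * h) (_ : ∀ i, |μ (i + 1) - μ i| ≤ L * h)
      (_ : ∀ i, |σ i| ≤ L * (1 + |uniformGrid h i|)) (_ : ∀ i, |μ i| ≤ L * (1 + |uniformGrid h i|))
      (_ : ∀ i, cut (j + 1) a h i * V i ≠ 0 →
        |P i + (μ i * cdiff h V i + 1 / 2 * σ i ^ 2 * cdiff₂ h V i)|
          ≤ L * (|V i| + |σ i| * |cdiff h V i|) + r i),
      ∑ i ∈ Finset.Icc (-(M : ℤ)) M, (1 / 4 * (cut (j + 1) a h i * σ i) ^ 2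
            * (fdiff h V i ^ 2 + fdiff h V (i - 1) ^ 2)
          - K * ((cut (j + 1) a h i * V i) ^ 2 + a ^ 2 * (wt h i ^ j * V i) ^ 2)
          - (cut (j + 1) a h i * r i) ^ 2)
        ≤ ∑ i ∈ Finset.Icc (-(M : ℤ)) M, 2 * cut (j + 1) a h i ^ 2 * V i * P i := by
  -- `B * wt ^ (j + 1)` plays the role of `β`: it dominates the cutoff at both ends of an edge and
  -- also the increments of the cutoff times the coefficients. `B'` is the squared ratio of the
  -- weights of neighbouring nodes and pays for shifting `V (i + 1)` back to `V i`.
  set B : ℝ := ((j + 1 : ℕ) + 1) * (1 + H) ^ (j + 1) with hB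
  set B' : ℝ := ((1 + H) ^ (j + 1)) ^ 2 with hB'
  refine ⟨1 + 60 * L ^ 2 * B ^ 2 * (1 + B'), ?_, ?_⟩
  · have : 0 ≤ B' := sq_nonneg _
    positivity
  intro h hh hH a ha M μ σ V P r hV hσ hμ hσ' hμ' heq
  set η := cut (j + 1) a h with hη
  have hH0 : 0 < H := hh.trans_le hH
  have hL0 : 0 ≤ L := by linarith
  have hB1 : (1 + H) ^ (j + 1) ≤ B := by
    rw [hB]; refine le_mul_of_one_le_left (by positivity) ?_
    push_cast; linarith [Nat.cast_nonneg (α := ℝ) j]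
  have hB2 : 1 ≤ B := (one_le_pow₀ (by linarith)).trans hB1
  have hw : ∀ i, 0 < wt h i ^ (j + 1) := fun i => pow_pos (wt_pos h i) _
  have hpow : (1 + h) ^ (j + 1) ≤ (1 + H) ^ (j + 1) := by gcongr
  have hwsucc : ∀ i, wt h (i + 1) ^ (j + 1) ≤ (1 + H) ^ (j + 1) * wt h i ^ (j + 1) := fun i => by
    rw [← mul_pow]
    refine pow_le_pow_left₀ (wt_pos _ _).le ((wt_succ_le hh i).trans ?_) _
    gcongr
    exact (wt_pos _ _).le
  have hwpred : ∀ i, wt h i ^ (j + 1) ≤ (1 + H) ^ (j + 1) * wt h (i + 1) ^ (j + 1) := fun i => by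
    rw [← mul_pow]
    refine pow_le_pow_left₀ (wt_pos _ _).le ((wt_le_succ hh i).trans ?_) _
    gcongr
    exact (wt_pos _ _).le
  have hΔ : ∀ (c : ℤ → ℝ), (∀ i, |c i| ≤ L * (1 + |uniformGrid h i|)) → ∀ i,
      |c i| * |η (i + 1) - η i| ≤ L * h * (B * wt h i ^ (j + 1)) := by
    intro c hc i
    calc |c i| * |η (i + 1) - η i|
        ≤ (L * (1 + |uniformGrid h i|)) *
            ((j + 1 : ℕ) * (1 + h) ^ (j + 1) * h * (wt h i * wt h i ^ (j + 1))) := by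
          gcongr
          · exact hc i
          · exact abs_cut_succ_sub_le hh _ _ _
      _ = (wt h i * (1 + |uniformGrid h i|)) *
            (L * h * ((j + 1 : ℕ) * (1 + h) ^ (j + 1) * wt h i ^ (j + 1))) := by ring
      _ ≤ _ := by
          rw [wt_mul_one_add, one_mul, hB]
          gcongr
          · exact (hw i).le
          · linarith
  have hη0 : ∀ i, 0 ≤ η i := fun i => cut_nonneg _ _ _ _
  have main := energy_abstract hh hL M μ σ η (fun i => B * wt h i ^ (j + 1)) V P r hV hη0
    (fun i => (cut_le ha _ _ _).trans (le_mul_of_one_le_left (hw i).le hB2))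
    (fun i => (cut_le ha _ _ _).trans ((hwsucc i).trans (by gcongr; exact (hw i).le)))
    hσ hμ (hΔ σ hσ') (hΔ μ hμ') heq
  refine le_trans ?_ main
  -- shift the neighbour term
  set G : ℤ → ℝ := fun i => (wt h i ^ (j + 1)) ^ 2 * V i ^ 2 with hG
  have hG1 : G (M + 1) = 0 := by
    have : V (M + 1) = 0 := hV _ (by rw [abs_of_nonneg] <;> omega)
    simp [hG, this]
  have hG2 : G (-M) = 0 := by
    have : V (-M) = 0 := hV _ (by rw [abs_neg]; exact le_abs_self _)
    simp [hG, this]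
  have htel := sum_Icc_telescope G M
  rw [hG1, hG2, sub_zero] at htel
  set C : ℝ := 30 * L ^ 2 * B ^ 2 * B' with hC
  rw [← add_zero (Finset.sum _ _), ← mul_zero (-C), ← htel, Finset.mul_sum,
    ← Finset.sum_add_distrib]
  refine Finset.sum_le_sum fun i _ => ?_
  have hq := sq_wt_pow_le ha j h i
  rw [← hη] at hq
  have h1 : (wt h i ^ (j + 1)) ^ 2 * V (i + 1) ^ 2 ≤ B' * G (i + 1) := by
    have : (wt h i ^ (j + 1)) ^ 2 ≤ B' * (wt h (i + 1) ^ (j + 1)) ^ 2 := by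
      rw [hB', ← mul_pow]
      exact pow_le_pow_left₀ (hw i).le (hwpred i) 2
    have := mul_le_mul_of_nonneg_right this (sq_nonneg (V (i + 1)))
    simp only [hG]; linarith
  have h2 : G i ≤ 2 * ((η i * V i) ^ 2 + a ^ 2 * (wt h i ^ j * V i) ^ 2) := by
    have := mul_le_mul_of_nonneg_right hq (sq_nonneg (V i))
    simp only [hG, mul_pow]; linarith
  set S := (η i * V i) ^ 2 + a ^ 2 * (wt h i ^ j * V i) ^ 2 with hS
  have hS0 : 0 ≤ S := by positivity
  set D := 1 / 4 * (η i * σ i) ^ 2 * (fdiff h V i ^ 2 + fdiff h V (i - 1) ^ 2)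
  have h3 : 30 * L ^ 2 * ((B * wt h i ^ (j + 1)) ^ 2 * (V i ^ 2 + V (i + 1) ^ 2))
      ≤ 30 * L ^ 2 * B ^ 2 * G i + C * G (i + 1) := by
    have := mul_le_mul_of_nonneg_left h1 (by positivity : 0 ≤ 30 * L ^ 2 * B ^ 2)
    simp only [hG, hC] at this ⊢
    linarith
  have h4 : 30 * L ^ 2 * B ^ 2 * (1 + B') * G i ≤ 30 * L ^ 2 * B ^ 2 * (1 + B') * (2 * S) := by
    gcongr
  have h5 : 30 * L ^ 2 * B ^ 2 * (1 + B') * G i = 30 * L ^ 2 * B ^ 2 * G i + C * G i := by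
    rw [hC]; ring
  linarith

/-- Summability of the squared weights, uniformly in the mesh. -/
theorem sum_wt_sq_le {h : ℝ} (hh : 0 < h) (M : ℕ) :
    h * ∑ i ∈ Finset.Icc (-(M : ℤ)) M, wt h i ^ 2 ≤ 2 + h := by
  -- Telescoping substitute for `∫ dx / (1 + x)² = 1` on the half line: `h * wt(n+1)² ≤ wt(n) -
  -- wt(n+1)`.
  have hp : ∀ n : ℕ, h * ∑ m ∈ Finset.range n, wt h (m + 1 : ℤ) ^ 2 ≤ 1 - wt h n := by
    intro n
    induction n with
    | zero => simp [wt, uniformGrid]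
    | succ n ih =>
      rw [Finset.sum_range_succ, mul_add]
      have e : wt h (n : ℤ) - wt h ((n : ℤ) + 1) = h * (wt h (n + 1 : ℤ) * wt h n) := by
        have h1 := wt_mul_one_add h n
        have h2 := wt_mul_one_add h (n + 1 : ℤ)
        have e1 : |uniformGrid h n| = n * h := by
          simp only [uniformGrid, Int.cast_natCast]; exact abs_of_nonneg (by positivity)
        have e2 : |uniformGrid h (n + 1 : ℤ)| = (n + 1) * h := by
          simp only [uniformGrid]; push_cast; exact abs_of_nonneg (by positivity)
        rw [e1] at h1
        rw [e2] at h2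
        linear_combination wt h (n + 1 : ℤ) * h1 - wt h n * h2
      have hle : wt h (n + 1 : ℤ) ≤ wt h n := by
        have := mul_pos hh (mul_pos (wt_pos h (n + 1 : ℤ)) (wt_pos h n))
        linarith
      have : wt h (n + 1 : ℤ) ^ 2 ≤ wt h (n + 1 : ℤ) * wt h n := by
        rw [sq]; exact mul_le_mul_of_nonneg_left hle (wt_pos _ _).le
      have := mul_le_mul_of_nonneg_left this hh.le
      push_cast
      linarith
  have hsplit : ∀ n : ℕ, ∑ i ∈ Finset.Icc (-(n : ℤ)) n, wt h i ^ 2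
      = wt h 0 ^ 2 + 2 * ∑ m ∈ Finset.range n, wt h (m + 1 : ℤ) ^ 2 := by
    intro n
    induction n with
    | zero => simp
    | succ n ih =>
      have : Finset.Icc (-((n + 1 : ℕ) : ℤ)) (n + 1 : ℕ)
          = insert (-((n : ℤ) + 1)) (insert ((n : ℤ) + 1) (Finset.Icc (-(n : ℤ)) n)) := by
        ext x; simp only [Finset.mem_Icc, Finset.mem_insert]; push_cast; omega
      rw [this, Finset.sum_insert, Finset.sum_insert, ih, Finset.sum_range_succ, wt_neg]
      · ring
      · simp
      · simp only [Finset.mem_insert, Finset.mem_Icc]; omega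
  rw [hsplit]
  have h1 := hp M
  have h2 := wt_pos h M
  have h3 : wt h 0 = 1 := by simp [wt, uniformGrid]
  rw [h3]
  linarith

/-- Backward Grönwall inequality. -/
theorem backward_gronwall {T C R : ℝ} (hC : 0 < C) {F F' : ℝ → ℝ}
    (hF : ∀ t ∈ Icc 0 T, HasDerivWithinAt F (F' t) (Icc 0 T) t)
    (hF' : ∀ t ∈ Icc 0 T, -(C * F t) - R ≤ F' t) (hFT : 0 ≤ F T + R / C) :
    ∀ t ∈ Icc 0 T, F t + R / C ≤ Real.exp (C * T) * (F T + R / C) := by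
  set Ψ : ℝ → ℝ := fun t => Real.exp (C * t) * (F t + R / C) with hΨ
  have hd : ∀ t ∈ Icc 0 T, HasDerivWithinAt Ψ
      (Real.exp (C * t) * C * (F t + R / C) + Real.exp (C * t) * F' t) (Icc 0 T) t := by
    intro t ht
    have h1 : HasDerivAt (fun t => Real.exp (C * t)) (Real.exp (C * t) * C) t := by
      simpa using ((hasDerivAt_id t).const_mul C).exp
    exact h1.hasDerivWithinAt.mul ((hF t ht).add_const (R / C))
  have hmono : MonotoneOn Ψ (Icc 0 T) := by
    refine monotoneOn_of_deriv_nonneg (convex_Icc 0 T)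
      (fun t ht => (hd t ht).continuousWithinAt) ?_ ?_
    · intro t ht
      rw [interior_Icc] at ht
      exact ((hd t (Ioo_subset_Icc_self ht)).hasDerivAt
        (Icc_mem_nhds ht.1 ht.2)).differentiableAt.differentiableWithinAt
    · intro t ht
      rw [interior_Icc] at ht
      rw [((hd t (Ioo_subset_Icc_self ht)).hasDerivAt (Icc_mem_nhds ht.1 ht.2)).deriv]
      have h1 := hF' t (Ioo_subset_Icc_self ht)
      have h2 : C * (R / C) = R := mul_div_cancel₀ R hC.ne'
      have h3 : 0 ≤ Real.exp (C * t) * (C * F t + C * (R / C) + F' t) :=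
        mul_nonneg (Real.exp_pos _).le (by linarith)
      linarith
  intro t ht
  have hT : T ∈ Icc 0 T := ⟨ht.1.trans ht.2, le_rfl⟩
  have h1 := hmono ht hT ht.2
  simp only [hΨ] at h1
  rcases le_total 0 (F t + R / C) with h0 | h0
  · have : 1 ≤ Real.exp (C * t) := Real.one_le_exp (mul_nonneg hC.le ht.1)
    nlinarith
  · exact h0.trans (mul_nonneg (Real.exp_pos _).le hFT)

/-! ### Global solvability of Lipschitz systems -/

/-- Global existence, backwards from a terminal value, for Lipschitz fields on `ℝⁿ`. -/
theorem exists_terminal_solution {ι : Type*} [Fintype ι] {T : ℝ} (hT : 0 < T)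
    {v : ℝ → (ι → ℝ) → ι → ℝ} {K : ℝ≥0} (hv : ∀ t ∈ Icc 0 T, LipschitzWith K (v t))
    (hc : ∀ z, ContinuousOn (fun t => v t z) (Icc 0 T)) (z₀ : ι → ℝ) :
    ∃ U : ℝ → ι → ℝ, U T = z₀ ∧
      ∀ t ∈ Icc 0 T, HasDerivWithinAt U (v t (U t)) (Icc 0 T) t := by
  have hTm : T ∈ Icc 0 T := ⟨hT.le, le_rfl⟩
  obtain ⟨B, hB⟩ := isCompact_Icc.exists_bound_of_continuousOn (hc 0)
  have hB0 : 0 ≤ B := (norm_nonneg _).trans (hB T hTm)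
  -- the clamped field
  set R : ℝ := Real.exp ((K + 1) * T) * (‖z₀‖ + B + 1) with hR
  have hR0 : 0 < R := by positivity
  set clamp : (ι → ℝ) → ι → ℝ := fun z i => max (-R) (min R (z i)) with hcl
  have hcl1 : ∀ y z, ‖clamp y - clamp z‖ ≤ ‖y - z‖ := by
    intro y z
    refine (pi_norm_le_iff_of_nonneg (norm_nonneg _)).2 fun i => ?_
    refine le_trans ?_ (norm_le_pi_norm (y - z) i)
    simp only [hcl, Pi.sub_apply, Real.norm_eq_abs]
    refine (abs_max_sub_max_le_max _ _ _ _).trans ?_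
    simp only [sub_self, abs_zero]
    refine max_le (abs_nonneg _) ((abs_min_sub_min_le_max _ _ _ _).trans ?_)
    simp
  have hcl0 : clamp 0 = 0 := by
    funext i; simp [hcl, hR0.le]
  have hclR : ∀ z, ‖clamp z‖ ≤ R := fun z =>
    (pi_norm_le_iff_of_nonneg hR0.le).2 fun i =>
      abs_le.2 ⟨le_max_left _ _, max_le (by linarith) (min_le_left _ _)⟩
  have hclid : ∀ z, ‖z‖ ≤ R → clamp z = z := by
    intro z hz
    funext i
    have := abs_le.1 ((norm_le_pi_norm z i).trans hz)
    simp only [hcl]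
    rw [min_eq_right this.2, max_eq_right this.1]
  have hgrow : ∀ t ∈ Icc 0 T, ∀ z, ‖v t z‖ ≤ B + K * ‖z‖ := by
    intro t ht z
    have h1 := (hv t ht).norm_sub_le z 0
    rw [sub_zero] at h1
    have h2 := norm_le_norm_add_norm_sub' (v t z) (v t 0)
    linarith [hB t ht]
  have hclz : ∀ z, ‖clamp z‖ ≤ ‖z‖ := fun z => by
    simpa [hcl0] using hcl1 z 0
  set m : ℝ≥0 := ⟨B + K * R, by positivity⟩ with hm
  -- The clamped field is bounded by `m`, so a solution cannot leave the ball of radius `m * T` and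
  -- a single application covers all of `[0,T]`, without continuation.
  have hPL : IsPicardLindelof (fun t z => v t (clamp z)) (tmin := 0) (tmax := T) ⟨T, hTm⟩ z₀
      (m * ⟨T, hT.le⟩) 0 m K := by
    refine ⟨fun t ht => ?_, fun z _ => hc _, fun t ht z _ => ?_, ?_⟩
    · refine LipschitzWith.lipschitzOnWith (LipschitzWith.of_dist_le_mul fun y z => ?_)
      rw [dist_eq_norm, dist_eq_norm]
      exact ((hv t ht).norm_sub_le _ _).trans (by gcongr; exact hcl1 y z)
    · refine (hgrow t ht _).trans ?_
      change _ ≤ B + K * R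
      gcongr
      exact hclR z
    · have : max (T - T) (T - 0) = T := by simp [hT.le]
      simp only [this]
      exact le_of_eq (by push_cast; rw [sub_zero]; rfl)
  obtain ⟨U, hU0, hU⟩ := hPL.exists_eq_forall_mem_Icc_hasDerivWithinAt₀
  refine ⟨U, hU0, ?_⟩
  -- a priori bound for the reversed curve
  have hbound : ∀ t ∈ Icc 0 T, ‖U t‖ ≤ R := by
    set Y : ℝ → ι → ℝ := fun s => U (T - s) with hY
    have hrev : ∀ s ∈ Icc 0 T, T - s ∈ Icc 0 T := fun s hs => ⟨by linarith [hs.2], by linarith [hs.1]⟩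
    have hYd : ∀ s ∈ Icc 0 T, HasDerivWithinAt Y (-(v (T - s) (clamp (Y s)))) (Icc 0 T) s := by
      intro s hs
      have h1 := hU (T - s) (hrev s hs)
      have h2 : HasDerivWithinAt (fun s : ℝ => T - s) (-1) (Icc 0 T) s :=
        ((hasDerivAt_id s).const_sub T).hasDerivWithinAt
      have := h1.scomp s h2 hrev
      simpa [Function.comp_def] using this
    -- The rate `K + 1` avoids the separate formula for rate zero. `R` dominates the resulting
    -- bound, so the clamp is never active along `U`.
    have hG := norm_le_gronwallBound_of_norm_deriv_right_le (f := Y) (δ := ‖z₀‖) (K := K + 1)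
      (ε := B) (a := 0) (b := T) (fun s hs => (hYd s hs).continuousWithinAt)
      (fun s hs => ((hYd s (Ico_subset_Icc_self hs)).mono_of_mem_nhdsWithin
        (Icc_mem_nhdsGE_of_mem hs))) (by simp only [hY, sub_zero]; rw [hU0]) (by
        intro s hs
        rw [norm_neg]
        refine (hgrow _ (hrev s (Ico_subset_Icc_self hs)) _).trans ?_
        have := hclz (Y s)
        have hK : (K : ℝ) * ‖clamp (Y s)‖ ≤ K * ‖Y s‖ := by gcongr
        linarith [norm_nonneg (Y s)])
    intro t ht
    have h1 := hG (T - t) (hrev t ht)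
    simp only [hY, sub_sub_cancel] at h1
    refine h1.trans ?_
    rw [gronwallBound_of_K_ne_0 (by positivity), sub_zero, hR]
    have hK : (0 : ℝ) ≤ K := K.2
    have e1 : Real.exp (((K : ℝ) + 1) * (T - t)) ≤ Real.exp ((K + 1) * T) := by
      gcongr; linarith [ht.1]
    have e2 : B / ((K : ℝ) + 1) ≤ B := div_le_self hB0 (by linarith)
    have e3 : 1 ≤ Real.exp (((K : ℝ) + 1) * (T - t)) :=
      Real.one_le_exp (mul_nonneg (by linarith) (by linarith [ht.2]))
    have e4 : B / ((K : ℝ) + 1) * (Real.exp (((K : ℝ) + 1) * (T - t)) - 1)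
        ≤ B * Real.exp ((K + 1) * T) := by
      refine mul_le_mul e2 (by linarith) (by linarith) hB0
    have e5 : ‖z₀‖ * Real.exp (((K : ℝ) + 1) * (T - t)) ≤ ‖z₀‖ * Real.exp ((K + 1) * T) := by
      gcongr
    nlinarith [Real.exp_pos (((K : ℝ) + 1) * T)]
  intro t ht
  have := hU t ht
  rwa [hclid _ (hbound t ht)] at this

/-! ### The systems of ordinary differential equations -/

variable {T : ℝ} {μ σ : ℝ → ℝ} {f : ℝ → ℝ → ℝ → ℝ → ℝ} {g : ℝ → ℝ}

theorem WalterAssumption.continuousOn_time (hdata : WalterAssumption T μ σ f g) (x y z : ℝ) :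
    ContinuousOn (fun t => f t x y z) (Icc 0 T) := by
  have h := hdata.contDiffOn_driver.continuousOn
  have h2 : ContinuousOn (fun t : ℝ => ((t, x, y, z) : ℝ × ℝ × ℝ × ℝ)) (Icc 0 T) := by fun_prop
  exact h.comp h2 fun t ht => ⟨ht, mem_univ _⟩

theorem WalterAssumption.exists_bound_driver (hdata : WalterAssumption T μ σ f g) :
    ∃ C : ℝ, 0 ≤ C ∧ ∀ t ∈ Icc 0 T, ∀ x, |f t x 0 0| ≤ C := by
  obtain ⟨C, hC⟩ := hdata.bounded_driver {0} (Bornology.isBounded_singleton) 0 (by norm_num)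
  refine ⟨max C 0, le_max_right _ _, fun t ht x => le_max_of_le_left ?_⟩
  have := hC (t, x, 0, 0) ⟨ht, rfl⟩
  rwa [norm_iteratedFDerivWithin_zero] at this

theorem WalterAssumption.exists_bound_terminal (hdata : WalterAssumption T μ σ f g) :
    ∃ C : ℝ, 0 ≤ C ∧ ∀ x, |g x| ≤ C := by
  obtain ⟨C, hC⟩ := hdata.bounded_terminal 0 (by norm_num)
  refine ⟨max C 0, le_max_right _ _, fun x => le_max_of_le_left ?_⟩
  simpa using hC x

/-- The right-hand side of the system is globally Lipschitz in the state. -/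
theorem exists_lipschitz_field (hf : LipschitzDriver T f) (x : ℤ → ℝ) (N : ℕ) :
    ∃ K : ℝ≥0, ∀ t ∈ Icc 0 T,
      LipschitzWith K (fun z => -((Q μ σ x N).mulVec z + F σ f x N t z)) := by
  obtain ⟨L, hL, hf⟩ := hf
  have hlin : ∀ A : Matrix (Node N) (Node N) ℝ, ∃ C : ℝ≥0, ∀ z, ‖A.mulVec z‖ ≤ C * ‖z‖ := by
    intro A
    set l := LinearMap.toContinuousLinearMap (Matrix.mulVecLin A)
    exact ⟨‖l‖₊, fun z => l.le_opNorm z⟩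
  obtain ⟨C₁, hC₁⟩ := hlin (Q μ σ x N)
  obtain ⟨C₂, hC₂⟩ := hlin (D₁ x N)
  set S : ℝ≥0 := ∑ i : Node N, ‖σ (x i)‖₊ with hS
  refine ⟨C₁ + ⟨L, hL.le⟩ * (1 + S * C₂), fun t ht => LipschitzWith.of_dist_le_mul fun y z => ?_⟩
  rw [dist_neg_neg, dist_eq_norm, dist_eq_norm, add_sub_add_comm, ← Matrix.mulVec_sub]
  refine (norm_add_le _ _).trans ?_
  push_cast
  rw [add_mul]
  refine add_le_add (hC₁ _) ?_
  change _ ≤ L * (1 + S * C₂) * ‖y - z‖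
  refine (pi_norm_le_iff_of_nonneg (by positivity)).2 fun i => ?_
  rw [Pi.sub_apply, Real.norm_eq_abs]
  refine (hf t ht _ _ _ _ _).trans ?_
  have h1 : |y i - z i| ≤ ‖y - z‖ := norm_le_pi_norm (y - z) i
  have h2 : |σ (x i) * (D₁ x N).mulVec y i - σ (x i) * (D₁ x N).mulVec z i|
      ≤ S * (C₂ * ‖y - z‖) := by
    rw [← mul_sub, abs_mul, ← Pi.sub_apply, ← Matrix.mulVec_sub]
    gcongr
    · rw [hS]; push_cast
      exact Finset.single_le_sum (f := fun i : Node N => ‖σ (x i)‖) (fun _ _ => norm_nonneg _)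
        (Finset.mem_univ i)
    · exact (norm_le_pi_norm _ i).trans (hC₂ _)
  calc _ ≤ L * (‖y - z‖ + S * (C₂ * ‖y - z‖)) := by gcongr
    _ = _ := by ring

theorem exists_isODESolution (hT : 0 < T) (hdata : WalterAssumption T μ σ f g)
    (hf : LipschitzDriver T f) (x : ℤ → ℝ) (N : ℕ) : ∃ U, IsODESolution T μ σ f g x N U := by
  obtain ⟨K, hK⟩ := exists_lipschitz_field (μ := μ) (σ := σ) hf x N
  obtain ⟨U, hU1, hU2⟩ := exists_terminal_solution hT hK (fun z => by
    refine (ContinuousOn.add continuousOn_const ?_).neg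
    exact continuousOn_pi.2 fun i => hdata.continuousOn_time _ _ _) (fun i : Node N => g (x i))
  exact ⟨U, hU2, fun i => by rw [hU1]⟩

theorem isODESolution_unique (hf : LipschitzDriver T f) {x : ℤ → ℝ} {N : ℕ}
    {U V : ℝ → Node N → ℝ} (hU : IsODESolution T μ σ f g x N U)
    (hV : IsODESolution T μ σ f g x N V) : EqOn U V (Icc 0 T) := by
  obtain ⟨K, hK⟩ := exists_lipschitz_field (μ := μ) (σ := σ) hf x N
  refine ODE_solution_unique_of_mem_Icc_left (s := fun _ => univ)
    (fun t ht => (hK t (Ioc_subset_Icc_self ht)).lipschitzOnWith)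
    (fun t ht => (hU.1 t ht).continuousWithinAt) (fun t ht => ?_) (fun _ _ => mem_univ _)
    (fun t ht => (hV.1 t ht).continuousWithinAt) (fun t ht => ?_) (fun _ _ => mem_univ _)
    (funext fun i => by rw [hU.2, hV.2])
  · exact (hU.1 t (Ioc_subset_Icc_self ht)).mono_of_mem_nhdsWithin (Icc_mem_nhdsLE_of_mem ht)
  · exact (hV.1 t (Ioc_subset_Icc_self ht)).mono_of_mem_nhdsWithin (Icc_mem_nhdsLE_of_mem ht)

/-! ### Lattice form of the systems -/

/-- Extension of a grid vector to the whole lattice by zero. -/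
noncomputable def ext {N : ℕ} (z : Node N → ℝ) (i : ℤ) : ℝ :=
  if hi : i ∈ Finset.Icc (-(N : ℤ)) N then z ⟨i, hi⟩ else 0

theorem ext_node {N : ℕ} (z : Node N → ℝ) (i : Node N) : ext z i = z i := by
  simp only [ext, i.2, dite_true]

theorem ext_of_lt {N : ℕ} (z : Node N → ℝ) {i : ℤ} (hi : (N : ℤ) < |i|) : ext z i = 0 := by
  have : i ∉ Finset.Icc (-(N : ℤ)) N := by
    rw [Finset.mem_Icc, ← abs_le]; omega
  simp only [ext, this, dite_false]

theorem sum_node_eq {N : ℕ} (z : Node N → ℝ) (c : ℤ → ℝ) :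
    ∑ j : Node N, c j * z j = ∑ j ∈ Finset.Icc (-(N : ℤ)) N, c j * ext z j := by
  rw [← Finset.sum_coe_sort (Finset.Icc (-(N : ℤ)) N) (fun j => c j * ext z j)]
  exact Finset.sum_congr rfl fun j _ => by rw [ext_node]

theorem three_point_sum {N : ℕ} (z : Node N → ℝ) {i : ℤ} (hi : |i| < N) (a b c : ℝ) :
    ∑ j : Node N, (if (j : ℤ) = i - 1 then a else if (j : ℤ) = i then b
      else if (j : ℤ) = i + 1 then c else 0) * z j
      = a * ext z (i - 1) + b * ext z i + c * ext z (i + 1) := by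
  rw [sum_node_eq z (fun j => if j = i - 1 then a else if j = i then b
      else if j = i + 1 then c else 0)]
  rw [abs_lt] at hi
  have : ∀ j : ℤ, (if j = i - 1 then a else if j = i then b
      else if j = i + 1 then c else 0) * ext z j
      = (if j = i - 1 then a * ext z (i - 1) else 0) + (if j = i then b * ext z i else 0)
        + (if j = i + 1 then c * ext z (i + 1) else 0) := by
    intro j
    by_cases h1 : j = i - 1
    · subst h1; simp; omega
    by_cases h2 : j = i
    · subst h2; simp only [if_neg h1, if_true]; simp
    by_cases h3 : j = i + 1
    · subst h3; simp [show ¬ (i + 1 = i - 1) by omega]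
    · simp [h1, h2, h3]
  simp only [this, Finset.sum_add_distrib, Finset.sum_ite_eq', Finset.mem_Icc]
  rw [if_pos (by omega), if_pos (by omega), if_pos (by omega)]

theorem uniformGrid_step (h : ℝ) (i : ℤ) : step (uniformGrid h) i = h := by
  simp only [step, uniformGrid]; push_cast; ring

theorem D₁_mulVec_interior {h : ℝ} (hh : 0 < h) {N : ℕ} (z : Node N → ℝ) (i : Node N)
    (hi : |(i : ℤ)| < N) : (D₁ (uniformGrid h) N).mulVec z i = cdiff h (ext z) i := by
  have h1 := three_point_sum z hi (-h / (h * (h + h))) ((h - h) / (h * h)) (h / (h * (h + h)))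
  have hi' := abs_lt.1 hi
  have hn : ¬ ((i : ℤ) = -N ∨ (i : ℤ) = N) := by omega
  simp only [Matrix.mulVec, dotProduct, D₁, Matrix.of_apply, uniformGrid_step, if_neg hn]
  rw [h1]
  simp only [cdiff, fdiff, sub_add_cancel]
  field_simp
  ring

theorem D₂_mulVec_interior {h : ℝ} (hh : 0 < h) {N : ℕ} (z : Node N → ℝ) (i : Node N)
    (hi : |(i : ℤ)| < N) : (D₂ (uniformGrid h) N).mulVec z i = cdiff₂ h (ext z) i := by
  have h1 := three_point_sum z hi (2 / (h * (h + h))) (-2 / (h * h)) (2 / (h * (h + h)))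
  have hi' := abs_lt.1 hi
  have hn : ¬ ((i : ℤ) = -N ∨ (i : ℤ) = N) := by omega
  simp only [Matrix.mulVec, dotProduct, D₂, Matrix.of_apply, uniformGrid_step, if_neg hn]
  rw [h1]
  simp only [cdiff₂, fdiff, sub_add_cancel]
  field_simp
  ring

theorem D₁_mulVec_boundary (x : ℤ → ℝ) {N : ℕ} (z : Node N → ℝ) (i : Node N)
    (hi : |(i : ℤ)| = N) : (D₁ x N).mulVec z i = 0 := by
  have hn : (i : ℤ) = -N ∨ (i : ℤ) = N := by
    rcases abs_choice (i : ℤ) with h | h <;> omega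
  simp only [Matrix.mulVec, dotProduct, D₁, Matrix.of_apply, if_pos hn, zero_mul,
    Finset.sum_const_zero]

theorem D₂_mulVec_boundary (x : ℤ → ℝ) {N : ℕ} (z : Node N → ℝ) (i : Node N)
    (hi : |(i : ℤ)| = N) : (D₂ x N).mulVec z i = 0 := by
  have hn : (i : ℤ) = -N ∨ (i : ℤ) = N := by
    rcases abs_choice (i : ℤ) with h | h <;> omega
  simp only [Matrix.mulVec, dotProduct, D₂, Matrix.of_apply, if_pos hn, zero_mul,
    Finset.sum_const_zero]

theorem Q_mulVec (x : ℤ → ℝ) {N : ℕ} (z : Node N → ℝ) (i : Node N) :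
    (Q μ σ x N).mulVec z i = μ (x i) * (D₁ x N).mulVec z i
      + 1 / 2 * σ (x i) ^ 2 * (D₂ x N).mulVec z i := by
  simp only [Q, Matrix.add_mulVec, Matrix.smul_mulVec, ← Matrix.mulVec_mulVec,
    Matrix.mulVec_diagonal, Pi.add_apply, Pi.smul_apply, smul_eq_mul]
  ring

/-- The equation at an interior node. -/
theorem IsODESolution.interior {h : ℝ} (hh : 0 < h) {N : ℕ} {U : ℝ → Node N → ℝ}
    (hU : IsODESolution T μ σ f g (uniformGrid h) N U) {i : ℤ} (hi : |i| < N) {t : ℝ}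
    (ht : t ∈ Icc 0 T) :
    HasDerivWithinAt (fun s => ext (U s) i)
      (-(μ (uniformGrid h i) * cdiff h (ext (U t)) i
          + 1 / 2 * σ (uniformGrid h i) ^ 2 * cdiff₂ h (ext (U t)) i
        + f t (uniformGrid h i) (ext (U t) i) (σ (uniformGrid h i) * cdiff h (ext (U t)) i)))
      (Icc 0 T) t := by
  have hm : i ∈ Finset.Icc (-(N : ℤ)) N := by
    rw [Finset.mem_Icc, ← abs_le]; omega
  have h1 := hasDerivWithinAt_pi.1 (hU.1 t ht) ⟨i, hm⟩
  have e : ∀ z : Node N → ℝ, z ⟨i, hm⟩ = ext z i := fun z => (ext_node z ⟨i, hm⟩).symm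
  simp only [Pi.neg_apply, Pi.add_apply, F, Q_mulVec, D₁_mulVec_interior hh _ ⟨i, hm⟩ hi,
    D₂_mulVec_interior hh _ ⟨i, hm⟩ hi] at h1
  simpa only [e] using h1

/-- The equation at the two end nodes. -/
theorem IsODESolution.boundary {x : ℤ → ℝ} {N : ℕ} {U : ℝ → Node N → ℝ}
    (hU : IsODESolution T μ σ f g x N U) {i : ℤ} (hi : |i| = N) {t : ℝ} (ht : t ∈ Icc 0 T) :
    HasDerivWithinAt (fun s => ext (U s) i) (-f t (x i) (ext (U t) i) 0) (Icc 0 T) t := by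
  have hm : i ∈ Finset.Icc (-(N : ℤ)) N := by
    rw [Finset.mem_Icc, ← abs_le]; omega
  have h1 := hasDerivWithinAt_pi.1 (hU.1 t ht) ⟨i, hm⟩
  have e : ∀ z : Node N → ℝ, z ⟨i, hm⟩ = ext z i := fun z => (ext_node z ⟨i, hm⟩).symm
  simp only [Pi.neg_apply, Pi.add_apply, F, Q_mulVec, D₁_mulVec_boundary x _ ⟨i, hm⟩ hi,
    D₂_mulVec_boundary x _ ⟨i, hm⟩ hi, mul_zero, add_zero, zero_add] at h1
  simpa only [e] using h1

theorem IsODESolution.terminal {x : ℤ → ℝ} {N : ℕ} {U : ℝ → Node N → ℝ}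
    (hU : IsODESolution T μ σ f g x N U) {i : ℤ} (hi : |i| ≤ N) : ext (U T) i = g (x i) := by
  have hm : i ∈ Finset.Icc (-(N : ℤ)) N := by
    rwa [Finset.mem_Icc, ← abs_le]
  exact (ext_node (U T) ⟨i, hm⟩).trans (hU.2 _)

/-! ### Uniform bounds for the semidiscrete solutions -/

/-- A common constant for all bounds on the data that the energy estimates use. -/
structure DataBound (L T : ℝ) (μ σ : ℝ → ℝ) (f : ℝ → ℝ → ℝ → ℝ → ℝ) (g : ℝ → ℝ) : Prop where
  one_le : 1 ≤ L
  drift_lipschitz : ∀ x x', |μ x - μ x'| ≤ L * |x - x'|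
  diffusion_lipschitz : ∀ x x', |σ x - σ x'| ≤ L * |x - x'|
  drift_growth : ∀ x, |μ x| ≤ L * (1 + |x|)
  diffusion_growth : ∀ x, |σ x| ≤ L * (1 + |x|)
  driver_lipschitz : ∀ t ∈ Icc 0 T, ∀ x y y' z z' : ℝ,
    |f t x y z - f t x y' z'| ≤ L * (|y - y'| + |z - z'|)
  driver_zero : ∀ t ∈ Icc 0 T, ∀ x, |f t x 0 0| ≤ L
  terminal : ∀ x, |g x| ≤ L

theorem exists_dataBound (hcoef : LipschitzCoefficients μ σ) (hdata : WalterAssumption T μ σ f g)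
    (hf : LipschitzDriver T f) : ∃ L, DataBound L T μ σ f g := by
  obtain ⟨L₁, hL₁, h1⟩ := hcoef
  obtain ⟨L₂, hL₂, h2⟩ := hf
  obtain ⟨C₁, hC₁, h3⟩ := hdata.exists_bound_driver
  obtain ⟨C₂, hC₂, h4⟩ := hdata.exists_bound_terminal
  have a1 := abs_nonneg (μ 0)
  have a2 := abs_nonneg (σ 0)
  set L := 1 + L₁ + L₂ + C₁ + C₂ + |μ 0| + |σ 0| with hL
  have hg : ∀ c : ℝ → ℝ, |c 0| ≤ L → (∀ x x', |c x - c x'| ≤ L * |x - x'|) →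
      ∀ x, |c x| ≤ L * (1 + |x|) := by
    intro c h0 hc x
    have := hc x 0
    rw [sub_zero] at this
    have h5 : |c x| ≤ |c x - c 0| + |c 0| := by simpa using abs_add_le (c x - c 0) (c 0)
    linarith
  have hμ : ∀ x x', |μ x - μ x'| ≤ L * |x - x'| := fun x x' => by
    have := h1 x x'
    have : L₁ * |x - x'| ≤ L * |x - x'| := by gcongr; linarith
    linarith [abs_nonneg (σ x - σ x')]
  have hσ : ∀ x x', |σ x - σ x'| ≤ L * |x - x'| := fun x x' => by
    have := h1 x x'
    have : L₁ * |x - x'| ≤ L * |x - x'| := by gcongr; linarith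
    linarith [abs_nonneg (μ x - μ x')]
  exact ⟨L, by linarith, hμ, hσ, hg μ (by linarith) hμ, hg σ (by linarith) hσ,
    fun t ht x y y' z z' => (h2 t ht x y y' z z').trans (by gcongr; linarith),
    fun t ht x => (h3 t ht x).trans (by linarith), fun x => (h4 x).trans (by linarith)⟩

theorem DataBound.drift_step {L : ℝ} (hb : DataBound L T μ σ f g) {h : ℝ} (hh : 0 < h) (i : ℤ) :
    |μ (uniformGrid h (i + 1)) - μ (uniformGrid h i)| ≤ L * h := by
  have := hb.drift_lipschitz (uniformGrid h (i + 1)) (uniformGrid h i)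
  rwa [show uniformGrid h (i + 1) - uniformGrid h i = h from uniformGrid_step h i,
    abs_of_pos hh] at this

theorem DataBound.diffusion_step {L : ℝ} (hb : DataBound L T μ σ f g) {h : ℝ} (hh : 0 < h)
    (i : ℤ) : |σ (uniformGrid h (i + 1)) - σ (uniformGrid h i)| ≤ L * h := by
  have := hb.diffusion_lipschitz (uniformGrid h (i + 1)) (uniformGrid h i)
  rwa [show uniformGrid h (i + 1) - uniformGrid h i = h from uniformGrid_step h i,
    abs_of_pos hh] at this

theorem hasDerivWithinAt_sum_sq {s : Set ℝ} {t : ℝ} (S : Finset ℤ) (c : ℤ → ℝ) {V : ℝ → ℤ → ℝ}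
    {P : ℤ → ℝ} (hV : ∀ i ∈ S, HasDerivWithinAt (fun s => V s i) (P i) s t) :
    HasDerivWithinAt (fun s => ∑ i ∈ S, (c i * V s i) ^ 2)
      (∑ i ∈ S, 2 * c i ^ 2 * V t i * P i) s t := by
  refine HasDerivWithinAt.fun_sum fun i hi => ?_
  have := ((hV i hi).const_mul (c i)).pow 2
  refine this.congr_deriv ?_
  simp; ring

/-- Weighted stability of the semidiscrete equation. -/
theorem weighted_stability {L : ℝ} (hb : DataBound L T μ σ f g) (j : ℕ) (H : ℝ) :
    ∃ C : ℝ, 0 < C ∧ ∀ (h : ℝ) (_ : 0 < h) (_ : h ≤ H) (a : ℝ) (_ : 0 ≤ a) (M : ℕ)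
      (V P : ℝ → ℤ → ℝ) (r : ℝ → ℤ → ℝ) (R : ℝ)
      (_ : ∀ t ∈ Icc 0 T, ∀ i : ℤ, (M : ℤ) ≤ |i| → V t i = 0)
      (_ : ∀ t ∈ Icc 0 T, ∀ i, HasDerivWithinAt (fun s => V s i) (P t i) (Icc 0 T) t)
      (_ : ∀ t ∈ Icc 0 T, ∀ i, cut (j + 1) a h i * V t i ≠ 0 →
        |P t i + (μ (uniformGrid h i) * cdiff h (V t) i
            + 1 / 2 * σ (uniformGrid h i) ^ 2 * cdiff₂ h (V t) i)|
          ≤ L * (|V t i| + |σ (uniformGrid h i)| * |cdiff h (V t) i|) + r t i)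
      (_ : ∀ t ∈ Icc 0 T, a ^ 2 * (h * ∑ i ∈ Finset.Icc (-(M : ℤ)) M, (wt h i ^ j * V t i) ^ 2)
        + h * ∑ i ∈ Finset.Icc (-(M : ℤ)) M, (cut (j + 1) a h i * r t i) ^ 2 ≤ R)
      (_ : h * ∑ i ∈ Finset.Icc (-(M : ℤ)) M, (cut (j + 1) a h i * V T i) ^ 2 ≤ R),
      ∀ t ∈ Icc 0 T,
        h * ∑ i ∈ Finset.Icc (-(M : ℤ)) M, (cut (j + 1) a h i * V t i) ^ 2 ≤ C * R := by
  obtain ⟨K, hK, hen⟩ := energy_cut hb.one_le j H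
  -- Grönwall at rate `K`, with terminal energy at most `R` and forcing `(K + 1) * R`.
  refine ⟨Real.exp (K * T) * (1 + (K + 1) / K), by positivity, ?_⟩
  intro h hh hH a ha M V P r R hV hP heq hR hRT t ht
  set Fn : ℝ → ℝ := fun s => h * ∑ i ∈ Finset.Icc (-(M : ℤ)) M, (cut (j + 1) a h i * V s i) ^ 2
    with hFn
  have hF0 : ∀ s, 0 ≤ Fn s := fun s => by positivity
  have hR0 : 0 ≤ R := (hF0 T).trans hRT
  have hG := backward_gronwall (T := T) (R := (K + 1) * R) hK (F := Fn)
    (F' := fun t => h * ∑ i ∈ Finset.Icc (-(M : ℤ)) M, 2 * cut (j + 1) a h i ^ 2 * V t i * P t i)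
    (fun s hs => (hasDerivWithinAt_sum_sq _ _ fun i _ => hP s hs i).const_mul h)
    (fun s hs => ?_) (by have := hF0 T; positivity) t ht
  · have e : 0 ≤ (K + 1) * R / K := by positivity
    calc Fn t ≤ Fn t + (K + 1) * R / K := by linarith
      _ ≤ Real.exp (K * T) * (Fn T + (K + 1) * R / K) := hG
      _ ≤ Real.exp (K * T) * (R + (K + 1) * R / K) := by gcongr
      _ = _ := by ring
  · have h1 := hen h hh hH a ha M (fun i => μ (uniformGrid h i)) (fun i => σ (uniformGrid h i))
      (V s) (P s) (r s) (hV s hs) (hb.diffusion_step hh) (hb.drift_step hh)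
      (fun i => hb.diffusion_growth _) (fun i => hb.drift_growth _) (heq s hs)
    have h2 := mul_le_mul_of_nonneg_left h1 hh.le
    refine le_trans ?_ h2
    rw [Finset.sum_sub_distrib, Finset.sum_sub_distrib, ← Finset.mul_sum, Finset.sum_add_distrib,
      ← Finset.mul_sum]
    -- Only the sign of the coercive term is used here; its size is exploited in `local_stability`.
    have h3 : 0 ≤ h * ∑ i ∈ Finset.Icc (-(M : ℤ)) M,
        1 / 4 * (cut (j + 1) a h i * σ (uniformGrid h i)) ^ 2 *
          (fdiff h (V s) i ^ 2 + fdiff h (V s) (i - 1) ^ 2) := by positivity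
    have h4 := hR s hs
    set X := h * ∑ i ∈ Finset.Icc (-(M : ℤ)) M, (wt h i ^ j * V s i) ^ 2 with hX
    set Y := h * ∑ i ∈ Finset.Icc (-(M : ℤ)) M, (cut (j + 1) a h i * r s i) ^ 2 with hY
    have h5 : 0 ≤ a ^ 2 * X := by positivity
    have h6 : 0 ≤ Y := by positivity
    have h7 : K * (a ^ 2 * X) ≤ K * R := by gcongr; linarith
    have e : h * (∑ i ∈ Finset.Icc (-(M : ℤ)) M,
        1 / 4 * (cut (j + 1) a h i * σ (uniformGrid h i)) ^ 2 *
          (fdiff h (V s) i ^ 2 + fdiff h (V s) (i - 1) ^ 2)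
        - K * (∑ i ∈ Finset.Icc (-(M : ℤ)) M, (cut (j + 1) a h i * V s i) ^ 2
          + a ^ 2 * ∑ i ∈ Finset.Icc (-(M : ℤ)) M, (wt h i ^ j * V s i) ^ 2)
        - ∑ i ∈ Finset.Icc (-(M : ℤ)) M, (cut (j + 1) a h i * r s i) ^ 2)
      = h * ∑ i ∈ Finset.Icc (-(M : ℤ)) M,
        1 / 4 * (cut (j + 1) a h i * σ (uniformGrid h i)) ^ 2 *
          (fdiff h (V s) i ^ 2 + fdiff h (V s) (i - 1) ^ 2)
        - K * Fn s - K * (a ^ 2 * X) - Y := by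
      simp only [hFn, hX, hY]; ring
    rw [e]
    linarith

/-- The values at the two end nodes are bounded uniformly in the grid. -/
theorem boundary_sq_le {L : ℝ} (hb : DataBound L T μ σ f g) {x : ℤ → ℝ} {N : ℕ}
    {U : ℝ → Node N → ℝ} (hU : IsODESolution T μ σ f g x N U) {i : ℤ} (hi : |i| = N) {t : ℝ}
    (ht : t ∈ Icc 0 T) : ext (U t) i ^ 2 ≤ Real.exp (3 * L * T) * (L ^ 2 + 1) := by
  have hL := hb.one_le
  -- At an end node the equation is scalar, with third argument of the driver equal to zero in its
  -- last slot. The constants come from `2|y|(L|y| + L) ≤ 3L y² + L`.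
  have hG := backward_gronwall (T := T) (R := L) (C := 3 * L) (by linarith)
    (F := fun s => ext (U s) i ^ 2)
    (F' := fun s => 2 * ext (U s) i * -f s (x i) (ext (U s) i) 0)
    (fun s hs => ((hU.boundary hi hs).pow 2).congr_deriv (by simp)) (fun s hs => ?_)
    (by positivity) t ht
  · have e : L / (3 * L) = 1 / 3 := by field_simp
    rw [e, hU.terminal hi.le] at hG
    have h1 : g (x i) ^ 2 ≤ L ^ 2 := by
      rw [← sq_abs]; gcongr; exact hb.terminal _
    have : Real.exp (3 * L * T) * (g (x i) ^ 2 + 1 / 3) ≤ Real.exp (3 * L * T) * (L ^ 2 + 1) := by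
      gcongr; norm_num
    linarith
  · set y := ext (U s) i
    have h1 := hb.driver_lipschitz s hs (x i) y 0 0 0
    have h2 := hb.driver_zero s hs (x i)
    have h3 : |f s (x i) y 0| ≤ L * |y| + L := by
      have := abs_add_le (f s (x i) y 0 - f s (x i) 0 0) (f s (x i) 0 0)
      simp only [sub_add_cancel, sub_zero, sub_self, abs_zero, add_zero] at this h1
      linarith
    have h4 : |2 * y * -f s (x i) y 0| ≤ 2 * |y| * (L * |y| + L) := by
      rw [abs_mul, abs_mul, abs_neg, abs_two]; gcongr
    have h5 := neg_le_of_abs_le h4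
    nlinarith [sq_nonneg (|y| - 1), sq_abs y]

theorem tendsto_wt {h : ℝ} (hh : 0 < h) (c : ℤ) :
    Tendsto (fun N : ℕ => wt h ((N : ℤ) - c)) atTop (𝓝 0) := by
  refine tendsto_inv_atTop_zero.comp (tendsto_atTop_add_const_left _ _ ?_)
  refine tendsto_abs_atTop_atTop.comp ?_
  have : (fun N : ℕ => uniformGrid h ((N : ℤ) - c)) = fun N : ℕ => (N : ℝ) * h + -(c * h) := by
    funext N; simp only [uniformGrid]; push_cast; ring
  rw [this]
  exact tendsto_atTop_add_const_right _ _ (tendsto_natCast_atTop_atTop.atTop_mul_const hh)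

/-- A bounded lattice function supported on two nodes `|i| = n` has a small weighted norm. -/
theorem sum_ite_abs_le {h : ℝ} (S : Finset ℤ) (n : ℤ) (X : ℝ) :
    ∑ i ∈ S, (if |i| = n then X * wt h i ^ 2 else 0) ≤ 2 * (|X| * wt h n ^ 2) := by
  have : ∀ i ∈ S, (if |i| = n then X * wt h i ^ 2 else 0) ≤
      (if i = n then |X| * wt h n ^ 2 else 0) + (if i = -n then |X| * wt h n ^ 2 else 0) := by
    intro i _
    have h0 : 0 ≤ |X| * wt h n ^ 2 := by positivity
    split_ifs with h1 h2 h3 h3 h2 h3 h3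
    all_goals first
      | positivity
      | (have : X * wt h i ^ 2 ≤ |X| * wt h n ^ 2 := by
          first
            | (subst h2; gcongr; exact le_abs_self _)
            | (subst h3; rw [wt_neg]; gcongr; exact le_abs_self _)
         linarith)
      | (exfalso; rcases abs_choice i with h | h <;> omega)
  refine (Finset.sum_le_sum this).trans ?_
  rw [Finset.sum_add_distrib, Finset.sum_ite_eq', Finset.sum_ite_eq']
  have h0 : 0 ≤ |X| * wt h n ^ 2 := by positivity
  split_ifs <;> linarith

theorem cdiff_eq {h : ℝ} (V : ℤ → ℝ) (i : ℤ) :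
    cdiff h V i = (V (i + 1) - V (i - 1)) / (2 * h) := by
  simp only [cdiff, fdiff, sub_add_cancel]; ring

theorem cdiff₂_eq {h : ℝ} (V : ℤ → ℝ) (i : ℤ) :
    cdiff₂ h V i = (V (i + 1) - 2 * V i + V (i - 1)) / h ^ 2 := by
  simp only [cdiff₂, fdiff, sub_add_cancel]; ring

theorem wt_anti {h : ℝ} {m n : ℤ} (hmn : |m| ≤ |n|) : wt h n ≤ wt h m := by
  have : |uniformGrid h m| ≤ |uniformGrid h n| := by
    simp only [uniformGrid, abs_mul]
    refine mul_le_mul_of_nonneg_right ?_ (abs_nonneg h)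
    exact_mod_cast hmn
  unfold wt
  gcongr

theorem IsODESolution.differentiableWithinAt {x : ℤ → ℝ} {N : ℕ} {U : ℝ → Node N → ℝ}
    (hU : IsODESolution T μ σ f g x N U) (i : ℤ) {t : ℝ} (ht : t ∈ Icc 0 T) :
    DifferentiableWithinAt ℝ (fun s => ext (U s) i) (Icc 0 T) t := by
  by_cases hi : i ∈ Finset.Icc (-(N : ℤ)) N
  · have h1 := hasDerivWithinAt_pi.1 (hU.1 t ht) ⟨i, hi⟩
    have e : ∀ z : Node N → ℝ, z ⟨i, hi⟩ = ext z i := fun z => (ext_node z ⟨i, hi⟩).symm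
    simp only [e] at h1
    exact h1.differentiableWithinAt
  · have e : ∀ z : Node N → ℝ, ext z i = 0 := fun z => by simp only [ext, hi, dite_false]
    simp only [e]
    exact differentiableWithinAt_const _

/-- Bound of the consistency error caused by replacing the boundary values by zero. -/
theorem DataBound.boundary_residual {L : ℝ} (hb : DataBound L T μ σ f g) {h : ℝ} (hh : 0 < h)
    {N : ℕ} {b : ℝ} {E : ℤ → ℝ} (hE : ∀ i, |E i| ≤ b) (hE0 : ∀ i : ℤ, |i| ≠ (N : ℤ) → E i = 0) {i : ℤ}
    (hi : |i| < N) :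
    (|μ (uniformGrid h i)| + L * |σ (uniformGrid h i)|) * |cdiff h E i|
        + 1 / 2 * σ (uniformGrid h i) ^ 2 * |cdiff₂ h E i|
      ≤ if |i| = (N : ℤ) - 1 then
          (2 * L ^ 2 * (b / h) + L ^ 2 * (b / h ^ 2)) * (1 + |uniformGrid h i|) ^ 2 else 0 := by
  have hL := hb.one_le
  have hEi : E i = 0 := hE0 i hi.ne
  have hb0 : 0 ≤ b := (abs_nonneg _).trans (hE 0)
  split_ifs with h1
  · set ρ := 1 + |uniformGrid h i| with hρ
    have hρ1 : 1 ≤ ρ := by rw [hρ]; linarith [abs_nonneg (uniformGrid h i)]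
    have c1 : |cdiff h E i| ≤ b / h := by
      rw [cdiff_eq, abs_div, abs_of_pos (by positivity : 0 < 2 * h), div_le_div_iff₀ (by positivity) hh]
      have := abs_sub (E (i + 1)) (E (i - 1))
      nlinarith [hE (i + 1), hE (i - 1)]
    have c2 : |cdiff₂ h E i| ≤ 2 * (b / h ^ 2) := by
      rw [cdiff₂_eq, hEi, abs_div, abs_of_pos (by positivity : 0 < h ^ 2), ← mul_div_assoc]
      gcongr
      rw [mul_zero, sub_zero]
      have := abs_add_le (E (i + 1)) (E (i - 1))
      linarith [hE (i + 1), hE (i - 1)]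
    have m1 : |μ (uniformGrid h i)| ≤ L ^ 2 * ρ ^ 2 := by
      refine (hb.drift_growth _).trans ?_
      exact mul_le_mul (le_self_pow₀ hL two_ne_zero) (le_self_pow₀ hρ1 two_ne_zero) (by linarith)
        (by positivity)
    have m2 : L * |σ (uniformGrid h i)| ≤ L ^ 2 * ρ ^ 2 := by
      have : L * |σ (uniformGrid h i)| ≤ L * (L * ρ) := by gcongr; exact hb.diffusion_growth _
      refine this.trans ?_
      rw [← mul_assoc, ← sq]
      gcongr
      exact le_self_pow₀ hρ1 two_ne_zero
    have m3 : σ (uniformGrid h i) ^ 2 ≤ L ^ 2 * ρ ^ 2 := by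
      rw [← sq_abs, ← mul_pow]
      gcongr
      exact hb.diffusion_growth _
    calc _ ≤ (L ^ 2 * ρ ^ 2 + L ^ 2 * ρ ^ 2) * (b / h)
          + 1 / 2 * (L ^ 2 * ρ ^ 2) * (2 * (b / h ^ 2)) := by gcongr
      _ = _ := by ring
  · have e1 : E (i + 1) = 0 := hE0 _ (by
      rw [Int.abs_eq_natAbs] at *; omega)
    have e2 : E (i - 1) = 0 := hE0 _ (by
      rw [Int.abs_eq_natAbs] at *; omega)
    rw [cdiff_eq, cdiff₂_eq, e1, e2, hEi]
    simp

/-- Weighted bounds of the semidiscrete solutions, uniform in the mesh size once the domain is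
large enough. -/
theorem weighted_apriori {L : ℝ} (hb : DataBound L T μ σ f g) (j : ℕ) {H : ℝ} (hH0 : 0 < H) :
    ∃ C : ℝ, 0 < C ∧ ∀ h : ℝ, 0 < h → h ≤ H → ∀ᶠ N : ℕ in atTop,
      ∀ U, IsODESolution T μ σ f g (uniformGrid h) N U → ∀ t ∈ Icc 0 T,
        h * ∑ i ∈ Finset.Icc (-(N : ℤ)) N, (wt h i ^ (j + 3) * ext (U t) i) ^ 2 ≤ C := by
  obtain ⟨C, hC, hst⟩ := weighted_stability hb (j + 2) H
  have hL := hb.one_le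
  set b : ℝ := 1 + Real.exp (3 * L * T) * (L ^ 2 + 1) with hbdef
  have hb0 : 0 < b := by positivity
  -- `2 * L ^ 2 * (2 + H)` pays for `f(t,x,0,0)`, the inner `1` for the residual at `|i| = N - 1`,
  -- and the outer `1` for the end nodes themselves.
  refine ⟨C * (2 * L ^ 2 * (2 + H) + 1) + 1, by positivity, ?_⟩
  intro h hh hH
  -- Size of the residual made at `|i| = N - 1` by deleting the end values. It blows up as `h → 0`,
  -- but at fixed `h` its weighted norm tends to zero with `N → ∞`; hence the final bound does not
  -- depend on `h`, while the required `N` does.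
  set Cr : ℝ := 2 * L ^ 2 * (b / h) + L ^ 2 * (b / h ^ 2) with hCr
  have ev1 : ∀ᶠ N : ℕ in atTop, h * (2 * (|2 * Cr ^ 2| * wt h ((N : ℤ) - 1) ^ 2)) ≤ 1 := by
    have : Tendsto (fun N : ℕ => h * (2 * (|2 * Cr ^ 2| * wt h ((N : ℤ) - 1) ^ 2))) atTop
        (𝓝 (h * (2 * (|2 * Cr ^ 2| * 0 ^ 2)))) :=
      ((((tendsto_wt hh 1).pow 2).const_mul _).const_mul _).const_mul _
    rw [show h * (2 * (|2 * Cr ^ 2| * (0 : ℝ) ^ 2)) = 0 by ring] at this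
    exact (this.eventually (gt_mem_nhds one_pos)).mono fun _ h => h.le
  have ev2 : ∀ᶠ N : ℕ in atTop, h * (2 * (|b ^ 2| * wt h (N : ℤ) ^ 2)) ≤ 1 := by
    have : Tendsto (fun N : ℕ => h * (2 * (|b ^ 2| * wt h ((N : ℤ) - 0) ^ 2))) atTop
        (𝓝 (h * (2 * (|b ^ 2| * 0 ^ 2)))) :=
      ((((tendsto_wt hh 0).pow 2).const_mul _).const_mul _).const_mul _
    rw [show h * (2 * (|b ^ 2| * (0 : ℝ) ^ 2)) = 0 by ring] at this
    simp only [sub_zero] at this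
    exact (this.eventually (gt_mem_nhds one_pos)).mono fun _ h => h.le
  filter_upwards [ev1, ev2] with N hN1 hN2 U hU t ht
  have hbd : ∀ s ∈ Icc 0 T, ∀ i : ℤ, |i| = N → |ext (U s) i| ≤ b := fun s hs i hi => by
    have := boundary_sq_le hb hU hi hs
    rw [hbdef]
    nlinarith [sq_nonneg (|ext (U s) i| - 1), sq_abs (ext (U s) i)]
  -- The end nodes obey a different equation, so their values are removed before testing and
  -- restored at the end.
  set V : ℝ → ℤ → ℝ := fun s i => if |i| < (N : ℤ) then ext (U s) i else 0 with hV
  have hwj : ∀ i, wt h i ^ (j + 3) ≤ wt h i := fun i =>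
    pow_le_of_le_one (wt_pos _ _).le (wt_le_one _ _) (by omega)
  have hw0 : ∀ i, 0 ≤ wt h i ^ (j + 3) := fun i => pow_nonneg (wt_pos _ _).le _
  -- Of the powers of the weight, two absorb the quadratic growth of `σ²`, and one is left to be
  -- square summable and to decay at the ends.
  have hwρ : ∀ i, wt h i ^ (j + 3) * (1 + |uniformGrid h i|) ^ 2 ≤ wt h i := fun i => by
    have e : wt h i ^ (j + 3) * (1 + |uniformGrid h i|) ^ 2
        = wt h i ^ (j + 1) * (wt h i * (1 + |uniformGrid h i|)) ^ 2 := by ring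
    rw [e, wt_mul_one_add, one_pow, mul_one]
    exact pow_le_of_le_one (wt_pos _ _).le (wt_le_one _ _) (by omega)
  have hsum := sum_wt_sq_le hh N
  -- With `a = 0` there is no truncation, and the term with the norm of lower order drops out.
  have hmain := hst h hh hH 0 le_rfl N V
    (fun s i => if |i| < (N : ℤ) then
      (-(μ (uniformGrid h i) * cdiff h (ext (U s)) i
          + 1 / 2 * σ (uniformGrid h i) ^ 2 * cdiff₂ h (ext (U s)) i
        + f s (uniformGrid h i) (ext (U s) i) (σ (uniformGrid h i) * cdiff h (ext (U s)) i)))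
      else 0)
    (fun _ i => L + if |i| = (N : ℤ) - 1 then Cr * (1 + |uniformGrid h i|) ^ 2 else 0)
    (2 * L ^ 2 * (2 + H) + 1)
    (fun s _ i hi => if_neg (not_lt.2 hi))
    (fun s hs i => by
      by_cases hi : |i| < (N : ℤ)
      · simp only [hV, hi, if_true]
        exact hU.interior hh hi hs
      · simp only [hV, hi, if_false]
        exact hasDerivWithinAt_const _ _ _)
    (fun s hs i hi => by
      have hi' : |i| < (N : ℤ) := by
        by_contra hn
        exact hi (by simp only [hV, if_neg hn, mul_zero])
      have hVi : V s i = ext (U s) i := if_pos hi'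
      set W := ext (U s) with hW
      set E : ℤ → ℝ := fun i => W i - V s i with hE
      have hEb : ∀ i, |E i| ≤ b := fun i => by
        simp only [hE, hV]
        split_ifs with h1
        · change |W i - W i| ≤ b
          rw [sub_self, abs_zero]; exact hb0.le
        · rw [sub_zero]
          rcases (not_lt.1 h1).eq_or_lt with h2 | h2
          · exact hbd s hs i h2.symm
          · rw [hW, ext_of_lt _ h2, abs_zero]; exact hb0.le
      have hE0 : ∀ i, |i| ≠ (N : ℤ) → E i = 0 := fun i hn => by
        simp only [hE, hV]
        split_ifs with h1
        · exact sub_self _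
        · rw [sub_zero, hW, ext_of_lt]
          exact lt_of_le_of_ne (not_lt.1 h1) (Ne.symm hn)
      have hres := hb.boundary_residual hh hEb hE0 hi'
      have e1 : cdiff h W i = cdiff h (V s) i + cdiff h E i := by
        simp only [cdiff_eq, hE]; ring
      have e2 : cdiff₂ h W i = cdiff₂ h (V s) i + cdiff₂ h E i := by
        simp only [cdiff₂_eq, hE]; ring
      simp only [if_pos hi']
      set m := μ (uniformGrid h i)
      set sg := σ (uniformGrid h i)
      have hf1 := hb.driver_lipschitz s hs (uniformGrid h i) (W i) 0 (sg * cdiff h W i) 0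
      have hf2 := hb.driver_zero s hs (uniformGrid h i)
      rw [sub_zero, sub_zero, abs_mul, e1] at hf1
      have hf3 : |sg| * |cdiff h (V s) i + cdiff h E i|
          ≤ |sg| * |cdiff h (V s) i| + |sg| * |cdiff h E i| := by
        rw [← mul_add]; gcongr; exact abs_add_le _ _
      rw [hVi, e1, e2]
      set fv := f s (uniformGrid h i) (W i) (sg * (cdiff h (V s) i + cdiff h E i))
      have hf4 : |fv| ≤ L * (|W i| + |sg| * |cdiff h (V s) i|) + L * |sg| * |cdiff h E i| + L := by
        have := abs_add_le (fv - f s (uniformGrid h i) 0 0) (f s (uniformGrid h i) 0 0)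
        rw [sub_add_cancel] at this
        have := mul_le_mul_of_nonneg_left hf3 (by linarith : 0 ≤ L)
        linarith
      have hX : -(m * (cdiff h (V s) i + cdiff h E i)
            + 1 / 2 * sg ^ 2 * (cdiff₂ h (V s) i + cdiff₂ h E i) + fv)
          + (m * cdiff h (V s) i + 1 / 2 * sg ^ 2 * cdiff₂ h (V s) i)
          = -(m * cdiff h E i + 1 / 2 * sg ^ 2 * cdiff₂ h E i + fv) := by ring
      rw [hX, abs_neg]
      have h5 : |m * cdiff h E i + 1 / 2 * sg ^ 2 * cdiff₂ h E i + fv|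
          ≤ |m| * |cdiff h E i| + 1 / 2 * sg ^ 2 * |cdiff₂ h E i| + |fv| := by
        refine (abs_add_three _ _ _).trans (le_of_eq ?_)
        rw [abs_mul, abs_mul, abs_of_nonneg (by positivity : 0 ≤ 1 / 2 * sg ^ 2)]
      rw [← hCr] at hres
      linarith)
    (fun s hs => by
      have h1 : ∀ i ∈ Finset.Icc (-(N : ℤ)) N, (cut (j + 2 + 1) 0 h i
          * (L + if |i| = (N : ℤ) - 1 then Cr * (1 + |uniformGrid h i|) ^ 2 else 0)) ^ 2
          ≤ 2 * L ^ 2 * wt h i ^ 2 + if |i| = (N : ℤ) - 1 then 2 * Cr ^ 2 * wt h i ^ 2 else 0 := by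
        intro i _
        rw [cut_zero (by omega)]
        have h2 : (wt h i ^ (j + 3) * L) ^ 2 ≤ L ^ 2 * wt h i ^ 2 := by
          rw [mul_pow, mul_comm]
          have := pow_le_pow_left₀ (hw0 i) (hwj i) 2
          gcongr
        split_ifs with h3
        · have h4 : (Cr * (wt h i ^ (j + 3) * (1 + |uniformGrid h i|) ^ 2)) ^ 2
              ≤ Cr ^ 2 * wt h i ^ 2 := by
            rw [mul_pow]
            have := pow_le_pow_left₀ (mul_nonneg (hw0 i) (sq_nonneg _)) (hwρ i) 2
            gcongr
          nlinarith [sq_nonneg (wt h i ^ (j + 3) * L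
            - Cr * (wt h i ^ (j + 3) * (1 + |uniformGrid h i|) ^ 2))]
        · rw [add_zero, add_zero]
          nlinarith [sq_nonneg (L * wt h i)]
      have h2 := Finset.sum_le_sum h1
      rw [Finset.sum_add_distrib, ← Finset.mul_sum] at h2
      have h3 := sum_ite_abs_le (h := h) (Finset.Icc (-(N : ℤ)) N) ((N : ℤ) - 1) (2 * Cr ^ 2)
      have h4 := mul_le_mul_of_nonneg_left (h2.trans (add_le_add_right h3 _)) hh.le
      rw [mul_add, show h * (2 * L ^ 2 * ∑ i ∈ Finset.Icc (-(N : ℤ)) N, wt h i ^ 2)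
        = 2 * L ^ 2 * (h * ∑ i ∈ Finset.Icc (-(N : ℤ)) N, wt h i ^ 2) by ring] at h4
      have h5 : 2 * L ^ 2 * (h * ∑ i ∈ Finset.Icc (-(N : ℤ)) N, wt h i ^ 2)
          ≤ 2 * L ^ 2 * (2 + H) := by gcongr; linarith
      rw [zero_pow two_ne_zero, zero_mul, zero_add]
      linarith)
    (by
      have h1 : ∀ i ∈ Finset.Icc (-(N : ℤ)) N, (cut (j + 2 + 1) 0 h i * V T i) ^ 2
          ≤ L ^ 2 * wt h i ^ 2 := by
        intro i hi
        rw [cut_zero (by omega), mul_pow, mul_comm]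
        have h2 : V T i ^ 2 ≤ L ^ 2 := by
          simp only [hV]
          split_ifs with h3
          · rw [hU.terminal h3.le, ← sq_abs]
            gcongr
            exact hb.terminal _
          · rw [zero_pow two_ne_zero]; positivity
        have := pow_le_pow_left₀ (hw0 i) (hwj i) 2
        gcongr
      have h2 := mul_le_mul_of_nonneg_left (Finset.sum_le_sum h1) hh.le
      rw [← Finset.mul_sum, mul_left_comm h] at h2
      have h5 : L ^ 2 * (h * ∑ i ∈ Finset.Icc (-(N : ℤ)) N, wt h i ^ 2)
          ≤ L ^ 2 * (2 + H) := by gcongr; linarith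
      have : 0 ≤ L ^ 2 * (2 + H) := by positivity
      linarith) t ht
  have h1 : ∀ i ∈ Finset.Icc (-(N : ℤ)) N, (wt h i ^ (j + 3) * ext (U t) i) ^ 2
      ≤ (cut (j + 2 + 1) 0 h i * V t i) ^ 2
        + if |i| = (N : ℤ) then b ^ 2 * wt h i ^ 2 else 0 := by
    intro i hi
    rw [cut_zero (by omega)]
    simp only [hV]
    rw [Finset.mem_Icc, ← abs_le] at hi
    rcases hi.eq_or_lt with h2 | h2
    · rw [if_neg h2.not_lt, if_pos h2, mul_zero, zero_pow two_ne_zero, zero_add, mul_pow, mul_comm,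
        ← sq_abs (ext (U t) i)]
      have := pow_le_pow_left₀ (hw0 i) (hwj i) 2
      have := hbd t ht i h2
      gcongr
    · rw [if_pos h2, if_neg h2.ne, add_zero]
  have h2 := Finset.sum_le_sum h1
  rw [Finset.sum_add_distrib] at h2
  have h3 := sum_ite_abs_le (h := h) (Finset.Icc (-(N : ℤ)) N) (N : ℤ) (b ^ 2)
  have h4 := mul_le_mul_of_nonneg_left (h2.trans (add_le_add_right h3 _)) hh.le
  rw [mul_add] at h4
  linarith

/-! ### Passage to the limit of large domains at a fixed mesh size -/

/-- For fixed mesh size the solutions form a Cauchy sequence at every node, uniformly in time. -/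
theorem node_cauchy {L : ℝ} (hT : 0 < T) (hb : DataBound L T μ σ f g) {h : ℝ} (hh : 0 < h) (i₀ : ℤ) {ε : ℝ}
    (hε : 0 < ε) : ∀ᶠ N : ℕ in atTop, ∀ N' ≥ N, ∀ U U',
      IsODESolution T μ σ f g (uniformGrid h) N U →
      IsODESolution T μ σ f g (uniformGrid h) N' U' →
      ∀ t ∈ Icc 0 T, |ext (U t) i₀ - ext (U' t) i₀| ≤ ε := by
  obtain ⟨C₀, hC₀, hap⟩ := weighted_apriori hb 0 hh
  obtain ⟨C, hC, hst⟩ := weighted_stability hb 3 h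
  have hwt : Tendsto (fun N : ℕ => wt h (N : ℤ)) atTop (𝓝 0) := by
    simpa using tendsto_wt hh 0
  set w := wt h i₀ ^ 4 with hw
  have hw0 : 0 < w := pow_pos (wt_pos _ _) _
  have ev1 : ∀ᶠ N : ℕ in atTop, wt h (N : ℤ) ^ 4 ≤ w / 2 := by
    have := hwt.pow 4
    rw [zero_pow (by norm_num)] at this
    exact (this.eventually (gt_mem_nhds (half_pos hw0))).mono fun _ h => h.le
  have ev2 : ∀ᶠ N : ℕ in atTop, C * (wt h (N : ℤ) ^ 2 * (4 * C₀)) ≤ h * (w / 2 * ε) ^ 2 := by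
    have : Tendsto (fun N : ℕ => C * (wt h (N : ℤ) ^ 2 * (4 * C₀))) atTop
      (𝓝 (C * (0 ^ 2 * (4 * C₀)))) := ((hwt.pow 2).mul_const _).const_mul _
    rw [show C * ((0 : ℝ) ^ 2 * (4 * C₀)) = 0 by ring] at this
    exact (this.eventually (gt_mem_nhds (by positivity))).mono fun _ h => h.le
  filter_upwards [ev1, ev2, (eventually_forall_ge_atTop.2 (hap h hh le_rfl)),
    eventually_ge_atTop i₀.natAbs] with N hN1 hN2 hN3 hN4 N' hN' U U' hU hU' t ht
  have hNN : (N : ℤ) ≤ N' := by exact_mod_cast hN'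
  -- Truncation at the weight of the end node of the smaller grid: the cutoff vanishes for `|i| ≥
  -- N`, so only interior equations of both solutions are compared and the residual is zero. The
  -- discrepancy at the ends enters only through `a² * 4 C₀`, which tends to zero.
  set a := wt h (N : ℤ) with ha
  set V : ℝ → ℤ → ℝ := fun s i => if |i| ≤ (N : ℤ) then ext (U s) i - ext (U' s) i else 0 with hV
  -- The sum extends to `N + 1` because `V` need not vanish at `|i| = N`.
  have hmain := hst h hh le_rfl a (wt_pos _ _).le (N + 1) V
    (fun s i => derivWithin (fun s => V s i) (Icc 0 T) s) (fun _ _ => 0)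
    (a ^ 2 * (4 * C₀))
    (fun s _ i hi => if_neg (by push_cast at hi; omega))
    (fun s hs i => by
      refine DifferentiableWithinAt.hasDerivWithinAt ?_
      simp only [hV]
      split_ifs with hi
      · exact (hU.differentiableWithinAt i hs).sub (hU'.differentiableWithinAt i hs)
      · exact differentiableWithinAt_const _)
    (fun s hs i hi => by
      have hi1 := lt_wt_of_cut_ne_zero (left_ne_zero_of_mul hi)
      have hi' : |i| < (N : ℤ) := by
        by_contra hn
        have hle : |(N : ℤ)| ≤ |i| := by rw [Nat.abs_cast]; exact not_lt.1 hn
        exact absurd (wt_anti (h := h) hle) (not_le.2 hi1)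
      have hVn : ∀ m : ℤ, |m| ≤ N → V s m = ext (U s) m - ext (U' s) m := fun m hm => if_pos hm
      have hlt := abs_lt.1 hi'
      have v0 := hVn i hi'.le
      have v1 := hVn (i + 1) (abs_le.2 (by omega))
      have v2 := hVn (i - 1) (abs_le.2 (by omega))
      have e1 : cdiff h (V s) i = cdiff h (ext (U s)) i - cdiff h (ext (U' s)) i := by
        simp only [cdiff_eq, v1, v2]; ring
      have e2 : cdiff₂ h (V s) i = cdiff₂ h (ext (U s)) i - cdiff₂ h (ext (U' s)) i := by
        simp only [cdiff₂_eq, v0, v1, v2]; ring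
      have hd : (fun s => V s i) = fun s => ext (U s) i - ext (U' s) i := by
        funext s; exact if_pos hi'.le
      have hdd := (hU.interior hh hi' hs).sub (hU'.interior hh (hi'.trans_le hNN) hs)
      have hdd' := hdd.derivWithin (uniqueDiffOn_Icc hT s hs)
      have hd' : derivWithin (fun s => V s i) (Icc 0 T) s = derivWithin
          ((fun s => ext (U s) i) - fun s => ext (U' s) i) (Icc 0 T) s := by rw [hd]; rfl
      rw [hd', hdd', e1, e2, v0, add_zero]
      have hf := hb.driver_lipschitz s hs (uniformGrid h i) (ext (U s) i) (ext (U' s) i)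
        (σ (uniformGrid h i) * cdiff h (ext (U s)) i)
        (σ (uniformGrid h i) * cdiff h (ext (U' s)) i)
      rw [← mul_sub, abs_mul (σ _)] at hf
      refine le_trans (le_of_eq ?_) hf
      rw [← abs_neg]
      congr 1
      ring)
    (fun s hs => by
      have h1 : ∑ i ∈ Finset.Icc (-((N + 1 : ℕ) : ℤ)) (N + 1 : ℕ), (wt h i ^ 3 * V s i) ^ 2
          = ∑ i ∈ Finset.Icc (-(N : ℤ)) N, (wt h i ^ 3 * V s i) ^ 2 := by
        refine (Finset.sum_subset (Finset.Icc_subset_Icc (by push_cast; omega)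
          (by push_cast; omega)) fun i _ hi => ?_).symm
        rw [Finset.mem_Icc, ← abs_le] at hi
        simp only [hV, if_neg hi, mul_zero, zero_pow two_ne_zero]
      have h2 : ∑ i ∈ Finset.Icc (-(N : ℤ)) N, (wt h i ^ 3 * V s i) ^ 2
          ≤ 2 * ∑ i ∈ Finset.Icc (-(N : ℤ)) N, (wt h i ^ 3 * ext (U s) i) ^ 2
            + 2 * ∑ i ∈ Finset.Icc (-(N' : ℤ)) N', (wt h i ^ 3 * ext (U' s) i) ^ 2 := by
        have h3 : ∑ i ∈ Finset.Icc (-(N : ℤ)) N, (wt h i ^ 3 * ext (U' s) i) ^ 2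
            ≤ ∑ i ∈ Finset.Icc (-(N' : ℤ)) N', (wt h i ^ 3 * ext (U' s) i) ^ 2 :=
          Finset.sum_le_sum_of_subset_of_nonneg
            (Finset.Icc_subset_Icc (by omega) (by omega)) fun _ _ _ => sq_nonneg _
        refine le_trans ?_ (add_le_add_right (mul_le_mul_of_nonneg_left h3 zero_le_two) _)
        rw [Finset.mul_sum, Finset.mul_sum, ← Finset.sum_add_distrib]
        refine Finset.sum_le_sum fun i hi => ?_
        rw [Finset.mem_Icc, ← abs_le] at hi
        simp only [hV, if_pos hi]
        nlinarith [sq_nonneg (wt h i ^ 3 * ext (U s) i + wt h i ^ 3 * ext (U' s) i)]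
      have h3 := hN3 N le_rfl U hU s hs
      have h4 := hN3 N' hN' U' hU' s hs
      have h5 := mul_le_mul_of_nonneg_left h2 hh.le
      simp only [zero_add] at h3 h4
      rw [h1]
      simp only [mul_zero, zero_pow two_ne_zero, Finset.sum_const_zero, add_zero]
      have h6 : h * ∑ i ∈ Finset.Icc (-(N : ℤ)) N, (wt h i ^ 3 * V s i) ^ 2 ≤ 4 * C₀ := by
        linarith
      gcongr)
    (by
      have : ∀ i, V T i = 0 := fun i => by
        simp only [hV]
        split_ifs with hi
        · rw [hU.terminal hi, hU'.terminal (hi.trans hNN), sub_self]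
        · rfl
      simp only [this, mul_zero, zero_pow two_ne_zero, Finset.sum_const_zero]
      positivity) t ht
  have hi₀ : |i₀| ≤ (N : ℤ) := by rw [Int.abs_eq_natAbs]; omega
  have h1 : (cut 4 a h i₀ * V t i₀) ^ 2 ≤
      ∑ i ∈ Finset.Icc (-((N + 1 : ℕ) : ℤ)) (N + 1 : ℕ), (cut 4 a h i * V t i) ^ 2 :=
    Finset.single_le_sum (f := fun i => (cut 4 a h i * V t i) ^ 2) (fun _ _ => sq_nonneg _)
      (by rw [Finset.mem_Icc, ← abs_le]; push_cast; omega)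
  have h2 : w / 2 ≤ cut 4 a h i₀ := le_trans (by linarith) (le_max_left _ _)
  -- A single summand is bounded by the whole energy. The mesh is fixed, so dividing by `h` is
  -- harmless.
  have h3 : h * (cut 4 a h i₀ * V t i₀) ^ 2 ≤ h * (w / 2 * ε) ^ 2 :=
    (mul_le_mul_of_nonneg_left h1 hh.le).trans (hmain.trans hN2)
  have h4 := le_of_mul_le_mul_left h3 hh
  have h5 := abs_le_of_sq_le_sq h4 (by positivity)
  have hVt : V t i₀ = ext (U t) i₀ - ext (U' t) i₀ := if_pos hi₀
  rw [abs_mul, abs_of_nonneg (cut_nonneg _ _ _ _), hVt] at h5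
  by_contra! hlt
  have : w / 2 * ε < cut 4 a h i₀ * |ext (U t) i₀ - ext (U' t) i₀| :=
    mul_lt_mul' h2 hlt hε.le (lt_of_lt_of_le (by positivity) h2)
  linarith

/-! ### The local estimate for the difference quotients -/

theorem abs_le_sum_of_vanish (G : ℤ → ℝ) (M : ℕ) (hG : G (-M) = 0) {i : ℤ} (hi : |i| ≤ M) :
    |G i| ≤ ∑ m ∈ Finset.Icc (-(M : ℤ)) M, |G (m + 1) - G m| := by
  obtain ⟨n, hn⟩ := Int.eq_ofNat_of_zero_le (show 0 ≤ i + M by linarith [(abs_le.1 hi).1])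
  have hi' := (abs_le.1 hi).2
  have h1 := sum_Ico_telescope G (-M) n
  have e : -(M : ℤ) + n = i := by omega
  rw [e, hG, sub_zero] at h1
  rw [← h1]
  refine (Finset.abs_sum_le_sum_abs _ _).trans
    (Finset.sum_le_sum_of_subset_of_nonneg (fun x hx => ?_) fun _ _ _ => abs_nonneg _)
  rw [Finset.mem_Ico] at hx
  rw [Finset.mem_Icc]
  omega

/-- Coercivity of the second-order term tested with the second difference. -/
theorem absorb_second {m S s p δ ρ ζ γ h d d₀ : ℝ} (hm : 0 < m) (hms : m ≤ s) (hsS : s ≤ S)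
    (hζ : 0 ≤ ζ) (hζ1 : ζ ≤ 1) (hh1 : h ≤ 1) (hγ : |γ| ≤ 2 * ζ + h)
    (hδ : h * |δ| = |d - d₀|) (hp : |p + 1 / 2 * s * δ| ≤ ρ) :
    -((4 * S + 3 + 2 / m) * (ρ ^ 2 + d ^ 2 + d₀ ^ 2)) ≤ -2 * p * (ζ ^ 2 * δ + γ * d₀) := by
  have hs : 0 < s := hm.trans_le hms
  set q := p + 1 / 2 * s * δ with hq
  have hρ : 0 ≤ ρ := (abs_nonneg _).trans hp
  -- Substituting `p = q - s δ / 2` exhibits the good term `s (ζ δ)²`; one half of it is spent in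
  -- `h1`, the other in `h2`.
  have hexp : -2 * p * (ζ ^ 2 * δ + γ * d₀)
      = s * (ζ * δ) ^ 2 + s * δ * γ * d₀ - 2 * q * ζ ^ 2 * δ - 2 * q * γ * d₀ := by
    rw [hq]; ring
  have h1 : |s * δ * γ * d₀| ≤ 1 / 2 * s * (ζ * δ) ^ 2 + 4 * S * (d ^ 2 + d₀ ^ 2) := by
    have e1 : |s * δ * γ * d₀| = s * (|δ| * |γ| * |d₀|) := by
      simp only [abs_mul, abs_of_pos hs]; ring
    have e2 : |δ| * |γ| * |d₀| ≤ |δ| * (2 * ζ + h) * |d₀| := by gcongr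
    -- The part of the cutoff derivative not controlled by `ζ` carries a factor `h`, and `h |δ|` is
    -- only a first-order quantity.
    have e3 : |δ| * (2 * ζ + h) * |d₀| = 2 * (ζ * |δ|) * |d₀| + |d - d₀| * |d₀| := by
      rw [← hδ]; ring
    have e4 : 2 * (ζ * |δ|) * |d₀| ≤ 1 / 2 * (ζ * δ) ^ 2 + 2 * d₀ ^ 2 := by
      rw [mul_pow, ← sq_abs δ, ← sq_abs d₀]
      nlinarith [sq_nonneg (ζ * |δ| - 2 * |d₀|)]
    have e5 : |d - d₀| * |d₀| ≤ d ^ 2 + 3 / 2 * d₀ ^ 2 := by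
      have := abs_mul_le_add_sq (d - d₀) d₀
      nlinarith [sq_nonneg (d + d₀)]
    have e6 : s * (2 * d₀ ^ 2 + (d ^ 2 + 3 / 2 * d₀ ^ 2)) ≤ S * (4 * (d ^ 2 + d₀ ^ 2)) := by
      gcongr <;> nlinarith [sq_nonneg d, sq_nonneg d₀]
    have e7 : s * (|δ| * |γ| * |d₀|)
        ≤ s * (1 / 2 * (ζ * δ) ^ 2 + 2 * d₀ ^ 2 + (d ^ 2 + 3 / 2 * d₀ ^ 2)) := by
      gcongr; linarith
    rw [e1]; linarith
  have h2 : |2 * q * ζ ^ 2 * δ| ≤ 1 / 2 * s * (ζ * δ) ^ 2 + 2 / m * ρ ^ 2 := by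
    have e1 : |2 * q * ζ ^ 2 * δ| = 2 * |q| * ζ * (ζ * |δ|) := by
      simp only [abs_mul, abs_two, abs_of_nonneg (sq_nonneg ζ)]; ring
    have e2 : 2 * |q| * ζ * (ζ * |δ|) ≤ 2 * ρ * 1 * (ζ * |δ|) := by gcongr
    have e3 : 2 * ρ * 1 * (ζ * |δ|) ≤ 1 / 2 * s * (ζ * δ) ^ 2 + 2 / s * ρ ^ 2 := by
      have e4 : (ζ * δ) ^ 2 = (ζ * |δ|) ^ 2 := by rw [mul_pow, mul_pow, sq_abs]
      have e5 : 1 / 2 * s * (ζ * |δ|) ^ 2 + 2 / s * ρ ^ 2 - 2 * ρ * 1 * (ζ * |δ|)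
          = (s * (ζ * |δ|) - 2 * ρ) ^ 2 / (2 * s) := by field_simp; ring
      have e6 : 0 ≤ (s * (ζ * |δ|) - 2 * ρ) ^ 2 / (2 * s) := by positivity
      rw [e4]; linarith
    have e4 : 2 / s * ρ ^ 2 ≤ 2 / m * ρ ^ 2 := by gcongr
    rw [e1]; linarith
  have h3 : |2 * q * γ * d₀| ≤ 3 * ρ ^ 2 + 3 * d₀ ^ 2 := by
    have e1 : |2 * q * γ * d₀| = 2 * |q| * |γ| * |d₀| := by
      simp only [abs_mul, abs_two]
    have e2 : 2 * |q| * |γ| * |d₀| ≤ 2 * ρ * 3 * |d₀| := by gcongr; linarith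
    have e3 : 2 * ρ * 3 * |d₀| ≤ 3 * ρ ^ 2 + 3 * d₀ ^ 2 := by
      rw [← sq_abs d₀]; nlinarith [sq_nonneg (ρ - |d₀|)]
    rw [e1]; linarith
  have k1 := neg_le_of_abs_le h1
  have k2 := (abs_le.1 h2).2
  have k3 := (abs_le.1 h3).2
  have hm2 : 0 < 2 / m := by positivity
  have k4 : 0 ≤ S := hs.le.trans hsS
  have k5 : 0 ≤ 4 * S * ρ ^ 2 := by positivity
  have k6 : 0 ≤ 2 / m * (d ^ 2 + d₀ ^ 2) := by positivity
  rw [hexp]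
  nlinarith [sq_nonneg d]

/-- Local energy inequality for the difference quotients. -/
theorem gradient_energy {h m S : ℝ} (hh : 0 < h) (hh1 : h ≤ 1) (hm : 0 < m) (M : ℕ)
    (s ζ V P ρ : ℤ → ℝ) (hζ0 : ∀ i, 0 ≤ ζ i) (hζ1 : ∀ i, ζ i ≤ 1)
    (hζΔ : ∀ i, |ζ (i + 1) - ζ i| ≤ h) (hζM : ∀ i : ℤ, (M : ℤ) ≤ |i| → ζ i = 0)
    (hs : ∀ i, ζ i ≠ 0 ∨ ζ (i - 1) ≠ 0 → m ≤ s i ∧ s i ≤ S)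
    (hP : ∀ i, ζ i ≠ 0 ∨ ζ (i - 1) ≠ 0 → |P i + 1 / 2 * s i * cdiff₂ h V i| ≤ ρ i)
    (B : ℤ → ℝ) (hB0 : ∀ i, 0 ≤ B i)
    (hB : ∀ i, ζ i ≠ 0 ∨ ζ (i - 1) ≠ 0 →
      (4 * S + 3 + 2 / m) * (ρ i ^ 2 + fdiff h V i ^ 2 + fdiff h V (i - 1) ^ 2) ≤ B i) :
    -∑ i ∈ Finset.Icc (-(M : ℤ)) M, B i
      ≤ ∑ i ∈ Finset.Icc (-(M : ℤ)) M, 2 * ζ i ^ 2 * fdiff h V i * fdiff h P i := by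
  set d := fdiff h V with hd
  -- Flux that moves the difference from `P` onto `ζ² d`; it vanishes at both ends with the cutoff.
  set G : ℤ → ℝ := fun i => 2 * ζ (i - 1) ^ 2 * d (i - 1) * P i / h with hG
  have hG1 : G (M + 1) = 0 := by
    have : ζ (M : ℤ) = 0 := hζM _ (le_abs_self _)
    simp [hG, this]
  have hG2 : G (-M) = 0 := by
    have : ζ (-M - 1) = 0 := hζM _ (by rw [abs_of_nonpos] <;> omega)
    simp [hG, this]
  have htel := sum_Icc_telescope G M
  rw [hG1, hG2, sub_zero] at htel
  rw [← add_zero (-Finset.sum _ _), ← htel, ← Finset.sum_neg_distrib, ← Finset.sum_add_distrib]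
  refine Finset.sum_le_sum fun i _ => ?_
  have hterm : 2 * ζ i ^ 2 * d i * fdiff h P i - (G (i + 1) - G i)
      = -2 * P i * (ζ i ^ 2 * cdiff₂ h V i
          + (ζ i - ζ (i - 1)) / h * (ζ i + ζ (i - 1)) * d (i - 1)) := by
    have e1 : fdiff h P i = (P (i + 1) - P i) / h := rfl
    have e2 : cdiff₂ h V i = (d i - d (i - 1)) / h := rfl
    rw [e1, e2]
    simp only [hG, add_sub_cancel_right]; ring
  by_cases hi : ζ i ≠ 0 ∨ ζ (i - 1) ≠ 0
  · have hz := hζΔ (i - 1)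
    rw [sub_add_cancel] at hz
    have hγ : |(ζ i - ζ (i - 1)) / h * (ζ i + ζ (i - 1))| ≤ 2 * ζ i + h := by
      rw [abs_mul, abs_div, abs_of_pos hh, abs_of_nonneg (add_nonneg (hζ0 _) (hζ0 _))]
      have h1 : |ζ i - ζ (i - 1)| / h ≤ 1 := (div_le_one hh).2 hz
      have h2 : ζ i + ζ (i - 1) ≤ 2 * ζ i + h := by linarith [(abs_le.1 hz).1]
      calc _ ≤ 1 * (2 * ζ i + h) := by
            gcongr
            exact add_nonneg (hζ0 _) (hζ0 _)
        _ = _ := one_mul _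
    have hδ : h * |cdiff₂ h V i| = |d i - d (i - 1)| := by
      simp only [cdiff₂, ← hd, abs_div, abs_of_pos hh]
      field_simp
    have := absorb_second hm (hs i hi).1 (hs i hi).2 (hζ0 i) (hζ1 i) hh1 hγ hδ (hP i hi)
    have := hB i hi
    linarith
  · push Not at hi
    have : -2 * P i * (ζ i ^ 2 * cdiff₂ h V i
          + (ζ i - ζ (i - 1)) / h * (ζ i + ζ (i - 1)) * d (i - 1)) = 0 := by
      rw [hi.1, hi.2]; ring
    linarith [hB0 i]

/-- Pointwise control by the weighted norm and a localized gradient norm. -/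
theorem discrete_sobolev {h c : ℝ} (hh : 0 < h) (hc : 0 < c) (M : ℕ) (ζ η V : ℤ → ℝ)
    (hζ0 : ∀ i, 0 ≤ ζ i) (hζ1 : ∀ i, ζ i ≤ 1) (hζΔ : ∀ i, |ζ (i + 1) - ζ i| ≤ h)
    (hVM : ∀ i : ℤ, (M : ℤ) ≤ |i| → V i = 0)
    (hη : ∀ i, ζ i ≠ 0 ∨ ζ (i + 1) ≠ 0 → c ≤ η i ^ 2 ∧ c ≤ η (i + 1) ^ 2) (i : ℤ) (hi : |i| ≤ M) :
    (ζ i * V i) ^ 2 ≤ h * ∑ m ∈ Finset.Icc (-(M : ℤ)) M, (ζ m * fdiff h V m) ^ 2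
      + 3 / c * (h * ∑ m ∈ Finset.Icc (-(M : ℤ)) M, (η m * V m) ^ 2) := by
  set X : ℤ → ℝ := fun m => (η m * V m) ^ 2 with hX
  have hX1 : X (M + 1) = 0 := by
    have : V (M + 1) = 0 := hVM _ (by rw [abs_of_nonneg] <;> omega)
    simp [hX, this]
  have hX2 : X (-M) = 0 := by
    have : V (-M) = 0 := hVM _ (by rw [abs_neg]; exact le_abs_self _)
    simp [hX, this]
  have htel := sum_Icc_telescope X M
  rw [hX1, hX2, sub_zero, Finset.sum_sub_distrib, sub_eq_zero] at htel
  -- Fundamental theorem of calculus for `(ζ V)²`, starting from the left end, where `V` vanishes.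
  have h0 := abs_le_sum_of_vanish (fun m => (ζ m * V m) ^ 2) M (by
    have : V (-M) = 0 := hVM _ (by rw [abs_neg]; exact le_abs_self _)
    simp [this]) hi
  rw [abs_of_nonneg (sq_nonneg _)] at h0
  refine h0.trans ?_
  have key : ∀ m : ℤ, |(ζ (m + 1) * V (m + 1)) ^ 2 - (ζ m * V m) ^ 2|
      ≤ h * (ζ m * fdiff h V m) ^ 2 + h / c * X m + 2 * (h / c) * X (m + 1) := by
    intro m
    by_cases hm : ζ m ≠ 0 ∨ ζ (m + 1) ≠ 0
    · obtain ⟨c1, c2⟩ := hη m hm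
      have v0 : V m ^ 2 ≤ 1 / c * X m := by
        rw [one_div, inv_mul_eq_div, le_div_iff₀ hc]
        simp only [hX, mul_pow]
        nlinarith [sq_nonneg (V m)]
      have v1 : V (m + 1) ^ 2 ≤ 1 / c * X (m + 1) := by
        rw [one_div, inv_mul_eq_div, le_div_iff₀ hc]
        simp only [hX, mul_pow]
        nlinarith [sq_nonneg (V (m + 1))]
      have e1 : (ζ (m + 1) * V (m + 1)) ^ 2 - (ζ m * V m) ^ 2
          = (ζ m * (h * fdiff h V m) + (ζ (m + 1) - ζ m) * V (m + 1))
            * (ζ m * V m + ζ (m + 1) * V (m + 1)) := by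
        have : h * fdiff h V m = V (m + 1) - V m := by simp only [fdiff]; field_simp
        rw [this]; ring
      have e2 : |ζ m * (h * fdiff h V m) + (ζ (m + 1) - ζ m) * V (m + 1)|
          ≤ h * (|ζ m * fdiff h V m| + |V (m + 1)|) := by
        refine (abs_add_le _ _).trans ?_
        rw [mul_add, show ζ m * (h * fdiff h V m) = h * (ζ m * fdiff h V m) by ring, abs_mul h,
          abs_of_pos hh, abs_mul (ζ (m + 1) - ζ m)]
        gcongr
        exact hζΔ m
      have e3 : |ζ m * V m + ζ (m + 1) * V (m + 1)| ≤ |V m| + |V (m + 1)| := by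
        refine (abs_add_le _ _).trans ?_
        rw [abs_mul, abs_mul, abs_of_nonneg (hζ0 _), abs_of_nonneg (hζ0 _)]
        gcongr
        · exact mul_le_of_le_one_left (abs_nonneg _) (hζ1 _)
        · exact mul_le_of_le_one_left (abs_nonneg _) (hζ1 _)
      rw [e1, abs_mul]
      have e4 : (|ζ m * fdiff h V m| + |V (m + 1)|) * (|V m| + |V (m + 1)|)
          ≤ (ζ m * fdiff h V m) ^ 2 + V m ^ 2 + 2 * V (m + 1) ^ 2 := by
        rw [← sq_abs (ζ m * fdiff h V m), ← sq_abs (V m), ← sq_abs (V (m + 1))]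
        nlinarith [sq_nonneg (|ζ m * fdiff h V m| - |V m|), sq_nonneg (|V m| - |V (m + 1)|),
          sq_nonneg (|ζ m * fdiff h V m| - |V (m + 1)|)]
      calc _ ≤ h * (|ζ m * fdiff h V m| + |V (m + 1)|) * (|V m| + |V (m + 1)|) := by gcongr
        _ = h * ((|ζ m * fdiff h V m| + |V (m + 1)|) * (|V m| + |V (m + 1)|)) := by ring
        _ ≤ h * ((ζ m * fdiff h V m) ^ 2 + 1 / c * X m + 2 * (1 / c * X (m + 1))) := by
            gcongr; linarith
        _ = _ := by ring
    · push Not at hm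
      rw [hm.1, hm.2]
      have : 0 ≤ X m := sq_nonneg _
      have : 0 ≤ X (m + 1) := sq_nonneg _
      simp only [zero_mul, sub_self, abs_zero]
      positivity
  refine (Finset.sum_le_sum fun m _ => key m).trans (le_of_eq ?_)
  rw [Finset.sum_add_distrib, Finset.sum_add_distrib, ← Finset.mul_sum, ← Finset.mul_sum,
    ← Finset.mul_sum, htel]
  ring

theorem hasDerivWithinAt_fdiff {s : Set ℝ} {t h : ℝ} {V : ℝ → ℤ → ℝ} {P : ℤ → ℝ}
    (hV : ∀ i, HasDerivWithinAt (fun s => V s i) (P i) s t) (i : ℤ) :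
    HasDerivWithinAt (fun s => fdiff h (V s) i) (fdiff h P i) s t :=
  ((hV (i + 1)).sub (hV i)).div_const h

theorem abs_uniformGrid_le_of_le_wt {b h : ℝ} (hb : 0 < b) {i : ℤ} (hi : b ≤ wt h i) :
    |uniformGrid h i| ≤ 1 / b := by
  have h1 := wt_mul_one_add h i
  have h2 := mul_le_mul_of_nonneg_right hi (by positivity : 0 ≤ 1 + |uniformGrid h i|)
  rw [h1] at h2
  rw [le_div_iff₀ hb]
  linarith

theorem half_le_wt_of_near {b h : ℝ} (hb : 0 < b) (hh : 0 < h) (hh1 : h ≤ 1) {i i' : ℤ}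
    (hi : b ≤ wt h i) (hii : i' = i ∨ i' = i + 1 ∨ i' = i - 1) : b / 2 ≤ wt h i' := by
  have h0 := wt_pos h i'
  have key : wt h i ≤ (1 + h) * wt h i' := by
    rcases hii with rfl | rfl | rfl
    · nlinarith
    · exact wt_le_succ hh i
    · have := wt_succ_le hh (i - 1)
      rwa [sub_add_cancel] at this
  nlinarith

/-- Separation of the truncation levels: it bounds the wide cutoff from below near the support of
the narrow one. With `a ≤ b / 4` at most half of `(b / 2) ^ (j + 1)` is subtracted, since `2 ^ (j +
1) ≥ 2`. -/
theorem cut_lower {a b h : ℝ} (hb : 0 < b) (ha : 0 ≤ a) (hab : a ≤ b / 4) (j : ℕ) {i : ℤ}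
    (hi : b / 2 ≤ wt h i) : (b / 4) ^ (j + 1) ≤ cut (j + 1) a h i := by
  refine le_trans ?_ (le_max_left _ _)
  have h1 : (b / 2) ^ (j + 1) ≤ wt h i ^ (j + 1) := by gcongr
  have h2 : a ^ (j + 1) ≤ (b / 4) ^ (j + 1) := by gcongr
  have h3 : (b / 2) ^ (j + 1) = 2 ^ (j + 1) * (b / 4) ^ (j + 1) := by rw [← mul_pow]; ring
  have h4 : (2 : ℝ) ≤ 2 ^ (j + 1) := le_self_pow₀ one_le_two (by omega)
  have h5 : 0 ≤ (b / 4) ^ (j + 1) := by positivity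
  nlinarith

/-- Local bound of the lower order part of the equation by the energy densities. -/
theorem lower_order_sq_le {L A c m sg mu ρ D d d₀ v r η : ℝ} (hL : 0 ≤ L) (hc : 0 < c)
    (hm : 0 < m) (hA : |mu| + L * |sg| ≤ A) (hcη : c ≤ η ^ 2) (hms : m ≤ sg ^ 2)
    (hρ : ρ = |mu * ((d + d₀) / 2)| + (L * (|v| + |sg| * |(d + d₀) / 2|) + r)) (hD : 0 ≤ D) :
    D * (ρ ^ 2 + d ^ 2 + d₀ ^ 2)
      ≤ D * (4 * (3 * A ^ 2 + 1) / (c * m) + 3 * (L ^ 2 + 1) / c)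
        * (1 / 4 * (η * sg) ^ 2 * (d ^ 2 + d₀ ^ 2) + (η * v) ^ 2 + (η * r) ^ 2) := by
  have hA0 : 0 ≤ A := le_trans (by positivity) hA
  have e0 : ρ = (|mu| + L * |sg|) * |(d + d₀) / 2| + L * |v| + r := by
    rw [hρ, abs_mul]; ring
  have e1 : ρ ^ 2 ≤ 3 * (((|mu| + L * |sg|) * |(d + d₀) / 2|) ^ 2 + (L * |v|) ^ 2 + r ^ 2) := by
    rw [e0]
    generalize (|mu| + L * |sg|) * |(d + d₀) / 2| = x
    generalize L * |v| = y
    nlinarith [sq_nonneg (x - y), sq_nonneg (x - r), sq_nonneg (y - r)]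
  have e2 : ((|mu| + L * |sg|) * |(d + d₀) / 2|) ^ 2 ≤ A ^ 2 * (d ^ 2 + d₀ ^ 2) := by
    rw [mul_pow, sq_abs]
    have k1 : (|mu| + L * |sg|) ^ 2 ≤ A ^ 2 := by gcongr
    have k2 : ((d + d₀) / 2) ^ 2 ≤ d ^ 2 + d₀ ^ 2 := by
      nlinarith [sq_nonneg (d - d₀), sq_nonneg d, sq_nonneg d₀]
    exact mul_le_mul k1 k2 (sq_nonneg _) (sq_nonneg _)
  have e3 : (L * |v|) ^ 2 = L ^ 2 * v ^ 2 := by rw [mul_pow, sq_abs]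
  set q := d ^ 2 + d₀ ^ 2 with hq
  have hq0 : 0 ≤ q := by positivity
  have f1 : q ≤ 4 / (c * m) * (1 / 4 * (η * sg) ^ 2 * q) := by
    have : c * m ≤ (η * sg) ^ 2 := by rw [mul_pow]; gcongr
    have h1 : 4 / (c * m) * (1 / 4 * (η * sg) ^ 2 * q) = (η * sg) ^ 2 / (c * m) * q := by
      field_simp
    rw [h1]
    exact le_mul_of_one_le_left hq0 ((one_le_div (by positivity)).2 this)
  have f2 : ∀ x : ℝ, x ^ 2 ≤ 1 / c * (η * x) ^ 2 := fun x => by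
    rw [mul_pow, ← mul_assoc, one_div, inv_mul_eq_div]
    exact le_mul_of_one_le_left (sq_nonneg _) ((one_le_div hc).2 hcη)
  have f3 := f2 v
  have f4 := f2 r
  set X := 1 / 4 * (η * sg) ^ 2 * q with hX
  have hX0 : 0 ≤ X := by positivity
  have g1 : ρ ^ 2 + d ^ 2 + d₀ ^ 2 ≤ (3 * A ^ 2 + 1) * q + 3 * L ^ 2 * v ^ 2 + 3 * r ^ 2 := by
    rw [add_assoc]
    linarith
  have g2 : (3 * A ^ 2 + 1) * q ≤ 4 * (3 * A ^ 2 + 1) / (c * m) * X := by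
    have := mul_le_mul_of_nonneg_left f1 (by positivity : 0 ≤ 3 * A ^ 2 + 1)
    refine this.trans (le_of_eq (by ring))
  have g3 : 3 * L ^ 2 * v ^ 2 ≤ 3 * (L ^ 2 + 1) / c * (η * v) ^ 2 := by
    have := mul_le_mul_of_nonneg_left f3 (by positivity : 0 ≤ 3 * L ^ 2)
    refine this.trans ?_
    have : 0 ≤ 3 * (1 / c) * (η * v) ^ 2 := by positivity
    have e : 3 * (L ^ 2 + 1) / c * (η * v) ^ 2
        = 3 * L ^ 2 * (1 / c * (η * v) ^ 2) + 3 * (1 / c) * (η * v) ^ 2 := by ring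
    rw [e]; linarith
  have g4 : 3 * r ^ 2 ≤ 3 * (L ^ 2 + 1) / c * (η * r) ^ 2 := by
    have : 0 ≤ 3 * L ^ 2 * (1 / c) * (η * r) ^ 2 := by positivity
    have e : 3 * (L ^ 2 + 1) / c * (η * r) ^ 2
        = 3 * L ^ 2 * (1 / c) * (η * r) ^ 2 + 3 * (1 / c * (η * r) ^ 2) := by ring
    rw [e]; linarith
  have g5 : 0 ≤ 4 * (3 * A ^ 2 + 1) / (c * m) * ((η * v) ^ 2 + (η * r) ^ 2) := by positivity
  have g6 : 0 ≤ 3 * (L ^ 2 + 1) / c * X := by positivity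
  rw [mul_assoc]
  gcongr
  have e : (4 * (3 * A ^ 2 + 1) / (c * m) + 3 * (L ^ 2 + 1) / c) * (X + (η * v) ^ 2 + (η * r) ^ 2)
      = 4 * (3 * A ^ 2 + 1) / (c * m) * X + 3 * (L ^ 2 + 1) / c * (η * v) ^ 2
        + 3 * (L ^ 2 + 1) / c * (η * r) ^ 2 + 3 * (L ^ 2 + 1) / c * X
        + 4 * (3 * A ^ 2 + 1) / (c * m) * ((η * v) ^ 2 + (η * r) ^ 2) := by ring
  rw [e]
  linarith

set_option maxHeartbeats 1000000 in
/-- Local uniform stability of the semidiscrete equation. -/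
theorem local_stability {L : ℝ} (hb : DataBound L T μ σ f g) (hσc : Continuous σ)
    (hσ : ∀ x, 0 < σ x ^ 2) (j : ℕ) {b : ℝ} (hb0 : 0 < b) :
    ∃ C : ℝ, 0 < C ∧ ∀ (h : ℝ) (_ : 0 < h) (_ : h ≤ 1) (a : ℝ) (_ : 0 ≤ a) (_ : a ≤ b / 4) (M : ℕ)
      (V P : ℝ → ℤ → ℝ) (r : ℝ → ℤ → ℝ) (R : ℝ)
      (_ : ∀ t ∈ Icc 0 T, ∀ i : ℤ, (M : ℤ) ≤ |i| → V t i = 0)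
      (_ : ∀ i : ℤ, a < wt h i → |i| < M)
      (_ : ∀ t ∈ Icc 0 T, ∀ i, HasDerivWithinAt (fun s => V s i) (P t i) (Icc 0 T) t)
      (_ : ∀ t ∈ Icc 0 T, ∀ i, a < wt h i →
        |P t i + (μ (uniformGrid h i) * cdiff h (V t) i
            + 1 / 2 * σ (uniformGrid h i) ^ 2 * cdiff₂ h (V t) i)|
          ≤ L * (|V t i| + |σ (uniformGrid h i)| * |cdiff h (V t) i|) + r t i)
      (_ : ∀ t ∈ Icc 0 T, a ^ 2 * (h * ∑ i ∈ Finset.Icc (-(M : ℤ)) M, (wt h i ^ j * V t i) ^ 2)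
        + h * ∑ i ∈ Finset.Icc (-(M : ℤ)) M, (cut (j + 1) a h i * r t i) ^ 2 ≤ R)
      (_ : ∀ i, V T i = 0),
      ∀ t ∈ Icc 0 T, ∀ i, 2 * b ≤ wt h i → V t i ^ 2 ≤ C * R := by
  obtain ⟨K, hK, hen⟩ := energy_cut hb.one_le j 1
  have hL := hb.one_le
  have hL0 : 0 ≤ L := by linarith
  have h0mem : (Icc (-(2 / b)) (2 / b)).Nonempty :=
    ⟨0, neg_nonpos.2 (by positivity), by positivity⟩
  -- bounds of the diffusion coefficient on the relevant compact set
  obtain ⟨x₁, hx₁, hmin⟩ := (isCompact_Icc (a := -(2 / b)) (b := 2 / b)).exists_isMinOn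
    h0mem (hσc.pow 2).continuousOn
  obtain ⟨x₂, hx₂, hmax⟩ := (isCompact_Icc (a := -(2 / b)) (b := 2 / b)).exists_isMaxOn
    h0mem (hσc.pow 2).continuousOn
  set m := σ x₁ ^ 2 with hm
  set S := σ x₂ ^ 2 with hS
  have hm0 : 0 < m := hσ x₁
  have hS0 : 0 < S := hσ x₂
  set c := ((b / 4) ^ (j + 1)) ^ 2 with hc
  have hc0 : 0 < c := by positivity
  set A := (1 + L) * (L * (1 + 2 / b)) with hA
  set D := 4 * S + 3 + 2 / m with hD
  have hD0 : 0 < D := by positivity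
  set Q := D * (4 * (3 * A ^ 2 + 1) / (c * m) + 3 * (L ^ 2 + 1) / c) with hQ
  have hQ0 : 0 < Q := by positivity
  -- Weight of the gradient energy. Its error is at most `Q` times the densities of the first
  -- energy, so with `κ * Q = 1` the coercive term absorbs the gradient part exactly.
  set κ := 1 / Q with hκ
  have hκ0 : 0 < κ := by positivity
  have hκQ : κ * Q = 1 := one_div_mul_cancel hQ0.ne'
  -- The exponential factor comes from Grönwall at rate `K + 1`, the sum from `discrete_sobolev`,
  -- and the division by `b ^ 2` from `ζ ≥ b` where `wt ≥ 2 * b`.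
  refine ⟨(1 / κ + 3 / c) / b ^ 2 * (Real.exp ((K + 1) * T) * ((K + 2) / (K + 1))), by positivity, ?_⟩
  intro h hh hh1 a ha hab M V P r R hV hM hP heq hR hVT t ht i₀ hi₀
  -- Two cutoffs: the wide `η` for the `ℓ²` energy, and the narrow `ζ` for the gradient, near whose
  -- support `η` and `σ²` are bounded below.
  set η := cut (j + 1) a h with hη
  set ζ := cut 1 b h with hζ
  have hζ0 : ∀ i, 0 ≤ ζ i := fun i => cut_nonneg _ _ _ _
  have hζ1 : ∀ i, ζ i ≤ 1 := fun i => (cut_le hb0.le _ _ _).trans (by simpa using wt_le_one h i)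
  have hζΔ : ∀ i, |ζ (i + 1) - ζ i| ≤ h := fun i => by
    have h1 : |ζ (i + 1) - ζ i| ≤ |wt h (i + 1) - wt h i| := by
      refine (abs_max_sub_max_le_abs _ _ _).trans ?_
      rw [sub_sub_sub_cancel_right, pow_one, pow_one]
    refine h1.trans ((abs_wt_succ_sub_le hh i).trans ?_)
    refine mul_le_of_le_one_right hh.le ?_
    exact mul_le_one₀ (wt_le_one _ _) (wt_pos _ _).le (wt_le_one _ _)
  have hζw : ∀ i, ζ i ≠ 0 → b ≤ wt h i := fun i hi => (lt_wt_of_cut_ne_zero hi).le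
  have hab' : a < b := by linarith
  have hζM : ∀ i : ℤ, (M : ℤ) ≤ |i| → ζ i = 0 := fun i hi => by
    by_contra hne
    exact absurd (hM i (hab'.trans_le (hζw i hne))) (not_lt.2 hi)
  have hnear : ∀ i, ζ i ≠ 0 ∨ ζ (i - 1) ≠ 0 → b / 2 ≤ wt h i := by
    rintro i (hi | hi)
    · exact half_le_wt_of_near hb0 hh hh1 (hζw i hi) (Or.inl rfl)
    · exact half_le_wt_of_near hb0 hh hh1 (hζw _ hi) (Or.inr (Or.inl (by ring)))
  have hcη : ∀ i, b / 2 ≤ wt h i → c ≤ η i ^ 2 := fun i hi => by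
    have := cut_lower hb0 ha hab j hi
    rw [hc]; gcongr
  have hx : ∀ i, b / 2 ≤ wt h i → |uniformGrid h i| ≤ 2 / b := fun i hi => by
    have := abs_uniformGrid_le_of_le_wt (half_pos hb0) hi
    rwa [one_div_div] at this
  -- the two energies
  set I := Finset.Icc (-(M : ℤ)) M with hI
  set e₀ : ℝ → ℝ := fun s => ∑ i ∈ I, (η i * V s i) ^ 2 with he₀
  set e₁ : ℝ → ℝ := fun s => ∑ i ∈ I, (ζ i * fdiff h (V s) i) ^ 2 with he₁
  set Fn : ℝ → ℝ := fun s => h * (e₀ s + κ * e₁ s) with hFn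
  have he₀0 : ∀ s, 0 ≤ e₀ s := fun s => by positivity
  have he₁0 : ∀ s, 0 ≤ e₁ s := fun s => by positivity
  have hFT : Fn T = 0 := by
    simp [hFn, he₀, he₁, hVT, fdiff]
  have hR0 : 0 ≤ R := le_trans (by positivity) (hR t ht)
  have hG := backward_gronwall (T := T) (R := (K + 2) * R) (C := K + 1) (by linarith) (F := Fn)
    (F' := fun s => h * ((∑ i ∈ I, 2 * η i ^ 2 * V s i * P s i)
      + κ * ∑ i ∈ I, 2 * ζ i ^ 2 * fdiff h (V s) i * fdiff h (P s) i))
    (fun s hs => ((hasDerivWithinAt_sum_sq I η fun i _ => hP s hs i).add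
      ((hasDerivWithinAt_sum_sq I ζ fun i _ =>
        hasDerivWithinAt_fdiff (hP s hs) i).const_mul κ)).const_mul h)
    (fun s hs => ?_) (by rw [hFT]; positivity) t ht
  · rw [hFT, zero_add] at hG
    have hFR : Fn t ≤ Real.exp ((K + 1) * T) * ((K + 2) / (K + 1)) * R := by
      have : 0 ≤ (K + 2) * R / (K + 1) := by positivity
      refine le_trans (by linarith) (hG.trans (le_of_eq (by ring)))
    have hi₀M : |i₀| ≤ (M : ℤ) := (hM i₀ (by linarith)).le
    have hsob := discrete_sobolev hh hc0 M ζ η (V t) hζ0 hζ1 hζΔ (hV t ht) (by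
      rintro i (hi | hi)
      · exact ⟨hcη _ (half_le_wt_of_near hb0 hh hh1 (hζw i hi) (Or.inl rfl)),
          hcη _ (half_le_wt_of_near hb0 hh hh1 (hζw i hi) (Or.inr (Or.inl rfl)))⟩
      · exact ⟨hcη _ (half_le_wt_of_near hb0 hh hh1 (hζw _ hi) (Or.inr (Or.inr (by ring)))),
          hcη _ (half_le_wt_of_near hb0 hh hh1 (hζw _ hi) (Or.inl rfl))⟩) i₀ hi₀M
    have hζb : b ≤ ζ i₀ := by
      refine le_trans ?_ (le_max_left _ _)
      rw [pow_one, pow_one]; linarith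
    have h1 : h * e₁ t ≤ 1 / κ * Fn t := by
      have e : 1 / κ * Fn t = 1 / κ * (h * e₀ t) + h * e₁ t := by
        simp only [hFn]; field_simp
      have : 0 ≤ 1 / κ * (h * e₀ t) := by have := he₀0 t; positivity
      rw [e]; linarith
    have h2 : h * e₀ t ≤ Fn t := by
      have : 0 ≤ h * (κ * e₁ t) := by have := he₁0 t; positivity
      simp only [hFn]; linarith
    have h3 : 3 / c * (h * e₀ t) ≤ 3 / c * Fn t := by gcongr
    have h4 : b ^ 2 * V t i₀ ^ 2 ≤ (ζ i₀ * V t i₀) ^ 2 := by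
      rw [mul_pow]; gcongr
    have h5 : b ^ 2 * V t i₀ ^ 2 ≤ (1 / κ + 3 / c) * Fn t := by
      refine h4.trans (hsob.trans ?_)
      rw [add_mul]; exact add_le_add h1 h3
    have h6 : V t i₀ ^ 2 ≤ (1 / κ + 3 / c) * Fn t / b ^ 2 := by
      rw [le_div_iff₀ (by positivity)]; linarith
    calc V t i₀ ^ 2 ≤ (1 / κ + 3 / c) * Fn t / b ^ 2 := h6
      _ = (1 / κ + 3 / c) / b ^ 2 * Fn t := by ring
      _ ≤ (1 / κ + 3 / c) / b ^ 2 * (Real.exp ((K + 1) * T) * ((K + 2) / (K + 1)) * R) := by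
          gcongr
      _ = _ := by ring
  · have h1 := hen h hh hh1 a ha M (fun i => μ (uniformGrid h i)) (fun i => σ (uniformGrid h i))
      (V s) (P s) (r s) (hV s hs) (hb.diffusion_step hh) (hb.drift_step hh)
      (fun i => hb.diffusion_growth _) (fun i => hb.drift_growth _)
      (fun i hi => heq s hs i (lt_wt_of_cut_ne_zero (left_ne_zero_of_mul hi)))
    rw [Finset.sum_sub_distrib, Finset.sum_sub_distrib, ← Finset.mul_sum, Finset.sum_add_distrib,
      ← Finset.mul_sum] at h1
    set ρ : ℤ → ℝ := fun i => |μ (uniformGrid h i) * cdiff h (V s) i|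
      + (L * (|V s i| + |σ (uniformGrid h i)| * |cdiff h (V s) i|) + r s i) with hρ
    set Bd : ℤ → ℝ := fun i => Q * (1 / 4 * (η i * σ (uniformGrid h i)) ^ 2
      * (fdiff h (V s) i ^ 2 + fdiff h (V s) (i - 1) ^ 2) + (η i * V s i) ^ 2 + (η i * r s i) ^ 2)
      with hBd
    have h2 := gradient_energy hh hh1 hm0 M (fun i => σ (uniformGrid h i) ^ 2) ζ (V s) (P s) ρ
      hζ0 hζ1 hζΔ hζM (S := S)
      (fun i hi => ⟨hmin (abs_le.1 (hx i (hnear i hi))), hmax (abs_le.1 (hx i (hnear i hi)))⟩)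
      (fun i hi => by
        have hw := heq s hs i (lt_of_lt_of_le (by linarith) (hnear i hi))
        have e : P s i + 1 / 2 * σ (uniformGrid h i) ^ 2 * cdiff₂ h (V s) i
          = -(μ (uniformGrid h i) * cdiff h (V s) i)
            + (P s i + (μ (uniformGrid h i) * cdiff h (V s) i
              + 1 / 2 * σ (uniformGrid h i) ^ 2 * cdiff₂ h (V s) i)) := by ring
        rw [e]
        refine (abs_add_le _ _).trans ?_
        rw [abs_neg]
        exact add_le_add le_rfl hw)
      Bd (fun i => by positivity) (fun i hi => by
        have hxi := hx i (hnear i hi)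
        refine lower_order_sq_le (sg := σ (uniformGrid h i)) (mu := μ (uniformGrid h i)) hL0 hc0 hm0
          ?_ (hcη i (hnear i hi)) (hmin (abs_le.1 hxi)) rfl hD0.le
        have k1 : |μ (uniformGrid h i)| ≤ L * (1 + 2 / b) :=
          (hb.drift_growth _).trans (by gcongr)
        have k2 : |σ (uniformGrid h i)| ≤ L * (1 + 2 / b) :=
          (hb.diffusion_growth _).trans (by gcongr)
        rw [hA, add_mul, one_mul]
        exact add_le_add k1 (by gcongr))
    simp only [hBd] at h2
    rw [← Finset.mul_sum, Finset.sum_add_distrib, Finset.sum_add_distrib] at h2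
    set Ds := ∑ i ∈ I, 1 / 4 * (η i * σ (uniformGrid h i)) ^ 2
      * (fdiff h (V s) i ^ 2 + fdiff h (V s) (i - 1) ^ 2) with hDs
    set X := ∑ i ∈ I, (wt h i ^ j * V s i) ^ 2 with hX
    set Y := ∑ i ∈ I, (η i * r s i) ^ 2 with hY
    have h3 := mul_le_mul_of_nonneg_left h2 hκ0.le
    have e3 : κ * -(Q * (Ds + ∑ i ∈ I, (η i * V s i) ^ 2 + Y)) = -(Ds + e₀ s + Y) := by
      rw [mul_neg, ← mul_assoc, hκQ, one_mul]
    rw [e3] at h3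
    have h4 := add_le_add h1 h3
    have h5 := mul_le_mul_of_nonneg_left h4 hh.le
    refine le_trans ?_ h5
    have h6 := hR s hs
    have h7 : 0 ≤ a ^ 2 * (h * X) := by positivity
    have h8 : 0 ≤ h * Y := by positivity
    have h9 : K * (a ^ 2 * (h * X)) ≤ K * R := by gcongr; linarith
    have h10 : 0 ≤ (K + 1) * (h * (κ * e₁ s)) := by have := he₁0 s; positivity
    have e : h * (Ds - K * (∑ i ∈ I, (η i * V s i) ^ 2 + a ^ 2 * X) - Y + -(Ds + e₀ s + Y))
        = -((K + 1) * (h * e₀ s)) - K * (a ^ 2 * (h * X)) - 2 * (h * Y) := by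
      simp only [he₀]; ring
    rw [e]
    simp only [hFn]
    linarith

/-! ### Consistency of the central differences -/

theorem abs_central_first_sub_le {φ : ℝ → ℝ} (hφ : Differentiable ℝ φ) {x h ε : ℝ} (hh : 0 < h)
    (hε : ∀ y, |y - x| ≤ h → |deriv φ y - deriv φ x| ≤ ε) :
    |(φ (x + h) - φ (x - h)) / (2 * h) - deriv φ x| ≤ ε := by
  obtain ⟨ξ, hξ, e⟩ := exists_deriv_eq_slope φ (show x - h < x + h by linarith)
    hφ.continuous.continuousOn hφ.differentiableOn
  rw [show x + h - (x - h) = 2 * h by ring] at e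
  rw [← e]
  exact hε ξ (abs_le.2 ⟨by linarith [hξ.1], by linarith [hξ.2]⟩)

/-- The second difference quotient equals the second derivative at an intermediate point: Cauchy's
mean value theorem for `φ(x+s) + φ(x-s)` against `s²`, then Lagrange's for `deriv φ`. Two
derivatives suffice, so no rate is obtained. -/
theorem abs_central_second_sub_le {φ : ℝ → ℝ} (hφ : ContDiff ℝ 2 φ) {x h ε : ℝ} (hh : 0 < h)
    (hε : ∀ y, |y - x| ≤ h → |iteratedDeriv 2 φ y - iteratedDeriv 2 φ x| ≤ ε) :
    |(φ (x + h) - 2 * φ x + φ (x - h)) / h ^ 2 - iteratedDeriv 2 φ x| ≤ ε := by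
  have hd : Differentiable ℝ φ := hφ.differentiable (by norm_num)
  have hd2 : Differentiable ℝ (deriv φ) := by
    have : ContDiff ℝ 1 (deriv φ) := by
      have := (contDiff_succ_iff_deriv (n := 1) (f := φ)).1 (by norm_num; exact hφ)
      exact this.2.2
    exact this.differentiable (by norm_num)
  have hi2 : iteratedDeriv 2 φ = deriv (deriv φ) := by
    rw [iteratedDeriv_succ, iteratedDeriv_one]
  set ψ : ℝ → ℝ := fun s => φ (x + s) + φ (x - s) with hψ
  have hψd : ∀ s, HasDerivAt ψ (deriv φ (x + s) - deriv φ (x - s)) s := by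
    intro s
    have h1 : HasDerivAt (fun s => φ (x + s)) (deriv φ (x + s)) s := by
      simpa using (hd (x + s)).hasDerivAt.comp_const_add x s
    have h2 : HasDerivAt (fun s => φ (x - s)) (-deriv φ (x - s)) s := by
      simpa using (hd (x - s)).hasDerivAt.comp_const_sub x s
    exact (h1.add h2).congr_deriv (sub_eq_add_neg _ _).symm
  have hsq : ∀ s : ℝ, HasDerivAt (fun s : ℝ => s ^ 2) (2 * s) s := fun s => by
    simpa using hasDerivAt_pow 2 s
  obtain ⟨s, hs, e⟩ := exists_ratio_hasDerivAt_eq_ratio_slope ψ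
    (fun s => deriv φ (x + s) - deriv φ (x - s)) hh
    (fun s _ => (hψd s).continuousAt.continuousWithinAt) (fun s _ => hψd s)
    (fun s => s ^ 2) (fun s => 2 * s) (fun s _ => (hsq s).continuousAt.continuousWithinAt)
    (fun s _ => hsq s)
  obtain ⟨ξ, hξ, e'⟩ := exists_deriv_eq_slope (deriv φ) (show x - s < x + s by linarith [hs.1])
    hd2.continuous.continuousOn hd2.differentiableOn
  have hs0 : 0 < s := hs.1
  rw [show x + s - (x - s) = 2 * s by ring, eq_div_iff (by positivity)] at e'
  have key : (φ (x + h) - 2 * φ x + φ (x - h)) / h ^ 2 = iteratedDeriv 2 φ ξ := by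
    rw [hi2, div_eq_iff (by positivity)]
    simp only [hψ, add_zero, sub_zero] at e
    rw [← e'] at e
    have : 2 * s * (φ (x + h) - 2 * φ x + φ (x - h)) = 2 * s * (deriv (deriv φ) ξ * h ^ 2) := by
      linear_combination (-1 : ℝ) * e
    exact mul_left_cancel₀ (by positivity) this
  rw [key]
  exact hε ξ (abs_le.2 ⟨by linarith [hξ.1, hs.2], by linarith [hξ.2, hs.2]⟩)

/-- The central differences of a `C^{1,2}` function are consistent, uniformly on compact sets. -/
theorem IsC12.consistency {u : ℝ → ℝ → ℝ} (hu : IsC12 T u) (R : ℝ) {ε : ℝ} (hε : 0 < ε) :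
    ∃ h₀ > 0, ∀ h, 0 < h → h < h₀ → ∀ t ∈ Icc 0 T, ∀ x, |x| ≤ R →
      |(u t (x + h) - u t (x - h)) / (2 * h) - deriv (u t) x| ≤ ε ∧
      |(u t (x + h) - 2 * u t x + u t (x - h)) / h ^ 2 - iteratedDeriv 2 (u t) x| ≤ ε := by
  -- The margin `1` keeps the whole stencil in the compact set, as `h < 1`.
  set Kc : Set (ℝ × ℝ) := Icc 0 T ×ˢ Icc (-(R + 1)) (R + 1) with hKc
  have hK : IsCompact Kc := isCompact_Icc.prod isCompact_Icc
  have hsub : Kc ⊆ Icc 0 T ×ˢ univ := prod_mono le_rfl (subset_univ _)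
  have h1 := Metric.uniformContinuousOn_iff_le.1
    (hK.uniformContinuousOn_of_continuous (hu.continuousOn_dx.mono hsub)) ε hε
  have h2 := Metric.uniformContinuousOn_iff_le.1
    (hK.uniformContinuousOn_of_continuous (hu.continuousOn_dxx.mono hsub)) ε hε
  obtain ⟨δ₁, hδ₁, h1⟩ := h1
  obtain ⟨δ₂, hδ₂, h2⟩ := h2
  refine ⟨min 1 (min δ₁ δ₂), by positivity, fun h hh hlt t ht x hx => ?_⟩
  have l1 : h < 1 := hlt.trans_le (min_le_left _ _)
  have l2 : h ≤ δ₁ := hlt.le.trans ((min_le_right _ _).trans (min_le_left _ _))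
  have l3 : h ≤ δ₂ := hlt.le.trans ((min_le_right _ _).trans (min_le_right _ _))
  have hx' := abs_le.1 hx
  have mx : (t, x) ∈ Kc := ⟨ht, by constructor <;> simp only <;> linarith⟩
  have my : ∀ y, |y - x| ≤ h → (t, y) ∈ Kc := fun y hy => by
    have := abs_le.1 hy
    exact ⟨ht, by constructor <;> simp only <;> linarith⟩
  have hdist : ∀ y, dist ((t, y) : ℝ × ℝ) (t, x) = |y - x| := fun y => by
    rw [Prod.dist_eq, dist_self, Real.dist_eq, max_eq_right (abs_nonneg _)]
  constructor
  · refine abs_central_first_sub_le ((hu.contDiff_space t ht).differentiable (by norm_num)) hh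
      fun y hy => ?_
    have := h1 (t, y) (my y hy) (t, x) mx (by rw [hdist]; linarith)
    rwa [Real.dist_eq] at this
  · refine abs_central_second_sub_le (hu.contDiff_space t ht) hh fun y hy => ?_
    have := h2 (t, y) (my y hy) (t, x) mx (by rw [hdist]; linarith)
    rwa [Real.dist_eq] at this

/-! ### Convergence -/

/-- The error is locally small, uniformly in time, for small mesh and large domain. -/
theorem eventually_error_le {L : ℝ} (hT : 0 < T) (hb : DataBound L T μ σ f g)
    (hσc : Continuous σ) (hσ : ∀ x, 0 < σ x ^ 2) {u : ℝ → ℝ → ℝ}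
    (hu : IsClassicalSolution T μ σ f g u) {b ε : ℝ} (hb0 : 0 < b) (hε : 0 < ε) :
    ∃ h₀ > 0, ∀ h, 0 < h → h < h₀ → ∀ᶠ N : ℕ in atTop, ∀ U,
      IsODESolution T μ σ f g (uniformGrid h) N U → ∀ t ∈ Icc 0 T, ∀ i : ℤ, 2 * b ≤ wt h i →
        |u t (uniformGrid h i) - ext (U t) i| ≤ ε := by
  have hL0 : 0 ≤ L := by linarith [hb.one_le]
  obtain ⟨Cu', p, hgrow'⟩ := hu.growth
  set Cu := |Cu'| with hCu
  have hgrow : ∀ t ∈ Icc 0 T, ∀ x, |u t x| ≤ Cu * (1 + |x| ^ p) := fun t ht x =>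
    (hgrow' t ht x).trans (by gcongr; exact le_abs_self _)
  obtain ⟨C₀, hC₀, hap⟩ := weighted_apriori hb p one_pos
  obtain ⟨C₁, hC₁, hst⟩ := local_stability hb hσc hσ (p + 3) hb0
  -- Bound for the weighted norm of `u - U`: the weighted square of `u` is at most `4 Cu² w²`, `h ∑
  -- w² ≤ 3` for `h ≤ 1`, and squaring a difference costs a factor `2`.
  set C₂ := 2 * (12 * Cu ^ 2) + 2 * C₀ with hC₂
  have hC₂0 : 0 < C₂ := by positivity
  -- choice of the cutoff level and of the admissible residual
  obtain ⟨a, ha0, hab, haε⟩ : ∃ a : ℝ, 0 < a ∧ a ≤ b / 4 ∧ C₁ * (a ^ 2 * C₂) ≤ ε ^ 2 / 2 := by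
    have : Tendsto (fun a : ℝ => C₁ * (a ^ 2 * C₂)) (𝓝[>] 0) (𝓝 (C₁ * (0 ^ 2 * C₂))) :=
      ((by fun_prop : Continuous fun a : ℝ => C₁ * (a ^ 2 * C₂)).tendsto 0).mono_left
        nhdsWithin_le_nhds
    rw [show C₁ * ((0 : ℝ) ^ 2 * C₂) = 0 by ring] at this
    have e1 := this.eventually (gt_mem_nhds (show (0 : ℝ) < ε ^ 2 / 2 by positivity))
    have e2 : ∀ᶠ a : ℝ in 𝓝[>] 0, a ≤ b / 4 :=
      nhdsWithin_le_nhds ((gt_mem_nhds (show (0 : ℝ) < b / 4 by positivity)).mono fun _ h => h.le)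
    obtain ⟨a, h1, h2, h3⟩ := (e1.and (e2.and self_mem_nhdsWithin)).exists
    exact ⟨a, h3, h2, h1.le⟩
  obtain ⟨δ, hδ0, hδε⟩ : ∃ δ : ℝ, 0 < δ ∧ C₁ * (3 * δ ^ 2) ≤ ε ^ 2 / 2 := by
    have : Tendsto (fun a : ℝ => C₁ * (3 * a ^ 2)) (𝓝[>] 0) (𝓝 (C₁ * (3 * 0 ^ 2))) :=
      ((by fun_prop : Continuous fun a : ℝ => C₁ * (3 * a ^ 2)).tendsto 0).mono_left
        nhdsWithin_le_nhds
    rw [show C₁ * (3 * (0 : ℝ) ^ 2) = 0 by ring] at this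
    have e1 := this.eventually (gt_mem_nhds (show (0 : ℝ) < ε ^ 2 / 2 by positivity))
    obtain ⟨a, h1, h3⟩ := (e1.and self_mem_nhdsWithin).exists
    exact ⟨a, h3, h1.le⟩
  -- `A` bounds the coefficients on the support of the cutoff, where `|x| ≤ 1 / a`. `B` collects the
  -- factors with which the consistency errors enter through drift, driver and diffusion, so
  -- tolerance `δ / B` gives residual `δ`. The order of choice is `a` and `δ`, then the mesh, then
  -- `N`.
  set A := L * (1 + 1 / a) with hA
  have hA0 : 0 ≤ A := by positivity
  set B := A + L * A + A ^ 2 + 1 with hB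
  have hB0 : 0 < B := by positivity
  obtain ⟨h₀, hh₀, hcons⟩ := hu.isC12.consistency (1 / a) (div_pos hδ0 hB0)
  refine ⟨min 1 h₀, by positivity, fun h hh hlt => ?_⟩
  have hh1 : h ≤ 1 := hlt.le.trans (min_le_left _ _)
  have hhh : h < h₀ := hlt.trans_le (min_le_right _ _)
  have hwt : Tendsto (fun N : ℕ => wt h (N : ℤ)) atTop (𝓝 0) := by simpa using tendsto_wt hh 0
  filter_upwards [hap h hh hh1, hwt.eventually (gt_mem_nhds ha0)] with N hN1 hN2 U hU t ht i hi
  have hin : ∀ i : ℤ, a < wt h i → |i| < (N : ℤ) := fun i hi => by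
    by_contra hn
    have hle : |(N : ℤ)| ≤ |i| := by rw [Nat.abs_cast]; exact not_lt.1 hn
    linarith [wt_anti (h := h) hle]
  set V : ℝ → ℤ → ℝ := fun s i => if |i| ≤ (N : ℤ) then u s (uniformGrid h i) - ext (U s) i else 0
    with hV
  have hVn : ∀ s, ∀ m : ℤ, |m| ≤ N → V s m = u s (uniformGrid h m) - ext (U s) m :=
    fun s m hm => if_pos hm
  have hmain := hst h hh hh1 a ha0.le hab (N + 1) V
    (fun s i => derivWithin (fun s => V s i) (Icc 0 T) s) (fun _ _ => δ)
    (a ^ 2 * C₂ + 3 * δ ^ 2)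
    (fun s _ i hi => if_neg (by push_cast at hi; omega))
    (fun i hi => by have := hin i hi; push_cast; omega)
    (fun s hs i => by
      refine DifferentiableWithinAt.hasDerivWithinAt ?_
      simp only [hV]
      split_ifs with hi
      · exact (hu.isC12.differentiable_time s hs _).sub (hU.differentiableWithinAt i hs)
      · exact differentiableWithinAt_const _)
    (fun s hs i hi => by
      have hi' := hin i hi
      have hlt := abs_lt.1 hi'
      have v0 := hVn s i hi'.le
      have v1 := hVn s (i + 1) (abs_le.2 (by omega))
      have v2 := hVn s (i - 1) (abs_le.2 (by omega))
      set x := uniformGrid h i with hx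
      have x1 : uniformGrid h (i + 1) = x + h := by
        simp only [hx, uniformGrid]; push_cast; ring
      have x2 : uniformGrid h (i - 1) = x - h := by
        simp only [hx, uniformGrid]; push_cast; ring
      rw [x1] at v1
      rw [x2] at v2
      set W := ext (U s) with hW
      have hxa : |x| ≤ 1 / a := abs_uniformGrid_le_of_le_wt ha0 hi.le
      obtain ⟨k1, k2⟩ := hcons h hh hhh s hs x hxa
      set c1 := (u s (x + h) - u s (x - h)) / (2 * h) with hc1
      set c2 := (u s (x + h) - 2 * u s x + u s (x - h)) / h ^ 2 with hc2
      have e1 : cdiff h (V s) i = c1 - cdiff h W i := by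
        simp only [cdiff_eq, v1, v2, hc1]; ring
      have e2 : cdiff₂ h (V s) i = c2 - cdiff₂ h W i := by
        simp only [cdiff₂_eq, v0, v1, v2, hc2]; ring
      have hdd := ((hu.isC12.differentiable_time s hs x).hasDerivWithinAt).sub
        (hU.interior hh hi' hs)
      have hd' : derivWithin (fun s => V s i) (Icc 0 T) s = derivWithin
          ((fun s => u s x) - fun s => ext (U s) i) (Icc 0 T) s := by
        congr 1; funext s; exact if_pos hi'.le
      rw [hd', hdd.derivWithin (uniqueDiffOn_Icc hT s hs)]
      have heq := hu.equation s hs x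
      set ut := derivWithin (fun s => u s x) (Icc 0 T) s
      set ux := deriv (u s) x
      set uxx := iteratedDeriv 2 (u s) x
      have hf := hb.driver_lipschitz s hs x (u s x) (W i) (σ x * ux) (σ x * cdiff h W i)
      rw [← v0] at hf
      have s1 : |σ x| ≤ A := (hb.diffusion_growth x).trans (by rw [hA]; gcongr)
      have s2 : |μ x| ≤ A := (hb.drift_growth x).trans (by rw [hA]; gcongr)
      have s3 : σ x ^ 2 ≤ A ^ 2 := by rw [← sq_abs]; gcongr
      have hz : |σ x * ux - σ x * cdiff h W i| ≤ |σ x| * |cdiff h (V s) i| + |σ x| * |c1 - ux| := by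
        rw [← mul_sub, abs_mul, ← mul_add, e1]
        gcongr
        have : ux - cdiff h W i = (c1 - cdiff h W i) - (c1 - ux) := by ring
        rw [this]
        exact abs_sub _ _
      rw [← hx, ← hW]
      set fu := f s x (u s x) (σ x * ux)
      set fW := f s x (W i) (σ x * cdiff h W i)
      -- The differential equation for `u` eliminates the time derivative, leaving consistency
      -- errors and a driver increment.
      have hX : ut - -(μ x * cdiff h W i + 1 / 2 * σ x ^ 2 * cdiff₂ h W i + fW)
            + (μ x * cdiff h (V s) i + 1 / 2 * σ x ^ 2 * cdiff₂ h (V s) i)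
          = μ x * (c1 - ux) + 1 / 2 * σ x ^ 2 * (c2 - uxx) + -(fu - fW) := by
        rw [e1, e2]
        linear_combination heq
      rw [hX]
      refine (abs_add_three _ _ _).trans ?_
      rw [abs_neg, abs_mul, abs_mul (1 / 2 * σ x ^ 2), abs_of_nonneg (by positivity : 0 ≤ 1 / 2 * σ x ^ 2)]
      have t1 : |μ x| * |c1 - ux| ≤ A * (δ / B) := by gcongr
      have t2 : 1 / 2 * σ x ^ 2 * |c2 - uxx| ≤ A ^ 2 * (δ / B) := by
        have : 1 / 2 * σ x ^ 2 ≤ A ^ 2 := by linarith [sq_nonneg A]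
        gcongr
      have t3 : L * (|σ x| * |c1 - ux|) ≤ L * (A * (δ / B)) := by gcongr
      have t4 : L * |σ x * ux - σ x * cdiff h W i|
          ≤ L * (|σ x| * |cdiff h (V s) i| + |σ x| * |c1 - ux|) := by gcongr
      have t5 : (A + L * A + A ^ 2) * (δ / B) ≤ δ := by
        have : (A + L * A + A ^ 2) * (δ / B) ≤ B * (δ / B) := by
          have : 0 ≤ δ / B := by positivity
          gcongr
          linarith
        rwa [mul_div_cancel₀ _ hB0.ne'] at this
      linarith)
    (fun s hs => by
      have h1 : ∑ i ∈ Finset.Icc (-((N + 1 : ℕ) : ℤ)) (N + 1 : ℕ), (wt h i ^ (p + 3) * V s i) ^ 2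
          = ∑ i ∈ Finset.Icc (-(N : ℤ)) N, (wt h i ^ (p + 3) * V s i) ^ 2 := by
        refine (Finset.sum_subset (Finset.Icc_subset_Icc (by push_cast; omega)
          (by push_cast; omega)) fun i _ hi => ?_).symm
        rw [Finset.mem_Icc, ← abs_le] at hi
        simp only [hV, if_neg hi, mul_zero, zero_pow two_ne_zero]
      have h2 : ∑ i ∈ Finset.Icc (-(N : ℤ)) N, (wt h i ^ (p + 3) * V s i) ^ 2
          ≤ 8 * Cu ^ 2 * ∑ i ∈ Finset.Icc (-(N : ℤ)) N, wt h i ^ 2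
            + 2 * ∑ i ∈ Finset.Icc (-(N : ℤ)) N, (wt h i ^ (p + 3) * ext (U s) i) ^ 2 := by
        rw [Finset.mul_sum, Finset.mul_sum, ← Finset.sum_add_distrib]
        refine Finset.sum_le_sum fun i hi => ?_
        rw [Finset.mem_Icc, ← abs_le] at hi
        rw [hVn s i hi]
        set x := uniformGrid h i with hx
        have hw := wt_pos h i
        have k1 : wt h i ^ (p + 3) * |u s x| ≤ 2 * Cu * wt h i := by
          have q1 : |x| ^ p ≤ (1 + |x|) ^ p := by gcongr; linarith
          have q2 : 1 ≤ (1 + |x|) ^ p := one_le_pow₀ (by linarith [abs_nonneg x])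
          have q3 : |u s x| ≤ Cu * (2 * (1 + |x|) ^ p) :=
            (hgrow s hs x).trans (by gcongr; linarith)
          calc wt h i ^ (p + 3) * |u s x| ≤ wt h i ^ (p + 3) * (Cu * (2 * (1 + |x|) ^ p)) := by
                gcongr
            _ = 2 * Cu * (wt h i ^ 3 * (wt h i * (1 + |x|)) ^ p) := by rw [mul_pow]; ring
            _ = 2 * Cu * wt h i ^ 3 := by rw [hx, wt_mul_one_add, one_pow, mul_one]
            _ ≤ 2 * Cu * wt h i := by
                gcongr
                exact pow_le_of_le_one hw.le (wt_le_one _ _) (by norm_num)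
        have k2 : (wt h i ^ (p + 3) * u s x) ^ 2 ≤ 4 * Cu ^ 2 * wt h i ^ 2 := by
          have : (wt h i ^ (p + 3) * u s x) ^ 2 = (wt h i ^ (p + 3) * |u s x|) ^ 2 := by
            rw [mul_pow, mul_pow, sq_abs]
          rw [this]
          calc _ ≤ (2 * Cu * wt h i) ^ 2 := by gcongr
            _ = _ := by ring
        rw [mul_sub]
        nlinarith [sq_nonneg (wt h i ^ (p + 3) * u s x + wt h i ^ (p + 3) * ext (U s) i)]
      have h3 := hN1 U hU s hs
      have h4 := sum_wt_sq_le hh N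
      have h5 := mul_le_mul_of_nonneg_left h2 hh.le
      have h6 : h * ∑ i ∈ Finset.Icc (-(N : ℤ)) N, (wt h i ^ (p + 3) * V s i) ^ 2 ≤ C₂ := by
        have q : 8 * Cu ^ 2 * (h * ∑ i ∈ Finset.Icc (-(N : ℤ)) N, wt h i ^ 2)
            ≤ 8 * Cu ^ 2 * 3 := by gcongr; linarith
        linarith
      have h7 : h * ∑ i ∈ Finset.Icc (-((N + 1 : ℕ) : ℤ)) (N + 1 : ℕ),
          (cut (p + 3 + 1) a h i * δ) ^ 2 ≤ 3 * δ ^ 2 := by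
        have q : ∀ i ∈ Finset.Icc (-((N + 1 : ℕ) : ℤ)) (N + 1 : ℕ),
            (cut (p + 3 + 1) a h i * δ) ^ 2 ≤ δ ^ 2 * wt h i ^ 2 := fun i _ => by
          rw [mul_pow, mul_comm]
          have q1 : cut (p + 3 + 1) a h i ≤ wt h i := (cut_le ha0.le _ _ _).trans
            (pow_le_of_le_one (wt_pos _ _).le (wt_le_one _ _) (by omega))
          have := pow_le_pow_left₀ (cut_nonneg _ _ _ _) q1 2
          gcongr
        have q2 := mul_le_mul_of_nonneg_left (Finset.sum_le_sum q) hh.le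
        rw [← Finset.mul_sum, mul_left_comm] at q2
        have q3 := sum_wt_sq_le hh (N + 1)
        have q4 : δ ^ 2 * (h * ∑ i ∈ Finset.Icc (-((N + 1 : ℕ) : ℤ)) (N + 1 : ℕ), wt h i ^ 2)
            ≤ δ ^ 2 * 3 := by gcongr; linarith
        linarith
      rw [h1]
      have h8 : a ^ 2 * (h * ∑ i ∈ Finset.Icc (-(N : ℤ)) N, (wt h i ^ (p + 3) * V s i) ^ 2)
          ≤ a ^ 2 * C₂ := by gcongr
      linarith)
    (fun i => by
      simp only [hV]
      split_ifs with hi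
      · rw [hU.terminal hi, hu.terminal, sub_self]
      · rfl) t ht i hi
  have hiN : |i| < (N : ℤ) := hin i (by linarith)
  rw [hVn t i hiN.le] at hmain
  refine abs_le_of_sq_le_sq (hmain.trans ?_) hε.le
  linarith

/-! ### The iterated limit -/

/-- A sequence of extended nonnegative reals that is Cauchy in the additive sense and eventually
finite has a finite limit. -/
theorem exists_tendsto_of_add_le {e : ℕ → ℝ≥0∞} (hfin : ∀ n, e n ≠ ⊤)
    (he : ∀ ε : ℝ, 0 < ε → ∀ᶠ N in atTop, ∀ N' ≥ N,
      e N' ≤ e N + ENNReal.ofReal ε ∧ e N ≤ e N' + ENNReal.ofReal ε) :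
    ∃ l : ℝ≥0, Tendsto e atTop (𝓝 (l : ℝ≥0∞)) := by
  have hreal : ∀ {x y : ℝ≥0∞} {ε : ℝ}, 0 < ε → x ≠ ⊤ → y ≠ ⊤ → x ≤ y + ENNReal.ofReal ε →
      x.toReal ≤ y.toReal + ε := by
    intro x y ε hε hx hy hxy
    have := ENNReal.toReal_mono (ENNReal.add_ne_top.2 ⟨hy, ENNReal.ofReal_ne_top⟩) hxy
    rwa [ENNReal.toReal_add hy ENNReal.ofReal_ne_top, ENNReal.toReal_ofReal hε.le] at this
  have hc : CauchySeq fun n => (e n).toReal := by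
    refine Metric.cauchySeq_iff'.2 fun ε hε => ?_
    obtain ⟨N, hN⟩ := (he (ε / 2) (half_pos hε)).exists
    refine ⟨N, fun n hn => ?_⟩
    obtain ⟨h1, h2⟩ := hN n hn
    have h3 := hreal (half_pos hε) (hfin n) (hfin N) h1
    have h4 := hreal (half_pos hε) (hfin N) (hfin n) h2
    rw [Real.dist_eq, abs_lt]
    constructor <;> linarith
  obtain ⟨l, hl⟩ := cauchySeq_tendsto_of_complete hc
  refine ⟨l.toNNReal, ?_⟩
  have := ENNReal.tendsto_ofReal hl
  simp only [ENNReal.ofReal_toReal (hfin _)] at this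
  exact this

/-- Triangle inequality at each node. `hK` guarantees that every lattice point in `K` is also a node
of the second grid, so the lemma can be used in both directions. -/
theorem iSup_gridError_le_add {u : ℝ → ℝ → ℝ} {K : Set ℝ} {h ε : ℝ} {N N' : ℕ}
    {U : ℝ → Node N → ℝ} {U' : ℝ → Node N' → ℝ} {S : Set ℝ}
    (hU : ∀ t ∈ S, ∀ i : ℤ, uniformGrid h i ∈ K → |ext (U t) i - ext (U' t) i| ≤ ε)
    (hK : ∀ i : ℤ, uniformGrid h i ∈ K → |i| ≤ N') :
    ⨆ t ∈ S, gridError u K h N U t ≤ (⨆ t ∈ S, gridError u K h N' U' t) + ENNReal.ofReal ε := by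
  refine iSup₂_le fun t ht => iSup₂_le fun i hi => ?_
  have hm : (i : ℤ) ∈ Finset.Icc (-(N' : ℤ)) N' := by
    rw [Finset.mem_Icc, ← abs_le]; exact hK i hi
  have h1 : ENNReal.ofReal |u t (uniformGrid h i) - U' t ⟨i, hm⟩|
      ≤ ⨆ t ∈ S, gridError u K h N' U' t :=
    le_iSup₂_of_le t ht (le_iSup₂_of_le (f := fun (i : Node N') (_ : uniformGrid h i ∈ K) =>
      ENNReal.ofReal |u t (uniformGrid h i) - U' t i|) ⟨i, hm⟩ hi le_rfl)
  have h2 := hU t ht i hi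
  rw [ext_node, show ext (U' t) i = U' t ⟨i, hm⟩ from ext_node (U' t) ⟨i, hm⟩] at h2
  have h3 : |u t (uniformGrid h i) - U t i| ≤ |u t (uniformGrid h i) - U' t ⟨i, hm⟩| + ε := by
    have := abs_sub_le (u t (uniformGrid h i)) (U' t ⟨i, hm⟩) (U t i)
    rw [abs_sub_comm (U' t _)] at this
    linarith
  calc _ ≤ ENNReal.ofReal (|u t (uniformGrid h i) - U' t ⟨i, hm⟩| + ε) :=
        ENNReal.ofReal_le_ofReal h3
    _ ≤ _ := ENNReal.ofReal_add_le
    _ ≤ _ := by gcongr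

/-- There are finitely many nodes, and at each the error is continuous on a compact time interval.
-/
theorem iSup_gridError_ne_top {u : ℝ → ℝ → ℝ} (hu : IsC12 T u) {K : Set ℝ} {h : ℝ} {N : ℕ}
    {U : ℝ → Node N → ℝ} (hU : IsODESolution T μ σ f g (uniformGrid h) N U) {S : Set ℝ}
    (hS : S ⊆ Icc 0 T) : ⨆ t ∈ S, gridError u K h N U t ≠ ⊤ := by
  have hB : ∀ i : Node N, ∃ B : ℝ, ∀ t ∈ Icc 0 T, ‖u t (uniformGrid h i) - U t i‖ ≤ B := fun i =>
    isCompact_Icc.exists_bound_of_continuousOn (f := fun t => u t (uniformGrid h i) - U t i)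
      (ContinuousOn.sub (fun t ht => (hu.differentiable_time t ht _).continuousWithinAt)
        (fun t ht => (hasDerivWithinAt_pi.1 (hU.1 t ht) i).continuousWithinAt))
  choose B hB using hB
  refine ne_top_of_le_ne_top (b := ∑ i : Node N, ENNReal.ofReal (B i)) ?_ ?_
  · exact ENNReal.sum_ne_top.2 fun _ _ => ENNReal.ofReal_ne_top
  · refine iSup₂_le fun t ht => iSup₂_le fun i _ => ?_
    refine (ENNReal.ofReal_le_ofReal (hB i t (hS ht))).trans ?_
    exact Finset.single_le_sum (f := fun i => ENNReal.ofReal (B i)) (fun _ _ => zero_le)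
      (Finset.mem_univ i)

/-- Convergence of the method of lines, uniformly on an arbitrary set of times. -/
theorem iteratedLimitZero_gridError (hT : 0 < T) (hcoef : LipschitzCoefficients μ σ)
    (hdata : WalterAssumption T μ σ f g) (hf : LipschitzDriver T f) {u : ℝ → ℝ → ℝ}
    (hu : IsClassicalSolution T μ σ f g u) {U : (Δx : ℝ) → (N₀ : ℕ) → ℝ → Node N₀ → ℝ}
    (hU : ∀ (Δx : ℝ) (N₀ : ℕ), 0 < Δx →
      IsODESolution T μ σ f g (uniformGrid Δx) N₀ (U Δx N₀))
    {K : Set ℝ} (hK : IsCompact K) {S : Set ℝ} (hS : S ⊆ Icc 0 T) :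
    IteratedLimitZero fun Δx N₀ => ⨆ t ∈ S, gridError u K Δx N₀ (U Δx N₀) t := by
  obtain ⟨L, hb⟩ := exists_dataBound hcoef hdata hf
  obtain ⟨R, hR⟩ := hK.isBounded.exists_norm_le
  have hR' : ∀ x ∈ K, |x| ≤ |R| := fun x hx => (hR x hx).trans (le_abs_self R)
  have hinner : ∀ h : ℝ, 0 < h → ∃ l : ℝ≥0,
      Tendsto (fun N => ⨆ t ∈ S, gridError u K h N (U h N) t) atTop (𝓝 (l : ℝ≥0∞)) := by
    intro h hh
    obtain ⟨n, hn⟩ := exists_nat_ge (|R| / h)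
    have hKn : ∀ i : ℤ, uniformGrid h i ∈ K → |i| ≤ (n : ℤ) := fun i hi => by
      have h1 := hR' _ hi
      rw [uniformGrid, abs_mul, abs_of_pos hh, ← le_div_iff₀ hh] at h1
      exact_mod_cast h1.trans hn
    refine exists_tendsto_of_add_le (fun N => iSup_gridError_ne_top hu.isC12 (hU h N hh) hS)
      fun ε hε => ?_
    -- At fixed `h` only finitely many lattice points lie in `K`, so the Cauchy property at single
    -- nodes is uniform over `K`.
    have hev := (Finset.eventually_all (Finset.Icc (-(n : ℤ)) n)).2
      fun i _ => node_cauchy hT hb hh i hε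
    filter_upwards [hev, eventually_ge_atTop n] with N hN hnN N' hN'
    have hc : ∀ t ∈ S, ∀ i : ℤ, uniformGrid h i ∈ K →
        |ext (U h N t) i - ext (U h N' t) i| ≤ ε := fun t ht i hi =>
      hN i (by rw [Finset.mem_Icc, ← abs_le]; exact hKn i hi) N' hN' _ _ (hU h N hh) (hU h N' hh)
        t (hS ht)
    exact ⟨iSup_gridError_le_add (fun t ht i hi => by rw [abs_sub_comm]; exact hc t ht i hi)
        fun i hi => (hKn i hi).trans (by exact_mod_cast hnN),
      iSup_gridError_le_add hc
        fun i hi => (hKn i hi).trans (by exact_mod_cast hnN.trans hN')⟩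
  choose! l hl using hinner
  refine ⟨l, hl, ?_⟩
  -- Chosen so that `2 * b` is the weight at distance `|R|`, hence a lower bound for the weight on
  -- `K`.
  set b : ℝ := 1 / (2 * (1 + |R|)) with hbdef
  have hb0 : 0 < b := by positivity
  have hwb : ∀ (h : ℝ) (i : ℤ), uniformGrid h i ∈ K → 2 * b ≤ wt h i := fun h i hi => by
    have h1 := hR' _ hi
    have e : 2 * b = (1 + |R|)⁻¹ := by rw [hbdef]; field_simp
    rw [e, wt]
    gcongr
  have hσc : Continuous σ := hdata.contDiff_diffusion.continuous
  rw [← NNReal.tendsto_coe, NNReal.coe_zero]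
  refine Metric.tendsto_nhdsWithin_nhds.2 fun ε hε => ?_
  obtain ⟨h₀, hh₀, herr⟩ := eventually_error_le hT hb hσc hdata.diffusion_pos hu hb0 (half_pos hε)
  refine ⟨h₀, hh₀, fun {h} hh hlt => ?_⟩
  have hh' : 0 < h := hh
  rw [Real.dist_eq, sub_zero, abs_of_pos hh'] at hlt
  have hle : (l h : ℝ≥0∞) ≤ ENNReal.ofReal (ε / 2) := by
    refine le_of_tendsto (hl h hh') ?_
    filter_upwards [herr h hh' hlt] with N hN
    refine iSup₂_le fun t ht => iSup₂_le fun i hi => ENNReal.ofReal_le_ofReal ?_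
    rw [← ext_node (U h N t) i]
    exact hN _ (hU h N hh') t (hS ht) i (hwb h i hi)
  rw [Real.dist_eq, sub_zero, NNReal.abs_eq]
  have h1 : l h ≤ (ε / 2).toNNReal := ENNReal.coe_le_coe.1 hle
  have h2 : (l h : ℝ) ≤ ((ε / 2).toNNReal : ℝ) := by exact_mod_cast h1
  rw [Real.coe_toNNReal _ (half_pos hε).le] at h2
  linarith

end MethodOfLines

/-! ### Solvability and convergence combined -/

theorem mainTheorem3 (T : ℝ) (hT : 0 < T) (μ σ : ℝ → ℝ) (f : ℝ → ℝ → ℝ → ℝ → ℝ) (g : ℝ → ℝ)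
    (hcoef : MethodOfLines.LipschitzCoefficients μ σ)
    (hdata : MethodOfLines.WalterAssumption T μ σ f g)
    (hf : MethodOfLines.LipschitzDriver T f)
    (u : ℝ → ℝ → ℝ) (hu : MethodOfLines.IsUniqueClassicalSolution T μ σ f g u) :
    -- the systems of ordinary differential equations are uniquely solvable on `[0,T]`
    (∀ (Δx : ℝ) (N₀ : ℕ), 0 < Δx →
      (∃ U, MethodOfLines.IsODESolution T μ σ f g (MethodOfLines.uniformGrid Δx) N₀ U) ∧
      ∀ U V, MethodOfLines.IsODESolution T μ σ f g (MethodOfLines.uniformGrid Δx) N₀ U →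
        MethodOfLines.IsODESolution T μ σ f g (MethodOfLines.uniformGrid Δx) N₀ V →
        EqOn U V (Icc 0 T)) ∧
    -- and their solutions converge to `u`, for each time and uniformly in time
    ∀ U : (Δx : ℝ) → (N₀ : ℕ) → ℝ → MethodOfLines.Node N₀ → ℝ,
      (∀ (Δx : ℝ) (N₀ : ℕ), 0 < Δx →
        MethodOfLines.IsODESolution T μ σ f g (MethodOfLines.uniformGrid Δx) N₀ (U Δx N₀)) →
      ∀ K : Set ℝ, IsCompact K →
        (∀ t ∈ Icc 0 T, MethodOfLines.IteratedLimitZero fun Δx N₀ =>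
          MethodOfLines.gridError u K Δx N₀ (U Δx N₀) t) ∧
        MethodOfLines.IteratedLimitZero fun Δx N₀ =>
          ⨆ t ∈ Icc 0 T, MethodOfLines.gridError u K Δx N₀ (U Δx N₀) t := by
  refine ⟨fun Δx N₀ _ => ⟨MethodOfLines.exists_isODESolution hT hdata hf _ N₀,
    fun U V hU hV => MethodOfLines.isODESolution_unique hf hU hV⟩, fun U hU K hK => ⟨?_, ?_⟩⟩
  · intro t ht
    -- Convergence at a single time is the case of the one-point set of times.
    have h := MethodOfLines.iteratedLimitZero_gridError hT hcoef hdata hf hu.1 hU hK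
      (singleton_subset_iff.2 ht)
    simpa only [mem_singleton_iff, iSup_iSup_eq_left] using h
  · exact MethodOfLines.iteratedLimitZero_gridError hT hcoef hdata hf hu.1 hU hK Subset.rfl
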